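/- Let $(\Omega,\mathcal F,(\mathcal F_t)_{t\ge 0},\mathbb P)$ be a filtered probability space satisfying the usual conditions, and let $B$ and $W$ be two independent standard $(\mathcal F_t)$-Brownian motions. Let $H\in(0,1)$ and let $B^H$ be the (continuous) fractional Brownian motion generated by $B$, i.e. $B^H_t=\int_0^t K_H(t,s)\,dB_s$ with the Molchan--Golosov kernel $$K_H(t,s)=c_H\,(t-s)^{H-\frac12}\,F\!\left(H-\tfrac12,\tfrac12-H,H+\tfrac12;1-\tfrac ts\right)\mathbf 1_{[0,t]}(s),\qquad c_H=\left[\frac{2H\,\Gamma(\frac32-H)}{\Gamma(2-2H)\,\Gamma(H+\frac12)}\right]^{1/2},$$ where $F$ is the Gauss hypergeometric function. Let $s_0>0$, $a_0>0$, $\nu\in\mathbb R\setminus\{0\}$, $\rho\in(-1,1)$, $\bar\rho=\sqrt{1-\rho^2}$, and let $(S,\alpha)$ be the lognormal fractional SABR model: $\alpha_t=a_0e^{\nu B^H_t}$ and $S$ is a continuous adapted solution of $$S_t=s_0+\int_0^t\alpha_rS_r\,(\rho\,dB_r+\bar\rho\,dW_r),\qquad t\ge 0.$$ Put $v_t=\int_0^te^{2\nu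 B^H_s}\,ds$. Then for every $t>0$ the law of $(S_t,\alpha_t)$ is absolutely continuous with respect to Lebesgue measure on $\mathbb R^2$, and its density $q(t;s,a)$ vanishes for almost every $(s,a)\notin(0,\infty)^2$, while for almost every $(s,a)\in(0,\infty)^2$ $$q(t;s,a)=\frac{e^{-\frac{(\ln(a/a_0))^2}{2\nu^2t^{2H}}}}{a\sqrt{2\pi\nu^2t^{2H}}}\,\frac1{2\pi s}\int_{\mathbb R}\left(\frac s{s_0}\right)^{i\xi}\mathbb E\!\left[\left.e^{i\left(-\rho\int_0^ta_0e^{\nu B^H_s}dB_s+\frac{a_0^2v_t}2\right)\xi}\,e^{-\frac{\bar\rho^2a_0^2v_t}2\xi^2}\,\right|\,B^H_t=\frac{\ln(a/a_0)}\nu\right]d\xi,$$ where the Itô integral $\int_0^ta_0e^{\nu B^H_s}dB_s$ exists, the conditional expectations are computed with a regular conditional distribution given $B^H_t$, and the integral over $\xi$ converges absolutely. -/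

import Mathlib

open MeasureTheory ProbabilityTheory Filter Topology
open scoped NNReal ENNReal

/-- The usual conditions: the filtration is right-continuous and its initial `σ`-algebra contains
every `P`-null set (`P N` is the outer measure of `N`, so this also makes `P` complete). -/
structure UsualConditions {Ω : Type*} {mΩ : MeasurableSpace Ω} (F : Filtration ℝ≥0 mΩ)
    (P : Measure Ω) : Prop where
  rightContinuous : F.IsRightContinuous
  complete : ∀ N : Set Ω, P N = 0 → MeasurableSet[F 0] N

/-- A standard Brownian motion relative to the filtration `F`. -/
structure IsFilteredBrownian {Ω : Type*} {mΩ : MeasurableSpace Ω} (F : Filtration ℝ≥0 mΩ)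
    (P : Measure Ω) (B : ℝ≥0 → Ω → ℝ) : Prop where
  brownian : IsBrownianReal B P
  adapted : Adapted F B
  indep : ∀ s t : ℝ≥0, s ≤ t →
    Indep (F s) (MeasurableSpace.comap (fun ω => B t ω - B s ω) inferInstance) P

/-- A simple predictable process `∑ i, ξ i * 𝟙_{(left i, right i]}`, where each `ξ i` is bounded
and measurable with respect to `F (left i)`. -/
structure SimpleProcess {Ω : Type*} {mΩ : MeasurableSpace Ω} (F : Filtration ℝ≥0 mΩ) where
  n : ℕ
  left : Fin n → ℝ≥0
  right : Fin n → ℝ≥0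
  le : ∀ i, left i ≤ right i
  ξ : Fin n → Ω → ℝ
  measurable : ∀ i, Measurable[F (left i)] (ξ i)
  bounded : ∀ i, ∃ C : ℝ, ∀ ω, |ξ i ω| ≤ C

/-- The value at time `s` of a simple process. -/
noncomputable def SimpleProcess.eval {Ω : Type*} {mΩ : MeasurableSpace Ω}
    {F : Filtration ℝ≥0 mΩ} (V : SimpleProcess F) (s : ℝ≥0) (ω : Ω) : ℝ :=
  ∑ i, (Set.Ioc (V.left i) (V.right i)).indicator (fun _ => V.ξ i ω) s

/-- The elementary stochastic integral `∫₀ᵗ V dB` of a simple process. -/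
noncomputable def SimpleProcess.integral {Ω : Type*} {mΩ : MeasurableSpace Ω}
    {F : Filtration ℝ≥0 mΩ} (V : SimpleProcess F) (B : ℝ≥0 → Ω → ℝ) (t : ℝ≥0) (ω : Ω) : ℝ :=
  ∑ i, V.ξ i ω * (B (min (V.right i) t) ω - B (min (V.left i) t) ω)

/-- `I` is (a version of) the Itô integral `∫₀ᵗ G dB`: for some simple predictable processes `V n`
one has `∫₀ᵗ |V n - G|² ds → 0` and `∫₀ᵗ V n dB → I` in probability. -/
def IsItoIntegral {Ω : Type*} {mΩ : MeasurableSpace Ω} (F : Filtration ℝ≥0 mΩ) (P : Measure Ω)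
    (B : ℝ≥0 → Ω → ℝ) (G : ℝ≥0 → Ω → ℝ) (t : ℝ≥0) (I : Ω → ℝ) : Prop :=
  (∀ᵐ ω ∂P, AEMeasurable (fun s : ℝ => G s.toNNReal ω)
    (volume.restrict (Set.Ioc 0 (t : ℝ)))) ∧
  ∃ V : ℕ → SimpleProcess F,
    (∀ ε : ℝ≥0∞, 0 < ε → Tendsto (fun n => P {ω | ε ≤
      ∫⁻ s : ℝ in Set.Ioc 0 (t : ℝ),
        ‖(V n).eval s.toNNReal ω - G s.toNNReal ω‖ₑ ^ 2}) atTop (𝓝 0)) ∧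
    TendstoInMeasure P (fun n => (V n).integral B t) atTop I

/-- The Gauss hypergeometric function `F(a, b, c; z)` for real `z < 1`: on `[0, 1)` it is the Gauss
series; on `(-∞, 0)` it is the analytic continuation of the series, written through the Pfaff
transformation `F(a, b, c; z) = (1 - z)^(-a) F(a, c - b, c; z / (z - 1))`, whose right-hand side is
a convergent series because `z / (z - 1) ∈ (0, 1)` (and which is the series itself on `(-1, 0)`). -/
noncomputable def gaussHypergeometric (a b c z : ℝ) : ℝ :=
  if z < 0 then (1 - z) ^ (-a) * ordinaryHypergeometric a (c - b) c (z / (z - 1))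
  else ordinaryHypergeometric a b c z

/-- The constant `c_H` of the Molchan-Golosov kernel. -/
noncomputable def molchanGolosovConst (H : ℝ) : ℝ :=
  √(2 * H * Real.Gamma (3 / 2 - H) / (Real.Gamma (2 - 2 * H) * Real.Gamma (H + 1 / 2)))

/-- The Molchan-Golosov kernel `K_H(t, s)`. -/
noncomputable def molchanGolosov (H t s : ℝ) : ℝ :=
  (Set.Icc 0 t).indicator (fun s => molchanGolosovConst H * (t - s) ^ (H - 1 / 2) *
    gaussHypergeometric (H - 1 / 2) (1 / 2 - H) (H + 1 / 2) (1 - t / s)) s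

/-- `BH` is the (continuous) fractional Brownian motion of Hurst exponent `H` generated by the
Brownian motion `B`, that is `BH t = ∫₀ᵗ K_H(t, s) dB_s`. -/
structure IsFractionalBrownian {Ω : Type*} {mΩ : MeasurableSpace Ω} (F : Filtration ℝ≥0 mΩ)
    (P : Measure Ω) (B : ℝ≥0 → Ω → ℝ) (H : ℝ) (BH : ℝ≥0 → Ω → ℝ) : Prop where
  continuous : ∀ᵐ ω ∂P, Continuous (fun t => BH t ω)
  integral : ∀ t : ℝ≥0, IsItoIntegral F P B (fun s _ => molchanGolosov H t s) t (BH t)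

/-- The volatility process `α_t = a₀ exp(ν B^H_t)`. -/
noncomputable def fsabrVol {Ω : Type*} (a₀ ν : ℝ) (BH : ℝ≥0 → Ω → ℝ) (t : ℝ≥0) (ω : Ω) : ℝ :=
  a₀ * Real.exp (ν * BH t ω)

/-- `S` is a continuous adapted solution of `S_t = s₀ + ∫₀ᵗ α_r S_r (ρ dB_r + √(1 - ρ²) dW_r)`. -/
structure IsFSABRSpot {Ω : Type*} {mΩ : MeasurableSpace Ω} (F : Filtration ℝ≥0 mΩ)
    (P : Measure Ω) (B W : ℝ≥0 → Ω → ℝ) (s₀ ρ : ℝ) (α S : ℝ≥0 → Ω → ℝ) : Prop where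
  adapted : Adapted F S
  continuous : ∀ᵐ ω ∂P, Continuous (fun t => S t ω)
  sde : ∀ t : ℝ≥0, ∃ I J : Ω → ℝ,
    IsItoIntegral F P B (fun r ω => α r ω * S r ω) t I ∧
    IsItoIntegral F P W (fun r ω => α r ω * S r ω) t J ∧
    ∀ᵐ ω ∂P, S t ω = s₀ + (ρ * I ω + √(1 - ρ ^ 2) * J ω)

/-- `v_t = ∫₀ᵗ exp(2 ν B^H_s) ds`. -/
noncomputable def integratedVar {Ω : Type*} (ν : ℝ) (BH : ℝ≥0 → Ω → ℝ) (t : ℝ≥0) (ω : Ω) : ℝ :=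
  ∫ s in (0 : ℝ)..t, Real.exp (2 * ν * BH s.toNNReal ω)

/-- The conditional expectation
`E[exp(i (-ρ Z + a₀² v_t / 2) ξ) exp(-(1 - ρ²) a₀² v_t ξ² / 2) | B^H_t = η]`,
computed with the regular conditional distribution of `(Z, v_t)` given `B^H_t`; in use,
`Z = ∫₀ᵗ a₀ exp(ν B^H_s) dB_s`. -/
noncomputable def bridgeCondExp {Ω : Type*} {mΩ : MeasurableSpace Ω} (P : Measure Ω)
    [IsFiniteMeasure P] (BH : ℝ≥0 → Ω → ℝ) (ν ρ a₀ : ℝ) (t : ℝ≥0) (Z : Ω → ℝ) (η ξ : ℝ) : ℂ :=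
  ∫ z : ℝ × ℝ,
    Complex.exp (Complex.I * ((-ρ * z.1 + a₀ ^ 2 * z.2 / 2 : ℝ) : ℂ) * (ξ : ℂ)) *
      ((Real.exp (-((1 - ρ ^ 2) * a₀ ^ 2 * z.2 / 2 * ξ ^ 2)) : ℝ) : ℂ)
    ∂(condDistrib (fun ω => (Z ω, integratedVar ν BH t ω)) (BH t) P η)

/-! Given the path of B, the volatility is known and log S_t is Gaussian. Write Z = ∫α dB and Y = ∫α
dW over [0, t], and ρ' = √(1-ρ²). The linear equation forces S_t = s₀ exp(ρZ + ρ'Y - a₀²v_t/2).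
Since W is independent of B, Y is distributed, given B, as √(a₀²v_t) times a standard normal N.
Hence (log(S_t/s₀), B^H_t) has the law of (m + √V N, B^H_t) with m = ρZ - a₀²v_t/2 and V = ρ'²a₀²v_t
(`IsItoIntegral.map_add_mul_prodMk`). Disintegrating over B^H_t, whose law is N(0, t^{2H}), the
joint density is the density of B^H_t times the conditional mean of the N(m, V) density
(`map_mixture_eq_withDensity`), and passing from logarithms to (s, a) adds a Jacobian.

The integral over ξ is the Fourier representation of the N(m, V) density, exchanged with the
conditional expectation. Fubini applies as soon as V^{-1/2} has finite conditional mean. This holds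
for almost every value of B^H_t because E[v_t^{-1/2}] is finite: by Jensen, v_t^{-1/2} is at most a
constant times ∫ exp(-νB^H_s) ds, which has Gaussian exponential moments.

Three ingredients are built from elementary estimates. (1) Itô integration rests on the
Lenglart-type inequality `measure_exists_le_abs_sum_le`: a martingale transform is small in
probability when its energy is. This yields existence and uniqueness of the integral and convergence
of Riemann sums for continuous integrands. (2) The exponential formula avoids Itô's formula. A
discrete Gronwall argument shows that the Euler products s₀∏(1 + αΔM), with M = ρB + ρ'W, converge
to S_t; expanding log(1 + x) to second order and using the quadratic variation identifies their
limit with the exponential (`ae_eq_mul_exp_of_sde`). (3) The variance of B^H_t is the squared norm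
of the kernel. After the Pfaff transformation the hypergeometric factor satisfies a first-order
equation, which supplies an explicit antiderivative of the squared kernel (`hypPhi`); its boundary
values are beta integrals, and c_H is exactly the normalisation that they require. -/

section Noise

/-! ### Square-integrable martingale transforms and a maximal inequality. -/

variable {Ω : Type*} {m mΩ : MeasurableSpace Ω} {P : Measure Ω}

/-- `ζ` behaves, in `L²`, like an increment with conditional mean zero and conditional second moment
at most `c` given the `σ`-algebra `m`. -/
def IsNoise {Ω : Type*} (m : MeasurableSpace Ω) {mΩ : MeasurableSpace Ω} (P : Measure Ω) (ζ : Ω → ℝ)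
    (c : ℝ) : Prop :=
  ∀ X : Ω → ℝ, Measurable[m] X → MemLp X 2 P →
    MemLp (fun ω => X ω * ζ ω) 2 P ∧ ∫ ω, (X ω * ζ ω) ^ 2 ∂P ≤ c * ∫ ω, X ω ^ 2 ∂P ∧
    ∀ Y : Ω → ℝ, Measurable[m] Y → MemLp Y 2 P → ∫ ω, Y ω * (X ω * ζ ω) ∂P = 0

theorem IsNoise.of_indep [IsProbabilityMeasure P] (hm : m ≤ mΩ) {ζ : Ω → ℝ}
    (hζ : MemLp ζ 2 P) (hζm : Measurable ζ)
    (hind : Indep m (MeasurableSpace.comap ζ inferInstance) P) (h0 : ∫ ω, ζ ω ∂P = 0) {c : ℝ}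
    (hc : ∫ ω, ζ ω ^ 2 ∂P = c) : IsNoise m P ζ c := by
  intro X hX hX2
  have hXm : Measurable X := hX.mono hm le_rfl
  have indep : ∀ Y : Ω → ℝ, Measurable[m] Y → IndepFun Y ζ P := by
    intro Y hY
    rw [IndepFun_iff_Indep]
    exact indep_of_indep_of_le_left hind (measurable_iff_comap_le.1 hY)
  have hX2' : Integrable (fun ω => X ω ^ 2) P := hX2.integrable_sq
  have hζ2' : Integrable (fun ω => ζ ω ^ 2) P := hζ.integrable_sq
  have hi : IndepFun (fun ω => X ω ^ 2) (fun ω => ζ ω ^ 2) P :=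
    (indep X hX).comp (φ := fun x => x ^ 2) (ψ := fun x => x ^ 2) (by fun_prop) (by fun_prop)
  refine ⟨?_, ?_, ?_⟩
  · refine (memLp_two_iff_integrable_sq (hXm.mul hζm).aestronglyMeasurable).2 ?_
    have := hi.integrable_mul hX2' hζ2'
    refine this.congr (ae_of_all _ fun ω => ?_)
    simp [mul_pow]
  · have := hi.integral_mul_eq_mul_integral hX2'.aestronglyMeasurable hζ2'.aestronglyMeasurable
    simp only [mul_pow]
    simp only [Pi.mul_def] at this
    rw [this, hc, mul_comm]
  · intro Y hY hY2
    have hYX : Measurable[m] (fun ω => Y ω * X ω) := hY.mul hX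
    have := (indep _ hYX).integral_mul_eq_mul_integral
      (hYX.mono hm le_rfl).aestronglyMeasurable hζm.aestronglyMeasurable
    simp only [Pi.mul_def] at this
    simp only [← mul_assoc]
    rw [this, h0, mul_zero]

/-- The factor 2 is from (x + y)² ≤ 2x² + 2y². No relation between the two noises is needed, and
only an upper bound on the variance is ever used. -/
theorem IsNoise.linear_comb {ζ₁ ζ₂ : Ω → ℝ} {c₁ c₂ : ℝ}
    (h₁ : IsNoise m P ζ₁ c₁) (h₂ : IsNoise m P ζ₂ c₂) (a b : ℝ) :
    IsNoise m P (fun ω => a * ζ₁ ω + b * ζ₂ ω) (2 * (a ^ 2 * c₁ + b ^ 2 * c₂)) := by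
  intro X hX hX2
  obtain ⟨m1, v1, o1⟩ := h₁ X hX hX2
  obtain ⟨m2, v2, o2⟩ := h₂ X hX hX2
  have e : (fun ω => X ω * (a * ζ₁ ω + b * ζ₂ ω)) =
      fun ω => a * (X ω * ζ₁ ω) + b * (X ω * ζ₂ ω) := by ext; ring
  refine ⟨?_, ?_, ?_⟩
  · rw [e]; exact (m1.const_mul a).add (m2.const_mul b)
  · calc ∫ ω, (X ω * (a * ζ₁ ω + b * ζ₂ ω)) ^ 2 ∂P
        ≤ ∫ ω, (2 * a ^ 2 * (X ω * ζ₁ ω) ^ 2 + 2 * b ^ 2 * (X ω * ζ₂ ω) ^ 2) ∂P := by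
          apply integral_mono_of_nonneg (ae_of_all _ fun ω => sq_nonneg _)
            ((m1.integrable_sq.const_mul _).add (m2.integrable_sq.const_mul _))
          refine ae_of_all _ fun ω => ?_
          simp only [Pi.add_apply]
          nlinarith [sq_nonneg (a * (X ω * ζ₁ ω) - b * (X ω * ζ₂ ω))]
      _ = 2 * a ^ 2 * ∫ ω, (X ω * ζ₁ ω) ^ 2 ∂P + 2 * b ^ 2 * ∫ ω, (X ω * ζ₂ ω) ^ 2 ∂P := by
          rw [integral_add (m1.integrable_sq.const_mul _) (m2.integrable_sq.const_mul _),
            integral_const_mul, integral_const_mul]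
      _ ≤ 2 * a ^ 2 * (c₁ * ∫ ω, X ω ^ 2 ∂P) + 2 * b ^ 2 * (c₂ * ∫ ω, X ω ^ 2 ∂P) := by gcongr
      _ = _ := by ring
  · intro Y hY hY2
    have i1 : Integrable (fun ω => Y ω * (X ω * ζ₁ ω)) P := hY2.integrable_mul m1
    have i2 : Integrable (fun ω => Y ω * (X ω * ζ₂ ω)) P := hY2.integrable_mul m2
    have e' : (fun ω => Y ω * (X ω * (a * ζ₁ ω + b * ζ₂ ω))) =
        fun ω => a * (Y ω * (X ω * ζ₁ ω)) + b * (Y ω * (X ω * ζ₂ ω)) := by ext; ring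
    rw [e', integral_add (i1.const_mul a) (i2.const_mul b), integral_const_mul, integral_const_mul,
      o1 Y hY hY2, o2 Y hY hY2]
    simp

/-- One step of a martingale transform. -/
theorem IsNoise.memLp_add {ζ : Ω → ℝ} {c : ℝ} (h : IsNoise m P ζ c)
    {X Y : Ω → ℝ} (hX : Measurable[m] X) (hX2 : MemLp X 2 P) (hY2 : MemLp Y 2 P) :
    MemLp (fun ω => Y ω + X ω * ζ ω) 2 P :=
  hY2.add (h X hX hX2).1

/-- The cross term vanishes by orthogonality, so second moments add. -/
theorem IsNoise.integral_add_sq_le {ζ : Ω → ℝ} {c : ℝ}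
    (h : IsNoise m P ζ c) {X Y : Ω → ℝ} (hX : Measurable[m] X) (hX2 : MemLp X 2 P)
    (hY : Measurable[m] Y) (hY2 : MemLp Y 2 P) :
    ∫ ω, (Y ω + X ω * ζ ω) ^ 2 ∂P ≤ ∫ ω, Y ω ^ 2 ∂P + c * ∫ ω, X ω ^ 2 ∂P := by
  obtain ⟨m1, v1, o1⟩ := h X hX hX2
  have i1 : Integrable (fun ω => Y ω * (X ω * ζ ω)) P := hY2.integrable_mul m1
  have e : (fun ω => (Y ω + X ω * ζ ω) ^ 2) =
      fun ω => (Y ω ^ 2 + 2 * (Y ω * (X ω * ζ ω))) + (X ω * ζ ω) ^ 2 := by ext; ring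
  have i2 : Integrable (fun ω => Y ω ^ 2 + 2 * (Y ω * (X ω * ζ ω))) P :=
    hY2.integrable_sq.add (i1.const_mul 2)
  rw [e, integral_add i2 m1.integrable_sq, integral_add hY2.integrable_sq (i1.const_mul 2), integral_const_mul, o1 Y hY hY2]
  linarith

section Sum

variable {𝒢 : ℕ → MeasurableSpace Ω} {ζ U : ℕ → Ω → ℝ} {c : ℕ → ℝ}

theorem measurable_sum_mul_noise (hmono : Monotone 𝒢) (hζm : ∀ j, Measurable[𝒢 (j + 1)] (ζ j))
    (hU : ∀ j, Measurable[𝒢 j] (U j)) (k : ℕ) :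
    Measurable[𝒢 k] (fun ω => ∑ j ∈ Finset.range k, U j ω * ζ j ω) := by
  refine Finset.measurable_fun_sum _ fun j hj => ?_
  have hj' : j + 1 ≤ k := Finset.mem_range.1 hj
  exact ((hU j).mono (hmono (by omega)) le_rfl).mul ((hζm j).mono (hmono hj') le_rfl)

theorem memLp_sum_mul_noise (hζ : ∀ j, IsNoise (𝒢 j) P (ζ j) (c j))
    (hU : ∀ j, Measurable[𝒢 j] (U j)) (hU2 : ∀ j, MemLp (U j) 2 P) (k : ℕ) :
    MemLp (fun ω => ∑ j ∈ Finset.range k, U j ω * ζ j ω) 2 P :=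
  memLp_finsetSum _ fun j _ => (hζ j (U j) (hU j) (hU2 j)).1

/-- The Itô isometry in discrete form, as an inequality. -/
theorem integral_sum_mul_noise_sq_le (hmono : Monotone 𝒢)
    (hζm : ∀ j, Measurable[𝒢 (j + 1)] (ζ j)) (hζ : ∀ j, IsNoise (𝒢 j) P (ζ j) (c j))
    (hU : ∀ j, Measurable[𝒢 j] (U j)) (hU2 : ∀ j, MemLp (U j) 2 P) (k : ℕ) :
    ∫ ω, (∑ j ∈ Finset.range k, U j ω * ζ j ω) ^ 2 ∂P ≤
      ∑ j ∈ Finset.range k, c j * ∫ ω, U j ω ^ 2 ∂P := by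
  induction k with
  | zero => simp
  | succ k ih =>
    simp only [Finset.sum_range_succ]
    exact ((hζ k).integral_add_sq_le (hU k) (hU2 k) (measurable_sum_mul_noise hmono hζm hU k)
      (memLp_sum_mul_noise hζ hU hU2 k)).trans (by linarith)

/-- A maximal inequality of Lenglart type for martingale transforms. -/
theorem measure_exists_le_abs_sum_le [IsProbabilityMeasure P] (hmono : Monotone 𝒢)
    (hle : ∀ j, 𝒢 j ≤ mΩ) (hζm : ∀ j, Measurable[𝒢 (j + 1)] (ζ j)) (hc : ∀ j, 0 < c j)
    (hζ : ∀ j, IsNoise (𝒢 j) P (ζ j) (c j)) (hU : ∀ j, Measurable[𝒢 j] (U j)) (A : Set Ω) (n : ℕ)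
    {ε δ : ℝ} (hε : 0 < ε) (hδ : 0 < δ) :
    P (A ∩ {ω | ∃ k ≤ n, ε ≤ |∑ j ∈ Finset.range k, U j ω * ζ j ω|}) ≤
      P (A ∩ {ω | δ < ∑ j ∈ Finset.range n, c j * U j ω ^ 2}) + ENNReal.ofReal (δ / ε ^ 2) := by
  classical
  set N : ℕ → Ω → ℝ := fun k ω => ∑ j ∈ Finset.range k, U j ω * ζ j ω with hN
  set Q : ℕ → Ω → ℝ := fun k ω => ∑ j ∈ Finset.range k, c j * U j ω ^ 2 with hQ
  have hQmono : ∀ ω, Monotone fun k => Q k ω := fun ω =>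
    monotone_nat_of_le_succ fun k => by
      simp only [hQ, Finset.sum_range_succ]
      have := mul_nonneg (hc k).le (sq_nonneg (U k ω))
      linarith
  -- Stopping rule: step j is kept while the energy including step j stays at most δ and no earlier
  -- partial sum has reached ε. Since U is predictable, Q (j + 1) is already known at time j, so the
  -- energy never overshoots δ.
  set good : ℕ → Set Ω := fun j => {ω | Q (j + 1) ω ≤ δ ∧ ∀ l ∈ Finset.range (j + 1), |N l ω| < ε}
    with hgood
  have hNm : ∀ k, Measurable[𝒢 k] (N k) := measurable_sum_mul_noise hmono hζm hU
  have hgm : ∀ j, MeasurableSet[𝒢 j] (good j) := by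
    intro j
    have h1 : Measurable[𝒢 j] (Q (j + 1)) := by
      refine Finset.measurable_fun_sum _ fun i hi => ?_
      have hi' : i ≤ j := by have := Finset.mem_range.1 hi; omega
      exact (((hU i).mono (hmono hi') le_rfl).pow_const 2).const_mul _
    have e : good j = {ω | Q (j + 1) ω ≤ δ} ∩ ⋂ l ∈ Finset.range (j + 1), {ω | |N l ω| < ε} := by
      ext ω; simp [hgood]
    rw [e]
    refine MeasurableSet.inter (h1 measurableSet_Iic) ?_
    refine Finset.measurableSet_biInter _ fun l hl => ?_
    have hl' : l ≤ j := by have := Finset.mem_range.1 hl; omega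
    have h2 : Measurable[𝒢 j] (N l) := (hNm l).mono (hmono hl') le_rfl
    have h3 : Measurable[𝒢 j] (fun ω => |N l ω|) := measurable_abs.comp h2
    exact h3 measurableSet_Iio
  set U' : ℕ → Ω → ℝ := fun j => (good j).indicator (U j) with hU'
  have hU'm : ∀ j, Measurable[𝒢 j] (U' j) := fun j => (hU j).indicator (hgm j)
  have hQ' : ∀ k ω, ∑ j ∈ Finset.range k, c j * U' j ω ^ 2 ≤ δ := by
    intro k ω
    induction k with
    | zero => simpa using hδ.le
    | succ k ih =>
      by_cases hk : ω ∈ good k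
      · refine le_trans (Finset.sum_le_sum fun j _ => ?_) hk.1
        refine mul_le_mul_of_nonneg_left ?_ (hc j).le
        simp only [hU', Set.indicator]
        split_ifs
        · exact le_rfl
        · simpa using sq_nonneg _
      · rw [Finset.sum_range_succ]
        have : U' k ω = 0 := Set.indicator_of_notMem hk _
        rw [this]; simpa using ih
  -- The energy bound together with c j > 0 bounds each stopped coefficient, so U itself needs no
  -- integrability.
  have hU'2 : ∀ j, MemLp (U' j) 2 P := by
    intro j
    refine MemLp.of_bound ((hU'm j).mono (hle j) le_rfl).aestronglyMeasurable (√(δ / c j))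
      (ae_of_all _ fun ω => ?_)
    rw [Real.norm_eq_abs]
    apply Real.abs_le_sqrt
    rw [le_div_iff₀ (hc j)]
    have h1 := hQ' (j + 1) ω
    rw [Finset.sum_range_succ] at h1
    have h2 : 0 ≤ ∑ i ∈ Finset.range j, c i * U' i ω ^ 2 :=
      Finset.sum_nonneg fun i _ => mul_nonneg (hc i).le (sq_nonneg _)
    linarith
  set N' : Ω → ℝ := fun ω => ∑ j ∈ Finset.range n, U' j ω * ζ j ω with hN'
  have hN'2 : ∫ ω, N' ω ^ 2 ∂P ≤ δ := by
    refine (integral_sum_mul_noise_sq_le hmono hζm hζ hU'm hU'2 n).trans ?_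
    have hi : ∀ j, Integrable (fun ω => c j * U' j ω ^ 2) P := fun j =>
      (hU'2 j).integrable_sq.const_mul _
    simp_rw [← integral_const_mul]
    rw [← integral_finsetSum _ fun j _ => hi j]
    calc ∫ ω, ∑ j ∈ Finset.range n, c j * U' j ω ^ 2 ∂P ≤ ∫ _, δ ∂P :=
          integral_mono (integrable_finsetSum _ fun j _ => hi j) (integrable_const δ) (hQ' n)
      _ = δ := by simp
  have hcheb : P {ω | ε ^ 2 ≤ N' ω ^ 2} ≤ ENNReal.ofReal (δ / ε ^ 2) := by
    have h1 := mul_meas_ge_le_integral_of_nonneg (μ := P) (f := fun ω => N' ω ^ 2)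
      (ae_of_all _ fun ω => sq_nonneg _)
      (memLp_sum_mul_noise hζ hU'm hU'2 n).integrable_sq (ε ^ 2)
    rw [← ofReal_measureReal]
    apply ENNReal.ofReal_le_ofReal
    rw [le_div_iff₀ (by positivity)]
    linarith
  calc _ ≤ P ((A ∩ {ω | δ < Q n ω}) ∪ {ω | ε ^ 2 ≤ N' ω ^ 2}) := by
        apply measure_mono
        rintro ω ⟨hA, hω⟩
        by_cases hq : δ < Q n ω
        · exact Or.inl ⟨hA, hq⟩
        refine Or.inr ?_
        rw [not_lt] at hq
        have hex : ∃ k, k ≤ n ∧ ε ≤ |N k ω| := hω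
        set k := Nat.find hex with hk
        obtain ⟨hkn, hkε⟩ : k ≤ n ∧ ε ≤ |N k ω| := Nat.find_spec hex
        have hmin : ∀ l < k, |N l ω| < ε := by
          intro l hl
          by_contra hcon
          exact Nat.find_min hex hl ⟨by omega, not_lt.1 hcon⟩
        -- k is the first time that the sum reaches ε: every step before k is kept and every later
        -- one is dropped.
        have key : N' ω = N k ω := by
          simp only [hN', hN]
          rw [← Finset.sum_range_add_sum_Ico _ hkn]
          rw [Finset.sum_congr rfl (g := fun j => U j ω * ζ j ω), add_eq_left]
          · refine Finset.sum_eq_zero fun j hj => ?_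
            have hj' := (Finset.mem_Ico.1 hj).1
            have : ω ∉ good j := by
              intro h
              have := h.2 k (Finset.mem_range.2 (by omega))
              linarith
            simp [hU', Set.indicator_of_notMem this]
          · intro j hj
            have hj' := Finset.mem_range.1 hj
            have : ω ∈ good j :=
              ⟨(hQmono ω (by omega : j + 1 ≤ n)).trans hq, fun l hl => hmin l (by
                have := Finset.mem_range.1 hl; omega)⟩
            simp [hU', Set.indicator_of_mem this]
        simp only [Set.mem_ofPred_eq, key]
        rw [← sq_abs (N k ω)]
        gcongr
    _ ≤ _ := (measure_union_le _ _).trans (by gcongr)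

end Sum

end Noise

/-! ### Convergence in measure of real random variables. -/

section InMeasure

variable {Ω κ : Type*} {mΩ : MeasurableSpace Ω} {P : Measure Ω}

theorem tendsto_zero_of_forall_eventually_le_ofReal {l : Filter κ} {u : κ → ℝ≥0∞}
    (h : ∀ η : ℝ, 0 < η → ∀ᶠ k in l, u k ≤ ENNReal.ofReal η) : Tendsto u l (𝓝 0) := by
  rw [ENNReal.tendsto_nhds_zero]
  intro ε hε
  obtain ⟨η, hη0, hη⟩ : ∃ η : ℝ, 0 < η ∧ ENNReal.ofReal η ≤ ε := by
    rcases eq_or_ne ε ⊤ with rfl | hne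
    · exact ⟨1, one_pos, le_top⟩
    · exact ⟨ε.toReal, ENNReal.toReal_pos hε.ne' hne, ENNReal.ofReal_toReal_le⟩
  exact (h η hη0).mono fun k hk => hk.trans hη

theorem eventually_le_ofReal_of_tendsto_zero {l : Filter κ} {u : κ → ℝ≥0∞}
    (h : Tendsto u l (𝓝 0)) {η : ℝ} (hη : 0 < η) : ∀ᶠ k in l, u k ≤ ENNReal.ofReal η :=
  ENNReal.tendsto_nhds_zero.1 h _ (ENNReal.ofReal_pos.2 hη)

theorem tendstoInMeasure_real_iff {l : Filter κ} {f : κ → Ω → ℝ} {g : Ω → ℝ} :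
    TendstoInMeasure P f l g ↔
      ∀ ε : ℝ, 0 < ε → Tendsto (fun k => P {ω | ε ≤ |f k ω - g ω|}) l (𝓝 0) := by
  simp only [tendstoInMeasure_iff_norm, Real.norm_eq_abs]

theorem MeasureTheory.TendstoInMeasure.add_real {l : Filter κ} {f f' : κ → Ω → ℝ} {g g' : Ω → ℝ}
    (h : TendstoInMeasure P f l g) (h' : TendstoInMeasure P f' l g') :
    TendstoInMeasure P (fun k ω => f k ω + f' k ω) l (fun ω => g ω + g' ω) := by
  rw [tendstoInMeasure_real_iff] at *
  intro ε hε
  have h2 := (h (ε / 2) (by positivity)).add (h' (ε / 2) (by positivity))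
  rw [add_zero] at h2
  refine tendsto_of_tendsto_of_tendsto_of_le_of_le tendsto_const_nhds h2 (fun _ => zero_le)
    fun k => (measure_mono ?_).trans (measure_union_le _ _)
  intro ω hω
  by_contra hcon
  simp only [Set.mem_union, Set.mem_ofPred_eq, not_or, not_le] at hcon hω
  have := abs_add_le (f k ω - g ω) (f' k ω - g' ω)
  rw [show f k ω - g ω + (f' k ω - g' ω) = f k ω + f' k ω - (g ω + g' ω) by ring] at this
  linarith [hcon.1, hcon.2]

theorem MeasureTheory.TendstoInMeasure.const_mul_real {l : Filter κ} {f : κ → Ω → ℝ} {g : Ω → ℝ}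
    (h : TendstoInMeasure P f l g) (c : ℝ) :
    TendstoInMeasure P (fun k ω => c * f k ω) l (fun ω => c * g ω) := by
  rw [tendstoInMeasure_real_iff] at *
  intro ε hε
  refine tendsto_of_tendsto_of_tendsto_of_le_of_le tendsto_const_nhds
    (h (ε / (|c| + 1)) (by positivity)) (fun _ => zero_le) fun k => measure_mono ?_
  intro ω hω
  simp only [Set.mem_ofPred_eq] at hω ⊢
  rw [← mul_sub, abs_mul] at hω
  rw [div_le_iff₀ (by positivity)]
  nlinarith [abs_nonneg (f k ω - g ω)]

theorem MeasureTheory.TendstoInMeasure.of_sub {l : Filter κ} {f f' : κ → Ω → ℝ} {g : Ω → ℝ}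
    (h : TendstoInMeasure P f l g)
    (h' : TendstoInMeasure P (fun k ω => f' k ω - f k ω) l (fun _ => 0)) :
    TendstoInMeasure P f' l g := by
  have := h.add_real h'
  simpa using this

/-- A sequence that is Cauchy in measure converges in measure. -/
theorem exists_tendstoInMeasure_of_cauchy [IsFiniteMeasure P] {f : ℕ → Ω → ℝ}
    (hfm : ∀ n, AEStronglyMeasurable (f n) P)
    (hf : TendstoInMeasure P (fun (p : ℕ × ℕ) ω => f p.1 ω - f p.2 ω) atTop (fun _ => 0)) :
    ∃ g, TendstoInMeasure P f atTop g := by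
  rw [tendstoInMeasure_real_iff] at hf
  simp only [sub_zero] at hf
  have hc : ∀ k : ℕ, ∃ N, ∀ m ≥ N, ∀ n ≥ N,
      P {ω | (1 / 2 : ℝ) ^ k ≤ |f m ω - f n ω|} ≤ ENNReal.ofReal ((1 / 2 : ℝ) ^ k) := by
    intro k
    have := eventually_le_ofReal_of_tendsto_zero (hf ((1 / 2) ^ k) (by positivity))
      (η := (1 / 2) ^ k) (by positivity)
    obtain ⟨⟨a, b⟩, hab⟩ := eventually_atTop.1 this
    exact ⟨max a b, fun m hm n hn => hab (m, n)
      ⟨(le_max_left _ _).trans hm, (le_max_right _ _).trans hn⟩⟩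
  choose N hN using hc
  -- The running supremum dominates N k, and the added k makes the sequence strictly increasing.
  let φ : ℕ → ℕ := fun k => (Finset.range (k + 1)).sup N + k
  have hφN : ∀ k, N k ≤ φ k := fun k =>
    (Finset.le_sup (f := N) (Finset.mem_range.2 (Nat.lt_succ_self k))).trans (Nat.le_add_right _ _)
  have hφ : StrictMono φ := strictMono_nat_of_lt_succ fun k => by
    have : (Finset.range (k + 1)).sup N ≤ (Finset.range (k + 1 + 1)).sup N :=
      Finset.sup_mono (Finset.range_mono (by omega))
    simp only [φ]; omega
  -- Borel–Cantelli: almost surely the consecutive differences are eventually below a geometric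
  -- sequence.
  have hbc : P (limsup (fun k => {ω | (1 / 2 : ℝ) ^ k ≤ |f (φ k) ω - f (φ (k + 1)) ω|}) atTop)
      = 0 := by
    apply measure_limsup_atTop_eq_zero
    have hs : Summable (fun k : ℕ => (1 / 2 : ℝ) ^ k) := summable_geometric_two
    refine ne_top_of_le_ne_top ?_ (ENNReal.tsum_le_tsum fun k => hN k _ (hφN k) _
      ((hφN k).trans (hφ (Nat.lt_succ_self k)).le))
    rw [← ENNReal.ofReal_tsum_of_nonneg (fun _ => by positivity) hs]
    exact ENNReal.ofReal_ne_top
  have hlim : ∀ᵐ ω ∂P, ∃ x, Tendsto (fun k => f (φ k) ω) atTop (𝓝 x) := by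
    have := measure_eq_zero_iff_ae_notMem.1 hbc
    filter_upwards [this] with ω hω
    have hev : ∀ᶠ k in atTop, |f (φ k) ω - f (φ (k + 1)) ω| < (1 / 2 : ℝ) ^ k := by
      rw [mem_limsup_iff_frequently_mem, not_frequently] at hω
      exact hω.mono fun k hk => not_le.1 hk
    obtain ⟨K, hK⟩ := eventually_atTop.1 hev
    have hcs : CauchySeq (fun k => f (φ (k + K)) ω) := by
      refine cauchySeq_of_le_geometric (1 / 2) ((1 / 2) ^ K) (by norm_num) fun k => ?_
      rw [Real.dist_eq, ← pow_add, add_comm K k, show k + 1 + K = k + K + 1 by ring]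
      exact (hK (k + K) (by omega)).le
    obtain ⟨x, hx⟩ := cauchySeq_tendsto_of_complete hcs
    exact ⟨x, (tendsto_add_atTop_iff_nat K).1 hx⟩
  classical
  let g : Ω → ℝ := fun ω =>
    if h : ∃ x, Tendsto (fun k => f (φ k) ω) atTop (𝓝 x) then h.choose else 0
  have hg : ∀ᵐ ω ∂P, Tendsto (fun k => f (φ k) ω) atTop (𝓝 (g ω)) := by
    filter_upwards [hlim] with ω hω
    simp only [g, dif_pos hω]
    exact hω.choose_spec
  have h1 : TendstoInMeasure P (fun k => f (φ k)) atTop g :=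
    tendstoInMeasure_of_tendsto_ae (fun k => hfm _) hg
  refine ⟨g, h1.of_sub ?_⟩
  rw [tendstoInMeasure_real_iff]
  intro ε hε
  have h2 : Tendsto (fun k : ℕ => (k, φ k)) atTop atTop := by
    rw [← prod_atTop_atTop_eq]
    exact tendsto_id.prodMk hφ.tendsto_atTop
  simpa only [sub_zero, Function.comp_def] using (hf ε hε).comp h2

end InMeasure

/-! ### Measurability under the usual conditions. -/

section UsualConditions

variable {Ω : Type*} {mΩ : MeasurableSpace Ω} {P : Measure Ω} {F : Filtration ℝ≥0 mΩ}

/-- Preimages under X and Y differ by null sets, and all of those lie in F 0. -/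
theorem UsualConditions.measurable_congr (hF : UsualConditions F P) {s : ℝ≥0} {X Y : Ω → ℝ}
    (hY : Measurable[F s] Y) (h : X =ᵐ[P] Y) : Measurable[F s] X := by
  intro A hA
  have h0 : P {ω | X ω ≠ Y ω} = 0 := h
  have hnull : ∀ N : Set Ω, N ⊆ {ω | X ω ≠ Y ω} → MeasurableSet[F s] N := fun N hN =>
    F.mono (zero_le : (0 : ℝ≥0) ≤ s) _ (hF.complete N (measure_mono_null hN h0))
  have e : X ⁻¹' A = (Y ⁻¹' A \ (Y ⁻¹' A \ X ⁻¹' A)) ∪ (X ⁻¹' A \ Y ⁻¹' A) := by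
    ext ω
    simp only [Set.mem_union, Set.mem_sdiff]
    tauto
  rw [e]
  refine ((hY hA).diff (hnull _ ?_)).union (hnull _ ?_)
  · rintro ω ⟨h1, h2⟩ heq
    simp only [Set.mem_preimage, heq] at h1 h2
    exact h2 h1
  · rintro ω ⟨h1, h2⟩ heq
    simp only [Set.mem_preimage, heq] at h1 h2
    exact h2 h1

/-- The limit exists only almost everywhere; the `limsup` is a version of it that is measurable
everywhere. -/
theorem exists_measurable_ae_eq_of_tendsto {m : MeasurableSpace Ω} {f : ℕ → Ω → ℝ} {g : Ω → ℝ}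
    (hf : ∀ n, ∃ f' : Ω → ℝ, Measurable[m] f' ∧ f n =ᵐ[P] f')
    (h : ∀ᵐ ω ∂P, Tendsto (fun n => f n ω) atTop (𝓝 (g ω))) :
    ∃ g' : Ω → ℝ, Measurable[m] g' ∧ g =ᵐ[P] g' := by
  choose f' hf' hff' using hf
  refine ⟨fun ω => limsup (fun n => f' n ω) atTop,
    Measurable.limsup (mδ := m) hf', ?_⟩
  filter_upwards [h, ae_all_iff.2 hff'] with ω hω hω'
  simp only [hω'] at hω
  exact hω.limsup_eq.symm

theorem UsualConditions.measurable_of_tendstoInMeasure (hF : UsualConditions F P) {s : ℝ≥0}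
    {f : ℕ → Ω → ℝ} {g : Ω → ℝ} (hf : ∀ n, Measurable[F s] (f n))
    (h : TendstoInMeasure P f atTop g) : Measurable[F s] g := by
  obtain ⟨ns, -, hns⟩ := h.exists_seq_tendsto_ae
  obtain ⟨g', hg', h1⟩ :=
    exists_measurable_ae_eq_of_tendsto (fun n => ⟨_, hf (ns n), ae_eq_rfl⟩) hns
  exact hF.measurable_congr hg' h1

end UsualConditions

/-! ### Brownian increments and elementary integrals on a common grid. -/

section Brownian

variable {Ω : Type*} {mΩ : MeasurableSpace Ω} {P : Measure Ω} {F : Filtration ℝ≥0 mΩ}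
  {B : ℝ≥0 → Ω → ℝ}

theorem IsFilteredBrownian.measurable (hB : IsFilteredBrownian F P B) (s : ℝ≥0) :
    Measurable (B s) := (hB.adapted s).mono (F.le s) le_rfl

theorem IsFilteredBrownian.hasLaw_sub (hB : IsFilteredBrownian F P B) {s t : ℝ≥0} (hst : s ≤ t) :
    HasLaw (fun ω => B t ω - B s ω) (gaussianReal 0 (t - s)) P := by
  have := hB.brownian.toIsPreBrownianReal.hasLaw_sub t s
  have e : nndist t.1 s.1 = t - s := by
    rw [← NNReal.coe_inj, NNReal.coe_sub hst, coe_nndist, Real.dist_eq]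
    exact abs_of_nonneg (sub_nonneg.2 (by exact_mod_cast hst))
  rw [e] at this
  exact this

theorem IsFilteredBrownian.memLp_sub (hB : IsFilteredBrownian F P B) {s t : ℝ≥0} (hst : s ≤ t)
    (p : ℝ≥0) : MemLp (fun ω => B t ω - B s ω) p P := by
  have h := hB.hasLaw_sub hst
  have h2 := memLp_id_gaussianReal (μ := 0) (v := t - s) p
  rw [← h.map_eq] at h2
  exact h2.comp_of_map h.aemeasurable

theorem IsFilteredBrownian.integral_sub (hB : IsFilteredBrownian F P B) {s t : ℝ≥0}
    (hst : s ≤ t) : ∫ ω, (B t ω - B s ω) ∂P = 0 := by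
  rw [(hB.hasLaw_sub hst).integral_eq, integral_id_gaussianReal]

theorem IsFilteredBrownian.integral_sub_sq (hB : IsFilteredBrownian F P B) {s t : ℝ≥0}
    (hst : s ≤ t) : ∫ ω, (B t ω - B s ω) ^ 2 ∂P = (t : ℝ) - s := by
  have h := hB.hasLaw_sub hst
  have h2 := h.variance_eq
  rw [variance_id_gaussianReal, variance_of_integral_eq_zero h.aemeasurable
    (hB.integral_sub hst)] at h2
  rw [h2, NNReal.coe_sub hst]

theorem IsFilteredBrownian.isNoise [IsProbabilityMeasure P] (hB : IsFilteredBrownian F P B)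
    {s t : ℝ≥0} (hst : s ≤ t) : IsNoise (F s) P (fun ω => B t ω - B s ω) ((t : ℝ) - s) :=
  IsNoise.of_indep (F.le s) (by exact_mod_cast hB.memLp_sub hst 2)
    ((hB.measurable t).sub (hB.measurable s)) (hB.indep s t hst) (hB.integral_sub hst)
    (hB.integral_sub_sq hst)

/-- The points of a finite subset of `[0, t]`, enumerated increasingly. -/
theorem exists_strictMono_enumeration (T : Finset ℝ≥0) {t : ℝ≥0} (h0 : 0 ∈ T) (ht : t ∈ T)
    (hT : ∀ x ∈ T, x ≤ t) :
    ∃ (τ : ℕ → ℝ≥0) (n : ℕ), StrictMono τ ∧ τ 0 = 0 ∧ τ n = t ∧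
      ∀ x ∈ T, ∀ j < n, x ≤ τ j ∨ τ (j + 1) ≤ x := by
  obtain ⟨n, hn⟩ : ∃ n, T.card = n + 1 :=
    ⟨T.card - 1, (Nat.succ_pred_eq_of_pos (Finset.card_pos.2 ⟨0, h0⟩)).symm⟩
  set e := T.orderEmbOfFin hn with he
  have hmem : ∀ x ∈ T, ∃ i, e i = x := by
    intro x hx
    have := T.range_orderEmbOfFin hn
    rw [Set.ext_iff] at this
    exact (this x).2 hx
  have heT : ∀ i, e i ∈ T := fun i => T.orderEmbOfFin_mem hn i
  have hlast : e (Fin.last n) = t := by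
    obtain ⟨i, hi⟩ := hmem t ht
    exact le_antisymm (hT _ (heT _)) (hi ▸ e.monotone (Fin.le_last i))
  have hfirst : e 0 = 0 := by
    obtain ⟨i, hi⟩ := hmem 0 h0
    exact le_antisymm (hi ▸ e.monotone (Fin.zero_le i)) zero_le
  -- Past the last point the grid continues by unit steps beyond t, which keeps it strictly
  -- increasing on all of ℕ.
  let τ : ℕ → ℝ≥0 := fun k => if h : k < n + 1 then e ⟨k, h⟩ else t + ((k - n : ℕ) : ℝ≥0)
  refine ⟨τ, n, strictMono_nat_of_lt_succ fun k => ?_, ?_, ?_, ?_⟩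
  · by_cases h1 : k + 1 < n + 1
    · have h2 : k < n + 1 := by omega
      simp only [τ, dif_pos h1, dif_pos h2]
      exact e.strictMono (by simp)
    · by_cases h2 : k < n + 1
      · simp only [τ, dif_pos h2, dif_neg h1]
        have h3 : k + 1 - n = 1 := by omega
        rw [h3]
        exact (hT _ (heT _)).trans_lt (by simp)
      · simp only [τ, dif_neg h2, dif_neg h1]
        have h3 : k - n < k + 1 - n := by omega
        gcongr
  · simp only [τ, dif_pos (Nat.succ_pos n)]
    exact hfirst
  · simp only [τ, dif_pos (Nat.lt_succ_self n)]
    exact hlast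
  · intro x hx j hj
    obtain ⟨i, rfl⟩ := hmem x hx
    have h1 : j < n + 1 := by omega
    have h2 : j + 1 < n + 1 := by omega
    simp only [τ, dif_pos h1, dif_pos h2]
    rcases le_or_gt (i : ℕ) j with h | h
    · exact Or.inl (e.monotone (Fin.le_def.2 h))
    · exact Or.inr (e.monotone (Fin.le_def.2 h))

/-- Clamp the grid to [a, b] and telescope: no cell straddles a or b, so each clamped cell is either
whole or degenerate. -/
theorem sum_increments_of_grid {τ : ℕ → ℝ≥0} {n : ℕ} (hτ : StrictMono τ) {a b : ℝ≥0}
    (ha0 : τ 0 ≤ a) (hab : a ≤ b) (hb : b ≤ τ n)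
    (hga : ∀ j < n, a ≤ τ j ∨ τ (j + 1) ≤ a) (hgb : ∀ j < n, b ≤ τ j ∨ τ (j + 1) ≤ b)
    (f : ℝ≥0 → ℝ) :
    ∑ j ∈ Finset.range n, (if a ≤ τ j ∧ τ (j + 1) ≤ b then f (τ (j + 1)) - f (τ j) else 0) =
      f b - f a := by
  have h := Finset.sum_range_sub (fun j => f (max a (min (τ j) b))) n
  rw [min_eq_right hb, max_eq_right hab, max_eq_left ((min_le_left _ _).trans ha0)] at h
  rw [← h]
  refine Finset.sum_congr rfl fun j hj => ?_
  have hj := Finset.mem_range.1 hj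
  have hlt : τ j < τ (j + 1) := hτ (Nat.lt_succ_self j)
  split_ifs with hc
  · rw [min_eq_left hc.2, min_eq_left (hlt.le.trans hc.2), max_eq_right hc.1,
      max_eq_right (hc.1.trans hlt.le)]
  · rcases hga j hj with h1 | h1
    · rcases hgb j hj with h2 | h2
      · rw [min_eq_right h2, min_eq_right (h2.trans hlt.le)]; simp
      · exact absurd ⟨h1, h2⟩ hc
    · rw [max_eq_left ((min_le_left _ _).trans h1),
        max_eq_left ((min_le_left _ _).trans (hlt.le.trans h1))]; simp

theorem setLIntegral_Ioc_grid {τ : ℕ → ℝ≥0} (hτ : StrictMono τ) (h0 : τ 0 = 0) {f : ℝ → ℝ}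
    {u : ℕ → ℝ} (n : ℕ)
    (hf : ∀ j < n, ∀ s : ℝ, s ∈ Set.Ioc (τ j : ℝ) (τ (j + 1)) → f s = u j) :
    ∫⁻ s in Set.Ioc (0 : ℝ) (τ n), ‖f s‖ₑ ^ 2 =
      ENNReal.ofReal (∑ j ∈ Finset.range n, ((τ (j + 1) : ℝ) - τ j) * u j ^ 2) := by
  induction n with
  | zero => simp [h0]
  | succ n ih =>
    have hlt : (τ n : ℝ) ≤ τ (n + 1) := by exact_mod_cast (hτ (Nat.lt_succ_self n)).le
    have hnn : ∀ j, 0 ≤ ((τ (j + 1) : ℝ) - τ j) * u j ^ 2 := fun j =>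
      mul_nonneg (sub_nonneg.2 (by exact_mod_cast (hτ (Nat.lt_succ_self j)).le)) (sq_nonneg _)
    rw [← Set.Ioc_union_Ioc_eq_Ioc (τ n).coe_nonneg hlt, lintegral_union measurableSet_Ioc
      (Set.Ioc_disjoint_Ioc_of_le le_rfl), ih fun j hj => hf j (by omega), Finset.sum_range_succ,
      ENNReal.ofReal_add (Finset.sum_nonneg fun j _ => hnn j) (hnn n)]
    congr 1
    rw [setLIntegral_congr_fun (g := fun _ => ‖u n‖ₑ ^ 2) measurableSet_Ioc]
    · rw [setLIntegral_const, Real.volume_Ioc, mul_comm, ENNReal.ofReal_mul (sub_nonneg.2 hlt)]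
      congr 1
      rw [Real.enorm_eq_ofReal_abs, ← ENNReal.ofReal_pow (abs_nonneg _), sq_abs]
    · intro s hs
      simp only [hf n (Nat.lt_succ_self n) s hs]

/-- A finite family of weighted intervals is a step function on a common grid. -/
theorem exists_grid_of_family {ι : Type*} [Fintype ι] {l r : ι → ℝ≥0} (hlr : ∀ i, l i ≤ r i)
    (t : ℝ≥0) :
    ∃ (τ : ℕ → ℝ≥0) (n : ℕ), StrictMono τ ∧ τ 0 = 0 ∧ τ n = t ∧ ∀ ξ : ι → ℝ,
      (∀ f : ℝ≥0 → ℝ, ∑ i, ξ i * (f (min (r i) t) - f (min (l i) t)) =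
        ∑ j ∈ Finset.range n, (∑ i, if l i ≤ τ j ∧ τ (j + 1) ≤ r i then ξ i else 0) *
          (f (τ (j + 1)) - f (τ j))) ∧
      ∫⁻ s : ℝ in Set.Ioc 0 (t : ℝ),
        ‖∑ i, (Set.Ioc (l i) (r i)).indicator (fun _ => ξ i) s.toNNReal‖ₑ ^ 2 =
        ENNReal.ofReal (∑ j ∈ Finset.range n, ((τ (j + 1) : ℝ) - τ j) *
          (∑ i, if l i ≤ τ j ∧ τ (j + 1) ≤ r i then ξ i else 0) ^ 2) := by
  classical
  let T : Finset ℝ≥0 := {0, t} ∪ Finset.univ.image (fun i => min (l i) t) ∪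
    Finset.univ.image (fun i => min (r i) t)
  have hTl : ∀ i, min (l i) t ∈ T := fun i => by simp [T]
  have hTr : ∀ i, min (r i) t ∈ T := fun i => by simp [T]
  obtain ⟨τ, n, hτ, hτ0, hτn, hgrid⟩ := exists_strictMono_enumeration T (t := t) (by simp [T])
    (by simp [T]) (by
      intro x hx
      simp only [T, Finset.mem_union, Finset.mem_insert, Finset.mem_singleton, Finset.mem_image,
        Finset.mem_univ, true_and] at hx
      rcases hx with ((rfl | rfl) | ⟨i, rfl⟩) | ⟨i, rfl⟩
      · exact zero_le
      · exact le_rfl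
      · exact min_le_right _ _
      · exact min_le_right _ _)
  -- Cells with j < n lie inside [0, t], so truncating the endpoints at t does not change which
  -- cells an interval contains.
  have hcond : ∀ i, ∀ j < n, ((min (l i) t ≤ τ j ∧ τ (j + 1) ≤ min (r i) t) ↔
      (l i ≤ τ j ∧ τ (j + 1) ≤ r i)) := by
    intro i j hj
    have h1 : τ (j + 1) ≤ t := hτn ▸ hτ.monotone (by omega : j + 1 ≤ n)
    have h2 : τ j < t := (hτ (Nat.lt_succ_self j)).trans_le h1
    simp [h1, h2.not_ge]
  refine ⟨τ, n, hτ, hτ0, hτn, fun ξ => ⟨fun f => ?_, ?_⟩⟩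
  · simp only [Finset.sum_mul]
    rw [Finset.sum_comm]
    refine Finset.sum_congr rfl fun i _ => ?_
    rw [← sum_increments_of_grid hτ (a := min (l i) t) (b := min (r i) t) (by simp [hτ0])
      (min_le_min_right _ (hlr i)) (by simp [hτn]) (hgrid _ (hTl i)) (hgrid _ (hTr i))
      f, Finset.mul_sum]
    refine Finset.sum_congr rfl fun j hj => ?_
    simp only [hcond i j (Finset.mem_range.1 hj)]
    split_ifs <;> simp
  · rw [← hτn]
    refine setLIntegral_Ioc_grid hτ hτ0 (u := fun j => ∑ i, if l i ≤ τ j ∧ τ (j + 1) ≤ r i then ξ i else 0)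
      (f := fun s => ∑ i, (Set.Ioc (l i) (r i)).indicator (fun _ => ξ i) s.toNNReal) n ?_
    intro j hj s hs
    have hs0 : 0 ≤ s := (τ j).2.trans hs.1.le
    lift s to ℝ≥0 using hs0
    have hs1 : τ j < s := by exact_mod_cast hs.1
    have hs2 : s ≤ τ (j + 1) := by exact_mod_cast hs.2
    have hst : τ (j + 1) ≤ t := hτn ▸ hτ.monotone (by omega : j + 1 ≤ n)
    rw [Real.toNNReal_coe]
    refine Finset.sum_congr rfl fun i _ => ?_
    rw [Set.indicator_apply]
    congr 1
    rw [Set.mem_Ioc, ← hcond i j hj]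
    refine propext ⟨fun h => ⟨?_, ?_⟩, fun h => ?_⟩
    · refine (hgrid _ (hTl i) j hj).resolve_right fun h3 => ?_
      exact absurd ((hs2.trans h3).trans (min_le_left _ _)) h.1.not_ge
    · refine (hgrid _ (hTr i) j hj).resolve_left fun h3 => ?_
      exact absurd ((le_min h.2 (hs2.trans hst)).trans h3) hs1.not_ge
    · rw [hcond i j hj] at h
      exact ⟨h.1.trans_lt hs1, hs2.trans h.2⟩

/-- On a common grid the elementary integral is a martingale transform: ξ i enters cell j only when
l i ≤ τ j, so the cell coefficient is measurable at the left end of the cell. The maximal inequality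
then applies. -/
theorem IsFilteredBrownian.measure_le_abs_sum_le [IsProbabilityMeasure P]
    (hB : IsFilteredBrownian F P B) {ι : Type*} [Fintype ι] {l r : ι → ℝ≥0} (hlr : ∀ i, l i ≤ r i)
    {ξ : ι → Ω → ℝ} (hξ : ∀ i, Measurable[F (l i)] (ξ i)) (t : ℝ≥0) {ε δ : ℝ} (hε : 0 < ε)
    (hδ : 0 < δ) :
    P {ω | ε ≤ |∑ i, ξ i ω * (B (min (r i) t) ω - B (min (l i) t) ω)|} ≤
      P {ω | ENNReal.ofReal δ < ∫⁻ s : ℝ in Set.Ioc 0 (t : ℝ),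
        ‖∑ i, (Set.Ioc (l i) (r i)).indicator (fun _ => ξ i ω) s.toNNReal‖ₑ ^ 2} +
        ENNReal.ofReal (δ / ε ^ 2) := by
  obtain ⟨τ, n, hτ, -, -, hgrid⟩ := exists_grid_of_family hlr t
  let U : ℕ → Ω → ℝ := fun j ω => ∑ i, if l i ≤ τ j ∧ τ (j + 1) ≤ r i then ξ i ω else 0
  have hlen := measure_exists_le_abs_sum_le (P := P) (𝒢 := fun j => F (τ j))
    (ζ := fun j ω => B (τ (j + 1)) ω - B (τ j) ω) (U := U)
    (c := fun j => (τ (j + 1) : ℝ) - τ j) (fun i j hij => F.mono (hτ.monotone hij))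
    (fun j => F.le _)
    (fun j => (hB.adapted _).sub ((hB.adapted _).mono (F.mono (hτ (Nat.lt_succ_self j)).le) le_rfl))
    (fun j => sub_pos.2 (by exact_mod_cast hτ (Nat.lt_succ_self j)))
    (fun j => hB.isNoise (hτ (Nat.lt_succ_self j)).le)
    (fun j => Finset.measurable_fun_sum _ fun i _ => by
      split_ifs with h
      · exact (hξ i).mono (F.mono h.1) le_rfl
      · exact measurable_const) Set.univ n hε hδ
  simp only [Set.univ_inter] at hlen
  refine le_trans (measure_mono ?_) (hlen.trans ?_)
  · intro ω hω
    refine ⟨n, le_rfl, ?_⟩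
    have h := (hgrid fun i => ξ i ω).1 fun s => B s ω
    simp only [U]
    rw [← h]
    exact hω
  · simp only [fun ω => (hgrid fun i => ξ i ω).2, ENNReal.ofReal_lt_ofReal_iff_of_nonneg hδ.le]
    exact le_rfl

end Brownian

/-! ### Existence, uniqueness and measurability of the Itô integral. -/

section Ito

variable {Ω κ : Type*} {mΩ : MeasurableSpace Ω} {P : Measure Ω} {F : Filtration ℝ≥0 mΩ}
  {B : ℝ≥0 → Ω → ℝ}

/-- The simple processes `V k` approximate the integrand `G` on `(0, t]`, in probability. -/
def SimpleProcess.Approximates (V : κ → SimpleProcess F) (l : Filter κ) (P : Measure Ω)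
    (G : ℝ≥0 → Ω → ℝ) (t : ℝ≥0) : Prop :=
  ∀ ε : ℝ≥0∞, 0 < ε → Tendsto (fun k => P {ω | ε ≤ ∫⁻ s : ℝ in Set.Ioc 0 (t : ℝ),
    ‖(V k).eval s.toNNReal ω - G s.toNNReal ω‖ₑ ^ 2}) l (𝓝 0)

theorem SimpleProcess.measurable_eval (V : SimpleProcess F) (ω : Ω) :
    Measurable (fun s : ℝ => V.eval s.toNNReal ω) := by
  refine Finset.measurable_fun_sum _ fun i _ => ?_
  exact (measurable_const.indicator measurableSet_Ioc).comp measurable_real_toNNReal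

theorem SimpleProcess.measurable_integral (hB : IsFilteredBrownian F P B) (V : SimpleProcess F)
    (t : ℝ≥0) : Measurable[F t] (V.integral B t) := by
  refine Finset.measurable_fun_sum _ fun i _ => ?_
  have hb : ∀ s, Measurable[F t] (B (min s t)) := fun s =>
    (hB.adapted _).mono (F.mono (min_le_right _ _)) le_rfl
  rcases le_total (V.left i) t with h | h
  · exact ((V.measurable i).mono (F.mono h) le_rfl).mul ((hb _).sub (hb _))
  · have : (fun ω => V.ξ i ω * (B (min (V.right i) t) ω - B (min (V.left i) t) ω)) =
        fun _ => 0 := by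
      ext ω
      rw [min_eq_right h, min_eq_right (h.trans (V.le i))]
      simp
    rw [this]
    exact measurable_const

theorem enorm_sub_sq_le (x y z : ℝ) : ‖x - y‖ₑ ^ 2 ≤ 2 * ‖x - z‖ₑ ^ 2 + 2 * ‖y - z‖ₑ ^ 2 := by
  simp only [Real.enorm_eq_ofReal_abs, ← ENNReal.ofReal_pow (abs_nonneg _), sq_abs]
  rw [show (2 : ℝ≥0∞) = ENNReal.ofReal 2 by simp, ← ENNReal.ofReal_mul (by norm_num),
    ← ENNReal.ofReal_mul (by norm_num), ← ENNReal.ofReal_add (by positivity) (by positivity)]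
  apply ENNReal.ofReal_le_ofReal
  nlinarith [sq_nonneg ((x - z) + (y - z))]

/-- The difference is one elementary integral whose energy is at most twice the sum of the two
approximation errors. The filter is arbitrary so that the same statement gives uniqueness (two
sequences) and the Cauchy property (pairs of indices). -/
theorem IsFilteredBrownian.tendstoInMeasure_integral_sub [IsProbabilityMeasure P]
    (hB : IsFilteredBrownian F P B) {G : ℝ≥0 → Ω → ℝ} {t : ℝ≥0}
    (hG : ∀ᵐ ω ∂P, AEMeasurable (fun s : ℝ => G s.toNNReal ω)
      (volume.restrict (Set.Ioc 0 (t : ℝ))))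
    {l : Filter κ} {V V' : κ → SimpleProcess F} (hV : SimpleProcess.Approximates V l P G t)
    (hV' : SimpleProcess.Approximates V' l P G t) :
    TendstoInMeasure P (fun k ω => (V k).integral B t ω - (V' k).integral B t ω) l
      (fun _ => 0) := by
  rw [tendstoInMeasure_real_iff]
  intro ε hε
  refine tendsto_zero_of_forall_eventually_le_ofReal fun η hη => ?_
  -- With this δ the Chebyshev term δ / ε² is η / 3; errors below δ / 4 keep the energy at most
  -- 2(δ/4) + 2(δ/4) = δ.
  set δ : ℝ := ε ^ 2 * (η / 3) with hδ
  have hδ0 : 0 < δ := by positivity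
  have hpos : 0 < ENNReal.ofReal (δ / 4) := ENNReal.ofReal_pos.2 (by positivity)
  filter_upwards [eventually_le_ofReal_of_tendsto_zero (hV _ hpos) (η := η / 3) (by positivity),
    eventually_le_ofReal_of_tendsto_zero (hV' _ hpos) (η := η / 3) (by positivity)] with k h1 h2
  -- The difference is indexed by the disjoint union of the two families, with the second
  -- coefficients negated.
  have key := hB.measure_le_abs_sum_le (ι := Fin (V k).n ⊕ Fin (V' k).n)
    (l := Sum.elim (V k).left (V' k).left) (r := Sum.elim (V k).right (V' k).right)
    (ξ := Sum.elim (V k).ξ (fun i ω => - (V' k).ξ i ω))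
    (by rintro (i | i); exacts [(V k).le i, (V' k).le i])
    (by
      rintro (i | i)
      · exact (V k).measurable i
      · exact ((V' k).measurable i).neg) t hε hδ0
  simp only [Fintype.sum_sum_type, Sum.elim_inl, Sum.elim_inr] at key
  have e1 : ∀ ω, (V k).integral B t ω - (V' k).integral B t ω - 0 =
      (∑ i, (V k).ξ i ω * (B (min ((V k).right i) t) ω - B (min ((V k).left i) t) ω)) +
      ∑ i, -(V' k).ξ i ω * (B (min ((V' k).right i) t) ω - B (min ((V' k).left i) t) ω) := by
    intro ω
    simp only [SimpleProcess.integral, neg_mul, Finset.sum_neg_distrib]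
    ring
  have e2 : ∀ ω, ∀ s : ℝ≥0, (∑ i, (Set.Ioc ((V k).left i) ((V k).right i)).indicator
      (fun _ => (V k).ξ i ω) s) + ∑ i, (Set.Ioc ((V' k).left i) ((V' k).right i)).indicator
      (fun _ => -(V' k).ξ i ω) s = (V k).eval s ω - (V' k).eval s ω := by
    intro ω s
    simp only [SimpleProcess.eval, Set.indicator_apply, sub_eq_add_neg, ← Finset.sum_neg_distrib]
    congr 1
    exact Finset.sum_congr rfl fun i _ => by split_ifs <;> simp
  simp only [e1]
  simp only [e2] at key
  refine key.trans ?_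
  have hsub : {ω | ENNReal.ofReal δ < ∫⁻ s : ℝ in Set.Ioc 0 (t : ℝ),
        ‖(V k).eval s.toNNReal ω - (V' k).eval s.toNNReal ω‖ₑ ^ 2} ⊆
      ({ω | ENNReal.ofReal (δ / 4) ≤ ∫⁻ s : ℝ in Set.Ioc 0 (t : ℝ),
        ‖(V k).eval s.toNNReal ω - G s.toNNReal ω‖ₑ ^ 2} ∪
      {ω | ENNReal.ofReal (δ / 4) ≤ ∫⁻ s : ℝ in Set.Ioc 0 (t : ℝ),
        ‖(V' k).eval s.toNNReal ω - G s.toNNReal ω‖ₑ ^ 2}) ∪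
      {ω | ¬ AEMeasurable (fun s : ℝ => G s.toNNReal ω)
        (volume.restrict (Set.Ioc 0 (t : ℝ)))} := by
    intro ω hω
    by_contra hcon
    simp only [Set.mem_union, Set.mem_ofPred_eq, not_or, not_le, not_not] at hcon hω
    obtain ⟨⟨c1, c2⟩, c3⟩ := hcon
    refine absurd hω (not_lt.2 ?_)
    calc _ ≤ ∫⁻ s : ℝ in Set.Ioc 0 (t : ℝ), (2 * ‖(V k).eval s.toNNReal ω - G s.toNNReal ω‖ₑ ^ 2 +
          2 * ‖(V' k).eval s.toNNReal ω - G s.toNNReal ω‖ₑ ^ 2) :=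
          lintegral_mono fun s => enorm_sub_sq_le _ _ _
      _ = 2 * (∫⁻ s : ℝ in Set.Ioc 0 (t : ℝ), ‖(V k).eval s.toNNReal ω - G s.toNNReal ω‖ₑ ^ 2) +
          2 * ∫⁻ s : ℝ in Set.Ioc 0 (t : ℝ), ‖(V' k).eval s.toNNReal ω - G s.toNNReal ω‖ₑ ^ 2 := by
          rw [lintegral_add_left', lintegral_const_mul' _ _ (by simp),
            lintegral_const_mul' _ _ (by simp)]
          exact ((((V k).measurable_eval ω).aemeasurable.sub c3).enorm.pow_const 2).const_mul 2
      _ ≤ 2 * ENNReal.ofReal (δ / 4) + 2 * ENNReal.ofReal (δ / 4) := by gcongr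
      _ = ENNReal.ofReal δ := by
          rw [show (2 : ℝ≥0∞) = ENNReal.ofReal 2 by simp, ← ENNReal.ofReal_mul (by norm_num),
            ← ENNReal.ofReal_add (by positivity) (by positivity)]
          congr 1; ring
  have h3 : P {ω | ¬ AEMeasurable (fun s : ℝ => G s.toNNReal ω)
        (volume.restrict (Set.Ioc 0 (t : ℝ)))} = 0 := hG
  calc _ ≤ (ENNReal.ofReal (η / 3) + ENNReal.ofReal (η / 3) + 0) + ENNReal.ofReal (η / 3) := by
        refine add_le_add ((measure_mono hsub).trans ((measure_union_le _ _).trans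
          (add_le_add ((measure_union_le _ _).trans (add_le_add h1 h2)) h3.le))) ?_
        apply ENNReal.ofReal_le_ofReal
        rw [hδ]
        field_simp
        rfl
    _ = ENNReal.ofReal η := by
        rw [add_zero, ← ENNReal.ofReal_add (by positivity) (by positivity),
          ← ENNReal.ofReal_add (by positivity) (by positivity)]
        congr 1; ring

/-- The integral does not depend on the approximating sequence, so any convenient one may be used to
compute it. -/
theorem IsItoIntegral.tendstoInMeasure_of_approximates [IsProbabilityMeasure P]
    (hB : IsFilteredBrownian F P B) {G : ℝ≥0 → Ω → ℝ} {t : ℝ≥0} {I : Ω → ℝ}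
    (hI : IsItoIntegral F P B G t I) {V : ℕ → SimpleProcess F}
    (hV : SimpleProcess.Approximates V atTop P G t) :
    TendstoInMeasure P (fun n => (V n).integral B t) atTop I := by
  obtain ⟨hm, V', hV', hlim⟩ := hI
  exact hlim.of_sub (hB.tendstoInMeasure_integral_sub hm hV hV')

theorem exists_isItoIntegral_of_approximates [IsProbabilityMeasure P]
    (hB : IsFilteredBrownian F P B) {G : ℝ≥0 → Ω → ℝ} {t : ℝ≥0}
    (hG : ∀ᵐ ω ∂P, AEMeasurable (fun s : ℝ => G s.toNNReal ω)
      (volume.restrict (Set.Ioc 0 (t : ℝ)))) {V : ℕ → SimpleProcess F}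
    (hV : SimpleProcess.Approximates V atTop P G t) : ∃ I, IsItoIntegral F P B G t I := by
  have h1 : Tendsto (Prod.fst : ℕ × ℕ → ℕ) atTop atTop := by
    rw [← prod_atTop_atTop_eq]; exact tendsto_fst
  have h2 : Tendsto (Prod.snd : ℕ × ℕ → ℕ) atTop atTop := by
    rw [← prod_atTop_atTop_eq]; exact tendsto_snd
  obtain ⟨I, hI⟩ := exists_tendstoInMeasure_of_cauchy (P := P)
    (f := fun n => (V n).integral B t)
    (fun n => (((V n).measurable_integral hB t).mono (F.le t) le_rfl).aestronglyMeasurable)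
    (hB.tendstoInMeasure_integral_sub (V := fun p : ℕ × ℕ => V p.1)
      (V' := fun p : ℕ × ℕ => V p.2) hG (fun ε hε => (hV ε hε).comp h1)
      (fun ε hε => (hV ε hε).comp h2))
  exact ⟨I, hG, V, hV, hI⟩

theorem IsItoIntegral.measurable (hF : UsualConditions F P) (hB : IsFilteredBrownian F P B)
    {G : ℝ≥0 → Ω → ℝ} {t : ℝ≥0} {I : Ω → ℝ}
    (hI : IsItoIntegral F P B G t I) : Measurable[F t] I := by
  obtain ⟨-, V, -, hlim⟩ := hI
  exact hF.measurable_of_tendstoInMeasure (fun n => (V n).measurable_integral hB t) hlim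

theorem IsItoIntegral.congr {G G' : ℝ≥0 → Ω → ℝ} {t : ℝ≥0} {I : Ω → ℝ}
    (hI : IsItoIntegral F P B G t I) (h : ∀ᵐ ω ∂P, ∀ s, G s ω = G' s ω) :
    IsItoIntegral F P B G' t I := by
  obtain ⟨hm, V, hV, hlim⟩ := hI
  refine ⟨?_, V, fun ε hε => ?_, hlim⟩
  · filter_upwards [hm, h] with ω h1 h2
    simpa only [h2] using h1
  · refine (tendsto_congr fun n => measure_congr ?_).1 (hV ε hε)
    filter_upwards [h] with ω hω
    change (ε ≤ _) = (ε ≤ _)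
    simp only [hω]

end Ito

/-! ### Riemann sums of continuous adapted integrands. -/

section Riemann

variable {Ω : Type*} {mΩ : MeasurableSpace Ω} {P : Measure Ω} {F : Filtration ℝ≥0 mΩ}
  {B G : ℝ≥0 → Ω → ℝ}

/-- The truncation of `x` to `[-c, c]`. -/
noncomputable def clamp (c x : ℝ) : ℝ := max (-c) (min x c)

theorem measurable_clamp (c : ℝ) : Measurable (clamp c) := by unfold clamp; fun_prop

theorem abs_clamp_le {c : ℝ} (hc : 0 ≤ c) (x : ℝ) : |clamp c x| ≤ c := by
  unfold clamp
  rw [abs_le]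
  exact ⟨le_max_left _ _, max_le (by linarith) (min_le_right _ _)⟩

theorem clamp_of_abs_le {c x : ℝ} (h : |x| ≤ c) : clamp c x = x := by
  rw [abs_le] at h
  unfold clamp
  rw [min_eq_left h.2, max_eq_right h.1]

/-- The left-point step process of `G` with `n` steps of length `t / n`, truncated at level `n`. -/
noncomputable def riemannProcess (hG : Adapted F G) (t : ℝ≥0) (n : ℕ) : SimpleProcess F where
  n := n
  left k := k * (t / n)
  right k := (k + 1) * (t / n)
  le k := by gcongr; simp
  ξ k ω := clamp n (G (k * (t / n)) ω)
  measurable k := (measurable_clamp n).comp (hG _)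
  bounded k := ⟨n, fun ω => abs_clamp_le (Nat.cast_nonneg n) _⟩

/-- The left-point Riemann sum of `G` against `B` with `k` steps of length `h`. -/
noncomputable def riemannSum (G B : ℝ≥0 → Ω → ℝ) (h : ℝ≥0) (k : ℕ) (ω : Ω) : ℝ :=
  ∑ j ∈ Finset.range k, G (j * h) ω * (B ((j + 1) * h) ω - B (j * h) ω)

theorem riemannProcess_integral (hG : Adapted F G) (t : ℝ≥0) (n : ℕ) (ω : Ω) :
    (riemannProcess hG t n).integral B t ω =
      riemannSum (fun s ω => clamp n (G s ω)) B (t / n) n ω := by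
  rw [SimpleProcess.integral, riemannSum, ← Fin.sum_univ_eq_sum_range
    (fun j => clamp n (G (j * (t / n)) ω) * (B ((j + 1) * (t / n)) ω - B (j * (t / n)) ω))]
  refine Finset.sum_congr rfl fun k _ => ?_
  have hn : 0 < n := (Nat.zero_le _).trans_lt k.2
  have h1 : ((k : ℕ) + 1 : ℝ≥0) * (t / n) ≤ t := by
    rw [mul_div_assoc', div_le_iff₀ (by positivity), mul_comm]
    gcongr
    exact_mod_cast k.2
  have h2 : ((k : ℕ) : ℝ≥0) * (t / n) ≤ t := le_trans (by gcongr; simp) h1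
  simp only [riemannProcess] at h1 h2 ⊢
  rw [min_eq_left h1, min_eq_left h2]

theorem riemannProcess_eval (hG : Adapted F G) (t : ℝ≥0) (n : ℕ) {s : ℝ≥0} (hs0 : 0 < s)
    (hst : s ≤ t) (hn : n ≠ 0) (ω : Ω) : ∃ k : ℕ, k * (t / n) ≤ s ∧ s ≤ k * (t / n) + t / n ∧
      (riemannProcess hG t n).eval s ω = clamp n (G (k * (t / n)) ω) := by
  have hn' : (0 : ℝ≥0) < n := by positivity
  have ht : 0 < t := hs0.trans_le hst
  have hh : 0 < t / n := by positivity
  -- The step intervals are open on the left, so the one containing s has index ⌈s / (t/n)⌉ - 1.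
  obtain ⟨k, hk⟩ : ∃ k : ℕ, ⌈s / (t / n)⌉₊ = k + 1 :=
    ⟨⌈s / (t / n)⌉₊ - 1, by have := Nat.ceil_pos.2 (show 0 < s / (t / n) by positivity); omega⟩
  have h1 : (k : ℝ≥0) * (t / n) < s := by
    have : k < ⌈s / (t / n)⌉₊ := by omega
    rw [Nat.lt_ceil, lt_div_iff₀ hh] at this
    exact this
  have h2 : s ≤ (k + 1 : ℝ≥0) * (t / n) := by
    have := Nat.le_ceil (s / (t / n))
    rw [hk, div_le_iff₀ hh] at this
    exact_mod_cast this
  have hkn : k < n := by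
    have h3 := h1.trans_le hst
    rw [mul_div_assoc', div_lt_iff₀ hn', mul_comm] at h3
    exact_mod_cast lt_of_mul_lt_mul_left h3 zero_le
  refine ⟨k, h1.le, by rwa [add_mul, one_mul] at h2, ?_⟩
  refine (Finset.sum_eq_single (⟨k, hkn⟩ : Fin n) ?_ ?_).trans ?_
  · intro i _ hi
    refine Set.indicator_of_notMem (fun hmem : s ∈ Set.Ioc _ _ => hi ?_) _
    simp only [riemannProcess] at hmem i
    have h3 : (i : ℝ≥0) < k + 1 := lt_of_mul_lt_mul_right (hmem.1.trans_le h2) zero_le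
    have h4 : (k : ℝ≥0) < i + 1 := lt_of_mul_lt_mul_right (h1.trans_le hmem.2) zero_le
    have h3' : (i : ℕ) < k + 1 := by exact_mod_cast h3
    have h4' : k < (i : ℕ) + 1 := by exact_mod_cast h4
    exact Fin.ext (show (i : ℕ) = k by omega)
  · exact fun h => absurd (Finset.mem_univ _) h
  · have hmem : s ∈ Set.Ioc ((riemannProcess hG t n).left ⟨k, hkn⟩)
        ((riemannProcess hG t n).right ⟨k, hkn⟩) := ⟨h1, h2⟩
    exact Set.indicator_of_mem hmem _

theorem exists_abs_le_of_continuous {f : ℝ≥0 → ℝ} (hf : Continuous f) (t : ℝ≥0) :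
    ∃ C : ℝ, ∀ s ≤ t, |f s| ≤ C := by
  obtain ⟨C, hC⟩ := (isCompact_Icc (a := (0 : ℝ≥0)) (b := t)).exists_bound_of_continuousOn
    hf.continuousOn
  exact ⟨C, fun s hs => hC s ⟨zero_le, hs⟩⟩

theorem exists_modulus_of_continuous {f : ℝ≥0 → ℝ} (hf : Continuous f) (t : ℝ≥0) {η : ℝ}
    (hη : 0 < η) : ∃ δ : ℝ, 0 < δ ∧ ∀ r ≤ t, ∀ s ≤ t, dist r s < δ → |f r - f s| < η := by
  have h := isCompact_Icc.uniformContinuousOn_of_continuous (s := Set.Icc (0 : ℝ≥0) t)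
    hf.continuousOn
  obtain ⟨δ, hδ, h⟩ := Metric.uniformContinuousOn_iff.1 h η hη
  exact ⟨δ, hδ, fun r hr s hs hrs => h r ⟨zero_le, hr⟩ s ⟨zero_le, hs⟩ hrs⟩

theorem eventually_div_lt (t : ℝ≥0) {δ : ℝ} (hδ : 0 < δ) :
    ∀ᶠ n : ℕ in atTop, ((t / n : ℝ≥0) : ℝ) < δ := by
  have := tendsto_const_div_atTop_nhds_zero_nat (t : ℝ)
  filter_upwards [this.eventually (gt_mem_nhds hδ)] with n hn
  simpa using hn

/-- On a fixed path, uniform continuity controls the step error, and the truncation is inactive once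
n exceeds the maximum of the path. -/
theorem riemannProcess_tendsto (hG : Adapted F G) (t : ℝ≥0) {ω : Ω}
    (hc : Continuous (fun s => G s ω)) :
    Tendsto (fun n => ∫⁻ s : ℝ in Set.Ioc 0 (t : ℝ),
      ‖(riemannProcess hG t n).eval s.toNNReal ω - G s.toNNReal ω‖ₑ ^ 2) atTop (𝓝 0) := by
  refine tendsto_zero_of_forall_eventually_le_ofReal fun η hη => ?_
  -- Chosen so that η'² t ≤ η; the added 1 covers t = 0.
  set η' : ℝ := √(η / (t + 1)) with hη'
  have hη'0 : 0 < η' := Real.sqrt_pos.2 (by positivity)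
  obtain ⟨C, hC⟩ := exists_abs_le_of_continuous hc t
  obtain ⟨δ, hδ, hmod⟩ := exists_modulus_of_continuous hc t hη'0
  filter_upwards [eventually_div_lt t hδ, eventually_ge_atTop ⌈C⌉₊, eventually_ne_atTop 0]
    with n h1 h2 h3
  have hbd : ∀ s ∈ Set.Ioc 0 (t : ℝ),
      ‖(riemannProcess hG t n).eval s.toNNReal ω - G s.toNNReal ω‖ₑ ^ 2 ≤
        ENNReal.ofReal (η' ^ 2) := by
    intro s hs
    lift s to ℝ≥0 using hs.1.le
    rw [Real.toNNReal_coe]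
    have hs0 : 0 < s := by exact_mod_cast hs.1
    have hst : s ≤ t := by exact_mod_cast hs.2
    obtain ⟨k, hk1, hk2, hk3⟩ := riemannProcess_eval hG t n hs0 hst h3 ω
    rw [hk3, clamp_of_abs_le ((hC _ (hk1.trans hst)).trans ((Nat.le_ceil C).trans
      (by exact_mod_cast h2))), Real.enorm_eq_ofReal_abs, ← ENNReal.ofReal_pow (abs_nonneg _)]
    apply ENNReal.ofReal_le_ofReal
    have hk1' : ((k * (t / n) : ℝ≥0) : ℝ) ≤ s := by exact_mod_cast hk1
    have hk2' : (s : ℝ) ≤ (k * (t / n) : ℝ≥0) + (t / n : ℝ≥0) := by exact_mod_cast hk2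
    have := hmod (k * (t / n)) (hk1.trans hst) s hst (by
      rw [NNReal.dist_eq, abs_sub_lt_iff]
      constructor <;> linarith)
    gcongr
  calc _ ≤ ∫⁻ s : ℝ in Set.Ioc 0 (t : ℝ), ENNReal.ofReal (η' ^ 2) :=
        setLIntegral_mono measurable_const hbd
    _ = ENNReal.ofReal (η' ^ 2 * t) := by
        rw [setLIntegral_const, Real.volume_Ioc, ← ENNReal.ofReal_mul (by positivity), sub_zero]
    _ ≤ ENNReal.ofReal η := by
        apply ENNReal.ofReal_le_ofReal
        rw [hη', Real.sq_sqrt (by positivity), div_mul_eq_mul_div, div_le_iff₀ (by positivity)]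
        nlinarith [t.coe_nonneg]

theorem measurable_uncurry_of_adapted (hG : Adapted F G) (hc : ∀ ω, Continuous (fun s => G s ω)) :
    Measurable (Function.uncurry G) :=
  measurable_uncurry_of_continuous_of_measurable hc fun s => (hG s).mono (F.le s) le_rfl

theorem SimpleProcess.measurable_uncurry_eval (V : SimpleProcess F) :
    Measurable (Function.uncurry V.eval) := by
  have : Function.uncurry V.eval = fun p : ℝ≥0 × Ω =>
      ∑ i, (Set.Ioc (V.left i) (V.right i) ×ˢ Set.univ).indicator (fun p => V.ξ i p.2) p := by
    ext ⟨s, ω⟩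
    simp only [Function.uncurry, SimpleProcess.eval]
    refine Finset.sum_congr rfl fun i _ => ?_
    simp only [Set.indicator_apply, Set.mem_prod, Set.mem_univ, and_true]
  rw [this]
  refine Finset.measurable_fun_sum _ fun i _ => Measurable.indicator ?_
    (measurableSet_Ioc.prod MeasurableSet.univ)
  exact ((V.measurable i).mono (F.le _) le_rfl).comp measurable_snd

theorem riemannProcess_approximates [IsProbabilityMeasure P] (hG : Adapted F G)
    (hc : ∀ ω, Continuous (fun s => G s ω)) (t : ℝ≥0) :
    SimpleProcess.Approximates (riemannProcess hG t) atTop P G t := by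
  intro ε hε
  have hm : ∀ n, Measurable (fun ω => ∫⁻ s : ℝ in Set.Ioc 0 (t : ℝ),
      ‖(riemannProcess hG t n).eval s.toNNReal ω - G s.toNNReal ω‖ₑ ^ 2) := by
    intro n
    have h1 : Measurable (fun p : Ω × ℝ => (p.2.toNNReal, p.1)) :=
      (measurable_real_toNNReal.comp measurable_snd).prodMk measurable_fst
    exact Measurable.lintegral_prod_right' (f := fun p : Ω × ℝ =>
      ‖(riemannProcess hG t n).eval p.2.toNNReal p.1 - G p.2.toNNReal p.1‖ₑ ^ 2)
      ((((riemannProcess hG t n).measurable_uncurry_eval.comp h1).sub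
        ((measurable_uncurry_of_adapted hG hc).comp h1)).enorm.pow_const 2)
  have := tendsto_measure_of_ae_tendsto_indicator (μ := P) (L := atTop) (A := (∅ : Set Ω))
    (As := fun n => {ω | ε ≤ ∫⁻ s : ℝ in Set.Ioc 0 (t : ℝ),
      ‖(riemannProcess hG t n).eval s.toNNReal ω - G s.toNNReal ω‖ₑ ^ 2})
    MeasurableSet.empty (fun n => measurableSet_le measurable_const (hm n))
    MeasurableSet.univ (by simp) (by simp) (ae_of_all _ fun ω => ?_)
  · simpa using this
  · filter_upwards [(riemannProcess_tendsto hG t (hc ω)).eventually (gt_mem_nhds hε)] with n hn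
    simp only [Set.mem_empty_iff_false, iff_false, not_le]
    exact hn

theorem aemeasurable_toNNReal_of_continuous {f : ℝ≥0 → ℝ} (hf : Continuous f) (μ : Measure ℝ) :
    AEMeasurable (fun s : ℝ => f s.toNNReal) μ :=
  (hf.measurable.comp measurable_real_toNNReal).aemeasurable

theorem exists_isItoIntegral [IsProbabilityMeasure P] (hB : IsFilteredBrownian F P B)
    (hG : Adapted F G) (hc : ∀ ω, Continuous (fun s => G s ω)) (t : ℝ≥0) :
    ∃ I, IsItoIntegral F P B G t I :=
  exists_isItoIntegral_of_approximates hB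
    (ae_of_all _ fun ω => aemeasurable_toNNReal_of_continuous (hc ω) _)
    (riemannProcess_approximates hG hc t)

theorem measurable_riemannSum (hB : IsFilteredBrownian F P B) (hG : Adapted F G) (h : ℝ≥0)
    (k : ℕ) : Measurable (riemannSum G B h k) :=
  Finset.measurable_fun_sum _ fun _ _ =>
    ((hG _).mono (F.le _) le_rfl).mul ((hB.measurable _).sub (hB.measurable _))

theorem nat_mul_div_le (t : ℝ≥0) {n j : ℕ} (hj : j ≤ n) : (j : ℝ≥0) * (t / n) ≤ t := by
  rcases Nat.eq_zero_or_pos n with rfl | hn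
  · simp
  · rw [mul_div_assoc', div_le_iff₀ (by positivity), mul_comm]
    gcongr

/-- Riemann sums of a continuous adapted integrand converge to its Itô integral. -/
theorem IsItoIntegral.tendsto_riemannSum [IsProbabilityMeasure P]
    (hB : IsFilteredBrownian F P B) (hG : Adapted F G) (hc : ∀ ω, Continuous (fun s => G s ω))
    {t : ℝ≥0} {I : Ω → ℝ} (hI : IsItoIntegral F P B G t I) :
    TendstoInMeasure P (fun n : ℕ => riemannSum G B (t / n) n) atTop I := by
  have h1 := hI.tendstoInMeasure_of_approximates hB (riemannProcess_approximates hG hc t)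
  refine h1.of_sub ?_
  refine tendstoInMeasure_of_tendsto_ae (fun n => ?_) (ae_of_all _ fun ω => ?_)
  · exact ((measurable_riemannSum hB hG _ _).sub
      (((riemannProcess hG t n).measurable_integral hB t).mono (F.le t) le_rfl)).aestronglyMeasurable
  · obtain ⟨C, hC⟩ := exists_abs_le_of_continuous (hc ω) t
    -- On each path the truncated and untruncated sums eventually coincide.
    refine tendsto_const_nhds.congr' ?_
    filter_upwards [eventually_ge_atTop ⌈C⌉₊] with n hn
    rw [riemannProcess_integral, eq_comm, sub_eq_zero]
    refine Finset.sum_congr rfl fun j hj => ?_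
    beta_reduce
    rw [clamp_of_abs_le]
    exact (hC _ (nat_mul_div_le t (Finset.mem_range.1 hj).le)).trans ((Nat.le_ceil C).trans
      (by exact_mod_cast hn))

end Riemann

/-! ### Deterministic integrands: Wiener integrals are Gaussian and depend only on B. -/

section Deterministic

variable {Ω : Type*} {mΩ : MeasurableSpace Ω} {P : Measure Ω} {F : Filtration ℝ≥0 mΩ}
  {B : ℝ≥0 → Ω → ℝ}

theorem IsFilteredBrownian.integral_cexp_sub [IsProbabilityMeasure P]
    (hB : IsFilteredBrownian F P B) {s t : ℝ≥0} (hst : s ≤ t) (c : ℝ) :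
    ∫ ω, Complex.exp ((c * (B t ω - B s ω) : ℝ) * Complex.I) ∂P =
      Complex.exp ((-(((t : ℝ) - s) * c ^ 2 / 2) : ℝ)) := by
  have h := hB.hasLaw_sub hst
  have h1 := charFun_gaussianReal (μ := 0) (v := t - s) c
  rw [charFun_apply_real, ← h.map_eq, integral_map h.aemeasurable
    (by fun_prop)] at h1
  simp only [Complex.ofReal_mul, Complex.ofReal_sub]
  simp only [Complex.ofReal_sub] at h1
  rw [h1, NNReal.coe_sub hst]
  congr 1
  push_cast
  ring

/-- Independence of increments makes the characteristic function multiplicative along the grid. -/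
theorem IsFilteredBrownian.integral_cexp_sum [IsProbabilityMeasure P]
    (hB : IsFilteredBrownian F P B) {τ : ℕ → ℝ≥0} (hτ : Monotone τ) (u : ℕ → ℝ) (n : ℕ) :
    ∫ ω, Complex.exp ((∑ j ∈ Finset.range n, u j * (B (τ (j + 1)) ω - B (τ j) ω) : ℝ) *
      Complex.I) ∂P =
      Complex.exp ((-((∑ j ∈ Finset.range n, ((τ (j + 1) : ℝ) - τ j) * u j ^ 2) / 2) : ℝ)) := by
  induction n with
  | zero => simp
  | succ n ih =>
    have hX : Measurable[F (τ n)]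
        (fun ω => ∑ j ∈ Finset.range n, u j * (B (τ (j + 1)) ω - B (τ j) ω)) := by
      refine Finset.measurable_fun_sum _ fun j hj => Measurable.const_mul ?_ _
      have hj := Finset.mem_range.1 hj
      exact ((hB.adapted _).mono (F.mono (hτ (by omega))) le_rfl).sub
        ((hB.adapted _).mono (F.mono (hτ (by omega))) le_rfl)
    have hind : IndepFun (fun ω => ∑ j ∈ Finset.range n, u j * (B (τ (j + 1)) ω - B (τ j) ω))
        (fun ω => B (τ (n + 1)) ω - B (τ n) ω) P := by
      rw [IndepFun_iff_Indep]
      exact indep_of_indep_of_le_left (hB.indep _ _ (hτ (Nat.le_succ n)))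
        (measurable_iff_comap_le.1 hX)
    have hprod := (hind.comp (φ := fun x : ℝ => Complex.exp ((x : ℝ) * Complex.I))
      (ψ := fun x : ℝ => Complex.exp ((u n * x : ℝ) * Complex.I))
      (by fun_prop) (by fun_prop)).integral_mul_eq_mul_integral
      (by
        have := hX.mono (F.le _) le_rfl
        exact (Measurable.comp (by fun_prop) this).aestronglyMeasurable)
      (by
        have := (hB.measurable (τ (n + 1))).sub (hB.measurable (τ n))
        exact (Measurable.comp (by fun_prop) this).aestronglyMeasurable)
    simp only [Pi.mul_def, Function.comp_def, ← Complex.exp_add] at hprod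
    rw [ih, hB.integral_cexp_sub (hτ (Nat.le_succ n)), ← Complex.exp_add] at hprod
    simp only [Finset.sum_range_succ]
    refine (integral_congr_ae (ae_of_all _ fun ω => ?_)).trans (hprod.trans ?_)
    · congr 1
      push_cast
      ring
    · rw [← Complex.ofReal_add, Nat.succ_eq_add_one]
      congr 2
      ring

/-- The deterministic simple process obtained by fixing the coefficients of `V` at `ω₀`. -/
def SimpleProcess.freeze (V : SimpleProcess F) (ω₀ : Ω) : SimpleProcess F where
  n := V.n
  left := V.left
  right := V.right
  le := V.le
  ξ i _ := V.ξ i ω₀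
  measurable _ := measurable_const
  bounded i := ⟨|V.ξ i ω₀|, fun _ => le_rfl⟩

/-- Continuity of the L² norm, from the triangle inequality in both directions. -/
theorem tendsto_lintegral_sq_of_tendsto_sub {α : Type*} {mα : MeasurableSpace α} {μ : Measure α}
    {f : ℕ → α → ℝ} {g : α → ℝ} (hf : ∀ n, AEStronglyMeasurable (f n) μ)
    (hg : AEStronglyMeasurable g μ) (hfin : ∫⁻ x, ‖g x‖ₑ ^ 2 ∂μ ≠ ⊤)
    (h : Tendsto (fun n => ∫⁻ x, ‖f n x - g x‖ₑ ^ 2 ∂μ) atTop (𝓝 0)) :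
    Tendsto (fun n => ∫⁻ x, ‖f n x‖ₑ ^ 2 ∂μ) atTop (𝓝 (∫⁻ x, ‖g x‖ₑ ^ 2 ∂μ)) := by
  have key : ∀ f : α → ℝ, ∫⁻ x, ‖f x‖ₑ ^ 2 ∂μ = eLpNorm f 2 μ ^ 2 := by
    intro f
    have := eLpNorm_nnreal_pow_eq_lintegral (f := f) (μ := μ) (p := 2) (by norm_num)
    simpa using this.symm
  simp only [key] at *
  have hg' : eLpNorm g 2 μ ≠ ⊤ := by
    intro h; simp [h] at hfin
  have h0 : Tendsto (fun n => eLpNorm (f n - g) 2 μ) atTop (𝓝 0) := by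
    have h1 := (ENNReal.continuous_rpow_const (y := (1 / 2 : ℝ))).tendsto 0 |>.comp h
    simp only [Function.comp_def, ENNReal.zero_rpow_of_pos (show (0 : ℝ) < 1 / 2 by norm_num)] at h1
    refine h1.congr fun n => ?_
    rw [← ENNReal.rpow_natCast, ← ENNReal.rpow_mul]
    norm_num
    rfl
  have hlow : ∀ n, eLpNorm g 2 μ - eLpNorm (f n - g) 2 μ ≤ eLpNorm (f n) 2 μ := by
    intro n
    rw [tsub_le_iff_right]
    have := eLpNorm_sub_le (p := 2) (hf n) ((hf n).sub hg) (by norm_num)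
    simpa using this
  have hup : ∀ n, eLpNorm (f n) 2 μ ≤ eLpNorm g 2 μ + eLpNorm (f n - g) 2 μ := by
    intro n
    have := eLpNorm_add_le (p := 2) hg ((hf n).sub hg) (by norm_num)
    simpa using this
  have h1 : Tendsto (fun n => eLpNorm g 2 μ - eLpNorm (f n - g) 2 μ) atTop
      (𝓝 (eLpNorm g 2 μ)) := by
    simpa using ENNReal.Tendsto.sub tendsto_const_nhds h0 (Or.inl hg')
  have h2 : Tendsto (fun n => eLpNorm g 2 μ + eLpNorm (f n - g) 2 μ) atTop
      (𝓝 (eLpNorm g 2 μ)) := by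
    simpa using tendsto_const_nhds.add h0
  exact ENNReal.Tendsto.pow (tendsto_of_tendsto_of_tendsto_of_le_of_le h1 h2 hlow hup)

/-- A deterministic integrand is approximated by deterministic simple processes. -/
theorem IsItoIntegral.exists_freeze [IsProbabilityMeasure P] (hB : IsFilteredBrownian F P B)
    {K : ℝ≥0 → ℝ} {t : ℝ≥0} {I : Ω → ℝ} (hI : IsItoIntegral F P B (fun s _ => K s) t I) :
    ∃ (V : ℕ → SimpleProcess F) (w : ℕ → Ω),
      Tendsto (fun n => ∫⁻ s : ℝ in Set.Ioc 0 (t : ℝ),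
        ‖(V n).eval s.toNNReal (w n) - K s.toNNReal‖ₑ ^ 2) atTop (𝓝 0) ∧
      TendstoInMeasure P (fun n => ((V n).freeze (w n)).integral B t) atTop I := by
  obtain ⟨-, V, hV, -⟩ := id hI
  set e : ℕ → Ω → ℝ≥0∞ := fun n ω => ∫⁻ s : ℝ in Set.Ioc 0 (t : ℝ),
    ‖(V n).eval s.toNNReal ω - K s.toNNReal‖ₑ ^ 2 with he
  -- The infimum of the error over ω may not be attained, hence the slack 1/(n+1).
  have hw : ∀ n : ℕ, ∃ ω, e n ω ≤ (⨅ ω, e n ω) + (n + 1 : ℝ≥0∞)⁻¹ := by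
    intro n
    have hne : Nonempty Ω := nonempty_of_isProbabilityMeasure P
    by_cases htop : (⨅ ω, e n ω) = ⊤
    · exact ⟨hne.some, by simp [htop]⟩
    · have : (⨅ ω, e n ω) < (⨅ ω, e n ω) + (n + 1 : ℝ≥0∞)⁻¹ :=
        ENNReal.lt_add_right htop (by simp)
      obtain ⟨ω, hω⟩ := iInf_lt_iff.1 this
      exact ⟨ω, hω.le⟩
  choose w hw using hw
  -- The event {ε ≤ e n} has probability below 1 eventually, so it is not everything and some ω has
  -- error below ε.
  have hinf : Tendsto (fun n => ⨅ ω, e n ω) atTop (𝓝 0) := by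
    rw [ENNReal.tendsto_nhds_zero]
    intro ε hε
    have h1 := (hV ε hε).eventually (gt_mem_nhds (show (0 : ℝ≥0∞) < 1 by norm_num))
    filter_upwards [h1] with n hn
    by_contra hcon
    rw [not_le] at hcon
    have : {ω | ε ≤ e n ω} = Set.univ := by
      ext ω
      simpa using hcon.le.trans (iInf_le _ ω)
    simp only [he] at this
    rw [this, measure_univ] at hn
    exact lt_irrefl _ hn
  have hinv : Tendsto (fun n : ℕ => (n + 1 : ℝ≥0∞)⁻¹) atTop (𝓝 0) := by
    have := (tendsto_add_atTop_iff_nat 1).2 ENNReal.tendsto_inv_nat_nhds_zero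
    simpa using this
  have hlim : Tendsto (fun n => e n (w n)) atTop (𝓝 0) :=
    tendsto_of_tendsto_of_tendsto_of_le_of_le tendsto_const_nhds
      (by simpa using hinf.add hinv) (fun _ => zero_le) hw
  refine ⟨V, w, hlim, hI.tendstoInMeasure_of_approximates hB fun ε hε => ?_⟩
  refine tendsto_const_nhds.congr' ?_
  filter_upwards [hlim.eventually (gt_mem_nhds hε)] with n hn
  rw [eq_comm, measure_eq_zero_iff_ae_notMem]
  exact ae_of_all _ fun ω => not_le.2 hn

/-- Frozen coefficients are constants, so the approximating integrals are functions of the path of B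
alone. The original approximants could depend on anything in F. -/
theorem IsItoIntegral.exists_measurable_comap [IsProbabilityMeasure P]
    (hB : IsFilteredBrownian F P B) {K : ℝ≥0 → ℝ} {t : ℝ≥0} {I : Ω → ℝ}
    (hI : IsItoIntegral F P B (fun s _ => K s) t I) :
    ∃ I' : Ω → ℝ, Measurable[MeasurableSpace.comap (fun ω s => B s ω) inferInstance] I' ∧
      I =ᵐ[P] I' := by
  obtain ⟨V, w, -, h⟩ := hI.exists_freeze hB
  obtain ⟨ns, -, hns⟩ := h.exists_seq_tendsto_ae
  refine exists_measurable_ae_eq_of_tendsto (fun n => ⟨_, ?_, ae_eq_rfl⟩) hns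
  have hb : ∀ s, Measurable[MeasurableSpace.comap (fun ω s => B s ω) inferInstance] (B s) :=
    fun s => (measurable_pi_apply s).comp (comap_measurable (fun ω s => B s ω))
  exact Finset.measurable_fun_sum _ fun i _ => ((hb _).sub (hb _)).const_mul _

/-- The frozen integrals have Gaussian characteristic functions whose variances converge to v;
dominated convergence along an almost surely convergent subsequence identifies the limit. -/
theorem IsItoIntegral.hasLaw_gaussian [IsProbabilityMeasure P]
    (hB : IsFilteredBrownian F P B) {K : ℝ≥0 → ℝ} {t : ℝ≥0} {I : Ω → ℝ}
    (hI : IsItoIntegral F P B (fun s _ => K s) t I) {v : ℝ≥0}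
    (hv : ∫⁻ s : ℝ in Set.Ioc 0 (t : ℝ), ‖K s.toNNReal‖ₑ ^ 2 = v) :
    HasLaw I (gaussianReal 0 v) P := by
  have hKm : AEStronglyMeasurable (fun s : ℝ => K s.toNNReal)
      (volume.restrict (Set.Ioc 0 (t : ℝ))) := by
    obtain ⟨ω, hω⟩ := hI.1.exists
    exact hω.aestronglyMeasurable
  obtain ⟨V, w, hVw, h⟩ := hI.exists_freeze hB
  have hJm : ∀ n, Measurable (((V n).freeze (w n)).integral B t) := fun n =>
    (SimpleProcess.measurable_integral hB _ t).mono (F.le t) le_rfl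
  have hIm : AEMeasurable I P := h.aemeasurable fun n => (hJm n).aemeasurable
  have hq := tendsto_lintegral_sq_of_tendsto_sub
    (fun n => ((V n).measurable_eval (w n)).aestronglyMeasurable) hKm (by simp [hv]) hVw
  rw [hv] at hq
  have hchar : ∀ n (x : ℝ), ∫ ω, Complex.exp ((x * ((V n).freeze (w n)).integral B t ω : ℝ) *
      Complex.I) ∂P = Complex.exp ((-((∫⁻ s : ℝ in Set.Ioc 0 (t : ℝ),
        ‖(V n).eval s.toNNReal (w n)‖ₑ ^ 2).toReal * x ^ 2 / 2) : ℝ)) := by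
    intro n x
    obtain ⟨τ, m, hτ, -, -, hgrid⟩ := exists_grid_of_family (V n).le t
    obtain ⟨h1, h2⟩ := hgrid (fun i => (V n).ξ i (w n))
    have h3 := hB.integral_cexp_sum hτ.monotone (fun j => x * ∑ i,
      if (V n).left i ≤ τ j ∧ τ (j + 1) ≤ (V n).right i then (V n).ξ i (w n) else 0) m
    simp only [SimpleProcess.eval]
    rw [h2, ENNReal.toReal_ofReal (Finset.sum_nonneg fun j _ => mul_nonneg (sub_nonneg.2
      (by exact_mod_cast hτ.monotone (Nat.le_succ j))) (sq_nonneg _))]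
    convert h3 using 2
    · ext ω
      congr 3
      simp only [mul_assoc, ← Finset.mul_sum]
      rw [← h1 (fun s => B s ω)]
      rfl
    · congr 2
      rw [Finset.sum_mul]
      congr 1
      refine Finset.sum_congr rfl fun j _ => ?_
      ring
  obtain ⟨ns, hns, hlim⟩ := h.exists_seq_tendsto_ae
  refine ⟨hIm, Measure.ext_of_charFun ?_⟩
  ext x
  rw [charFun_gaussianReal, charFun_apply_real, integral_map hIm (by fun_prop)]
  have l1 : Tendsto (fun n => ∫ ω, Complex.exp ((x * ((V (ns n)).freeze (w (ns n))).integral B t ω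
      : ℝ) * Complex.I) ∂P) atTop (𝓝 (∫ ω, Complex.exp ((x * I ω : ℝ) * Complex.I) ∂P)) := by
    refine tendsto_integral_of_dominated_convergence (fun _ => 1) (fun n => ?_)
      (integrable_const _) (fun n => ae_of_all _ fun ω => ?_) ?_
    · exact (Measurable.comp (g := fun y : ℝ => Complex.exp ((x * y : ℝ) * Complex.I))
        (by fun_prop) (hJm (ns n))).aestronglyMeasurable
    · rw [Complex.norm_exp_ofReal_mul_I]
    · filter_upwards [hlim] with ω hω
      have hc : Continuous (fun y : ℝ => Complex.exp ((x * y : ℝ) * Complex.I)) := by fun_prop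
      exact (hc.tendsto _).comp hω
  have l2 : Tendsto (fun n => ∫ ω, Complex.exp ((x * ((V (ns n)).freeze (w (ns n))).integral B t ω
      : ℝ) * Complex.I) ∂P) atTop (𝓝 (Complex.exp ((-((v : ℝ) * x ^ 2 / 2) : ℝ)))) := by
    simp only [hchar]
    have h4 : Tendsto (fun n => (∫⁻ s : ℝ in Set.Ioc 0 (t : ℝ),
        ‖(V (ns n)).eval s.toNNReal (w (ns n))‖ₑ ^ 2).toReal) atTop (𝓝 (v : ℝ)) := by
      have := (ENNReal.tendsto_toReal (ENNReal.coe_ne_top (r := v))).comp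
        (hq.comp hns.tendsto_atTop)
      simpa [Function.comp_def] using this
    have hc : Continuous (fun y : ℝ => Complex.exp ((-(y * x ^ 2 / 2) : ℝ))) := by fun_prop
    exact (hc.tendsto _).comp h4
  have := tendsto_nhds_unique l1 l2
  push_cast at this ⊢
  rw [this]
  congr 1
  ring

end Deterministic

/-! ### The hypergeometric series with c = a + 1, and the beta integral. -/

section Hypergeometric

/-- The coefficients of the binomial series of `(1 - x) ^ (-b)`. -/
noncomputable def binomCoeff (b : ℝ) (n : ℕ) : ℝ := (n.factorial : ℝ)⁻¹ * (ascPochhammer ℝ n).eval b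

theorem binomCoeff_nonneg {b : ℝ} (hb : 0 < b) (n : ℕ) : 0 ≤ binomCoeff b n :=
  mul_nonneg (by positivity) (ascPochhammer_pos n b hb).le

theorem hasSum_binomCoeff (b : ℝ) {x : ℝ} (hx : |x| < 1) :
    HasSum (fun n => binomCoeff b n * x ^ n) ((1 - x) ^ (-b)) := by
  have h := (Real.one_div_one_sub_rpow_hasFPowerSeriesOnBall_zero b).hasSum (y := x) (by
    simpa [enorm_eq_nnnorm, ← NNReal.coe_lt_coe] using hx)
  rw [zero_add, one_div, ← Real.rpow_neg (by linarith [(abs_lt.1 hx).2])] at h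
  have e : (fun n => binomCoeff b n * x ^ n) = fun n => FormalMultilinearSeries.ofScalars ℝ
      (fun n : ℕ => Ring.choose (b + n - 1) n) n fun _ => x := by
    ext n
    rw [FormalMultilinearSeries.ofScalars_apply_eq, smul_eq_mul]
    congr 1
    have h1 := Ring.factorial_nsmul_multichoose_eq_ascPochhammer b n
    rw [Polynomial.ascPochhammer_smeval_eq_eval, nsmul_eq_mul] at h1
    rw [binomCoeff, ← h1, Ring.choose, show b + n - 1 - n + 1 = b by ring,
      inv_mul_cancel_left₀ (by positivity)]
  rw [e]
  exact h

variable {a : ℝ}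

/-- The quotient (a)_n / (a+1)_n collapses to a / (a + n). This is what reduces the hypergeometric
equation to first order when c = a + 1. -/
theorem add_mul_hypergeometric_coeff (ha : -(1 / 2) < a) (b : ℝ) (n : ℕ) :
    (a + n) * ordinaryHypergeometricCoefficient a b (a + 1) n = a * binomCoeff b n := by
  have h1 : (ascPochhammer ℝ n).eval (a + 1) ≠ 0 := (ascPochhammer_pos n _ (by linarith)).ne'
  have h2 : (a + n) * (ascPochhammer ℝ n).eval a = a * (ascPochhammer ℝ n).eval (a + 1) := by
    have e1 := ascPochhammer_succ_eval n a
    have e2 : (ascPochhammer ℝ (n + 1)).eval a = a * (ascPochhammer ℝ n).eval (a + 1) := by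
      rw [ascPochhammer_succ_left]; simp
    rw [← e2, e1, mul_comm]
  unfold ordinaryHypergeometricCoefficient binomCoeff
  field_simp
  linear_combination (ascPochhammer ℝ n).eval b * h2

/-- For n ≥ 1 and |a| < 1/2, both |a|/(a+n) and n|a|/(a+n) are at most 1. So the series and its
derivative are dominated by a binomial series. -/
theorem abs_hypergeometric_coeff_le (ha : -(1 / 2) < a) (ha' : a < 1 / 2) {b : ℝ} (hb : 0 < b)
    (n : ℕ) : |ordinaryHypergeometricCoefficient a b (a + 1) n| ≤ binomCoeff b n ∧
      n * |ordinaryHypergeometricCoefficient a b (a + 1) n| ≤ binomCoeff b n := by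
  have hg := binomCoeff_nonneg hb n
  rcases Nat.eq_zero_or_pos n with rfl | hn
  · simp [binomCoeff]
  · have h := add_mul_hypergeometric_coeff ha b n
    have hn' : (1 : ℝ) ≤ n := by exact_mod_cast hn
    have hpos : 0 < a + n := by linarith
    have h' : (a + n) * |ordinaryHypergeometricCoefficient a b (a + 1) n| =
        |a| * binomCoeff b n := by
      rw [← abs_of_pos hpos, ← abs_mul, h, abs_mul, abs_of_nonneg hg]
    have ha2 : |a| < 1 / 2 := abs_lt.2 ⟨ha, ha'⟩
    set y := |ordinaryHypergeometricCoefficient a b (a + 1) n|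
    have hy : 0 ≤ y := abs_nonneg _
    have h3 : |a| * binomCoeff b n ≤ 1 / 2 * binomCoeff b n := by gcongr
    constructor <;> nlinarith

/-- The hypergeometric function `F(a, b, a + 1; ·)` solves `a F + x F' = a (1 - x) ^ (-b)`. -/
theorem exists_hasDerivAt_hypergeometric (ha : -(1 / 2) < a) (ha' : a < 1 / 2) {b : ℝ}
    (hb : 0 < b) {x : ℝ} (hx : |x| < 1) :
    ∃ d, HasDerivAt (ordinaryHypergeometric a b (a + 1) : ℝ → ℝ) d x ∧
      a * ordinaryHypergeometric a b (a + 1) x + x * d = a * (1 - x) ^ (-b) := by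
  obtain ⟨f, hf⟩ : ∃ f : ℕ → ℝ, f = ordinaryHypergeometricCoefficient a b (a + 1) := ⟨_, rfl⟩
  have hf1 : ∀ n, |f n| ≤ binomCoeff b n := fun n =>
    hf ▸ (abs_hypergeometric_coeff_le ha ha' hb n).1
  have hf2 : ∀ n, n * |f n| ≤ binomCoeff b n := fun n =>
    hf ▸ (abs_hypergeometric_coeff_le ha ha' hb n).2
  -- An intermediate radius gives a bound on the derivative series that is uniform near x.
  obtain ⟨r, hxr, hr1⟩ := exists_between hx
  have hr0 : 0 < r := (abs_nonneg x).trans_lt hxr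
  have hsr : Summable (fun n => binomCoeff b n * r ^ n) :=
    (hasSum_binomCoeff b (by rwa [abs_of_pos hr0])).summable
  have hfun : (ordinaryHypergeometric a b (a + 1) : ℝ → ℝ) = fun y => ∑' n, f n * y ^ n := by
    rw [ordinaryHypergeometric_eq_tsum, hf]; rfl
  have hfs : ∀ y : ℝ, |y| < 1 → Summable (fun n => f n * y ^ n) := by
    intro y hy
    refine Summable.of_norm_bounded (hasSum_binomCoeff b (x := |y|) (by rwa [abs_abs])).summable
      fun n => ?_
    rw [norm_mul, norm_pow, Real.norm_eq_abs, Real.norm_eq_abs]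
    exact mul_le_mul_of_nonneg_right (hf1 n) (by positivity)
  have hd : HasDerivAt (fun y => ∑' n, f n * y ^ n) (∑' n, f n * (n * x ^ (n - 1))) x := by
    refine hasDerivAt_tsum_of_isPreconnected (u := fun n => binomCoeff b n * r ^ n * r⁻¹)
      (hsr.mul_right _) (t := Metric.ball 0 r) Metric.isOpen_ball
      (convex_ball _ _).isPreconnected (fun n y _ => (hasDerivAt_pow n y).const_mul _) ?_
      (y₀ := x) (by simpa using hxr) (hfs x hx) (by simpa using hxr)
    intro n y hy
    rcases Nat.eq_zero_or_pos n with rfl | hn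
    · simp only [Nat.cast_zero, zero_mul, mul_zero, norm_zero]
      have := binomCoeff_nonneg hb 0
      positivity
    · have hy' : |y| ≤ r := by simpa using (Metric.mem_ball.1 hy).le
      rw [norm_mul, norm_mul, norm_pow, Real.norm_natCast, Real.norm_eq_abs, Real.norm_eq_abs]
      have e : r ^ n * r⁻¹ = r ^ (n - 1) := by
        obtain ⟨k, rfl⟩ : ∃ k, n = k + 1 := ⟨n - 1, by omega⟩
        rw [pow_succ, mul_assoc, mul_inv_cancel₀ hr0.ne', mul_one]; rfl
      rw [mul_assoc, e, ← mul_assoc, mul_comm |f n|]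
      exact mul_le_mul (hf2 n)
        (pow_le_pow_left₀ (abs_nonneg _) hy' _) (by positivity) (binomCoeff_nonneg hb n)
  refine ⟨_, hfun ▸ hd, ?_⟩
  rw [hfun]
  have hds : Summable (fun n => f n * (n * x ^ n)) := by
    refine Summable.of_norm_bounded (hasSum_binomCoeff b (x := |x|) (by rwa [abs_abs])).summable
      fun n => ?_
    rw [norm_mul, norm_mul, norm_pow, Real.norm_natCast, Real.norm_eq_abs, Real.norm_eq_abs,
      ← mul_assoc, mul_comm |f n|]
    exact mul_le_mul_of_nonneg_right (hf2 n) (by positivity)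
  have e1 : x * ∑' n, f n * (n * x ^ (n - 1)) = ∑' n, f n * (n * x ^ n) := by
    rw [← tsum_mul_left]
    refine tsum_congr fun n => ?_
    rcases Nat.eq_zero_or_pos n with rfl | hn
    · simp
    · obtain ⟨k, rfl⟩ : ∃ k, n = k + 1 := ⟨n - 1, by omega⟩
      rw [Nat.add_sub_cancel, pow_succ]; ring
  simp only [e1]
  rw [← tsum_mul_left, ← ((hfs x hx).mul_left a).tsum_add hds,
    ← (hasSum_binomCoeff b hx).tsum_eq, ← tsum_mul_left]
  refine tsum_congr fun n => ?_
  have := add_mul_hypergeometric_coeff ha b n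
  simp only [hf]
  linear_combination x ^ n * this

/-- Read off from the beta density having total mass one. -/
theorem integral_beta {α β : ℝ} (hα : 0 < α) (hβ : 0 < β) :
    IntervalIntegrable (fun x => x ^ (α - 1) * (1 - x) ^ (β - 1)) volume 0 1 ∧
      ∫ x in (0 : ℝ)..1, x ^ (α - 1) * (1 - x) ^ (β - 1) = beta α β := by
  have h := lintegral_betaPDF_eq_one hα hβ
  have hpos := beta_pos hα hβ
  rw [lintegral_betaPDF] at h
  have hnn : 0 ≤ᵐ[volume.restrict (Set.Ioo (0 : ℝ) 1)]
      fun x => 1 / beta α β * x ^ (α - 1) * (1 - x) ^ (β - 1) := by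
    refine (ae_restrict_iff' measurableSet_Ioo).2 (ae_of_all _ fun x hx => ?_)
    have h1 : 0 < x := hx.1
    have h2 : 0 < 1 - x := sub_pos.2 hx.2
    simp only [Pi.zero_apply]
    positivity
  have hm : AEStronglyMeasurable (fun x => 1 / beta α β * x ^ (α - 1) * (1 - x) ^ (β - 1))
      (volume.restrict (Set.Ioo (0 : ℝ) 1)) := by fun_prop
  have hint : Integrable (fun x => 1 / beta α β * x ^ (α - 1) * (1 - x) ^ (β - 1))
      (volume.restrict (Set.Ioo (0 : ℝ) 1)) := by
    refine ⟨hm, ?_⟩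
    rw [hasFiniteIntegral_iff_ofReal hnn, h]
    exact ENNReal.one_lt_top
  have hval := integral_eq_lintegral_of_nonneg_ae hnn hm
  rw [h] at hval
  have e : (fun x : ℝ => x ^ (α - 1) * (1 - x) ^ (β - 1)) =
      fun x => beta α β * (1 / beta α β * x ^ (α - 1) * (1 - x) ^ (β - 1)) := by
    ext x; field_simp
  constructor
  · rw [intervalIntegrable_iff_integrableOn_Ioo_of_le zero_le_one, e]
    exact hint.const_mul _
  · rw [intervalIntegral.integral_of_le zero_le_one, integral_Ioc_eq_integral_Ioo, e,
      integral_const_mul, hval]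
    simp

end Hypergeometric

/-! ### The squared norm of the Molchan–Golosov kernel. -/

section Variance

/-- Since k(u)/u converges, u^p k(u) = u^{p+1}(k(u)/u) tends to 0, even for p in (-1, 0). -/
theorem tendsto_rpow_mul_of_hasDerivAt_zero {k : ℝ → ℝ} {d p : ℝ} (hk : HasDerivAt k d 0)
    (h0 : k 0 = 0) (hp : -1 < p) : Tendsto (fun u => u ^ p * k u) (𝓝[>] 0) (𝓝 0) := by
  have h1 : Tendsto (fun u => u⁻¹ * k u) (𝓝[>] 0) (𝓝 d) := by
    have := hasDerivAt_iff_tendsto_slope_zero.1 hk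
    simp only [zero_add, h0, sub_zero, smul_eq_mul] at this
    exact this.mono_left (nhdsWithin_mono _ fun x hx => ne_of_gt hx)
  have h2 : Tendsto (fun u : ℝ => u ^ (p + 1)) (𝓝[>] 0) (𝓝 0) := by
    have := (Real.continuousAt_rpow_const 0 (p + 1) (Or.inr (by linarith))).tendsto
    rw [Real.zero_rpow (by linarith)] at this
    exact this.mono_left nhdsWithin_le_nhds
  have h3 := h2.mul h1
  rw [zero_mul] at h3
  refine h3.congr' ?_
  filter_upwards [self_mem_nhdsWithin] with u hu
  have hu : 0 < u := hu
  rw [Real.rpow_add_one hu.ne', mul_assoc, mul_inv_cancel_left₀ hu.ne']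

/-- Extend f to the endpoints by its one-sided limits. A nonnegative derivative is then
automatically integrable, so no bound on f' near the endpoints is needed. -/
theorem lintegral_deriv_of_nonneg_of_tendsto {f f' : ℝ → ℝ} {a b fa fb : ℝ} (hab : a < b)
    (hderiv : ∀ x ∈ Set.Ioo a b, HasDerivAt f (f' x) x) (hpos : ∀ x ∈ Set.Ioo a b, 0 ≤ f' x)
    (ha : Tendsto f (𝓝[>] a) (𝓝 fa)) (hb : Tendsto f (𝓝[<] b) (𝓝 fb)) :
    ∫⁻ x in Set.Ioc a b, ENNReal.ofReal (f' x) = ENNReal.ofReal (fb - fa) := by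
  classical
  set G : ℝ → ℝ := Function.update (Function.update f a fa) b fb with hG
  have Gderiv : ∀ x ∈ Set.Ioo a b, HasDerivAt G (f' x) x := by
    refine fun x hx => (hderiv x hx).congr_of_eventuallyEq ?_
    filter_upwards [Ioo_mem_nhds hx.1 hx.2] with _ hy
    rw [hG, Function.update_of_ne hy.2.ne, Function.update_of_ne hy.1.ne']
  have hcont : ContinuousOn G (Set.Icc a b) := by
    rw [hG, continuousOn_update_iff, continuousOn_update_iff, Set.Icc_sdiff_right,
      Set.Ico_sdiff_left]
    refine ⟨⟨fun z hz => (hderiv z hz).continuousAt.continuousWithinAt, ?_⟩, ?_⟩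
    · exact fun _ => ha.mono_left (nhdsWithin_mono _ Set.Ioo_subset_Ioi_self)
    · rintro -
      refine (hb.congr' ?_).mono_left (nhdsWithin_mono _ Set.Ico_subset_Iio_self)
      filter_upwards [Ioo_mem_nhdsLT hab] with _ hz using
        (Function.update_of_ne hz.1.ne' _ _).symm
  have hint := intervalIntegral.integrableOn_deriv_of_nonneg hcont Gderiv hpos
  have hval : ∫ x in a..b, f' x = fb - fa :=
    intervalIntegral.integral_eq_sub_of_hasDerivAt_of_tendsto hab hderiv
      ((intervalIntegrable_iff_integrableOn_Ioc_of_le hab.le).2 hint) ha hb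
  rw [intervalIntegral.integral_of_le hab.le] at hval
  rw [← ofReal_integral_eq_lintegral_ofReal hint, hval]
  rw [EventuallyLE, ← restrict_Ioo_eq_restrict_Ioc, ae_restrict_iff' measurableSet_Ioo]
  exact ae_of_all _ hpos

variable {a : ℝ}

/-- The function `u ^ a * F(a, 2 a + 1, a + 1; u)`. -/
noncomputable def hypG (a u : ℝ) : ℝ := u ^ a * ordinaryHypergeometric a (2 * a + 1) (a + 1) u

/-- The derivative of u^a F is u^{a-1}(aF + uF'), and the first-order equation evaluates the
bracket. -/
theorem hasDerivAt_hypG (ha : -(1 / 2) < a) (ha' : a < 1 / 2) {u : ℝ} (hu : u ∈ Set.Ioo (0 : ℝ) 1) :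
    HasDerivAt (hypG a) (a * (u ^ a / u) * ((1 - u) ^ (-(2 * a)) / (1 - u))) u := by
  have hu0 : 0 < u := hu.1
  have hu1 : 0 < 1 - u := sub_pos.2 hu.2
  obtain ⟨d, hd, hode⟩ := exists_hasDerivAt_hypergeometric ha ha' (b := 2 * a + 1) (by linarith)
    (x := u) (abs_lt.2 ⟨by linarith, hu.2⟩)
  have h1 := (Real.hasDerivAt_rpow_const (x := u) (p := a) (Or.inl hu0.ne')).mul hd
  refine h1.congr_deriv ?_
  have e : (1 - u) ^ (-(2 * a + 1)) = (1 - u) ^ (-(2 * a)) / (1 - u) := by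
    rw [← Real.rpow_sub_one hu1.ne']; congr 1; ring
  rw [e] at hode
  rw [Real.rpow_sub_one hu0.ne']
  have e2 : a * (u ^ a / u) * ((1 - u) ^ (-(2 * a)) / (1 - u)) =
      (u ^ a / u) * (a * ((1 - u) ^ (-(2 * a)) / (1 - u))) := by ring
  rw [e2, ← hode]
  field_simp

theorem hasDerivAt_one_sub_rpow {u : ℝ} (hu : u < 1) (p : ℝ) :
    HasDerivAt (fun u : ℝ => (1 - u) ^ p) (-(p * ((1 - u) ^ p / (1 - u)))) u := by
  have hu1 : 0 < 1 - u := sub_pos.2 hu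
  have := ((hasDerivAt_id u).const_sub 1).rpow_const (p := p) (Or.inl hu1.ne')
  refine this.congr_deriv ?_
  simp only [id]
  rw [Real.rpow_sub_one hu1.ne']
  ring

theorem hasDerivAt_rpow_div {u : ℝ} (hu : 0 < u) (p : ℝ) :
    HasDerivAt (fun u : ℝ => u ^ p) (p * (u ^ p / u)) u := by
  rw [← Real.rpow_sub_one hu.ne']
  exact Real.hasDerivAt_rpow_const (Or.inl hu.ne')

/-- The part of `hypG` that stays bounded at `1`. -/
noncomputable def hypT (a u : ℝ) : ℝ := hypG a u - u ^ a * (1 - u) ^ (-(2 * a)) * (2 - u) / 2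

/-- The term subtracted in `hypT` is chosen to cancel the factors 1/u and 1/(1-u) in the derivative
of `hypG`. What remains is a multiple of a beta integrand, integrable on all of (0, 1). -/
theorem hasDerivAt_hypT (ha : -(1 / 2) < a) (ha' : a < 1 / 2) {u : ℝ} (hu : u ∈ Set.Ioo (0 : ℝ) 1) :
    HasDerivAt (hypT a) ((1 - a) / 2 * (u ^ a * (1 - u) ^ (-(2 * a)))) u := by
  have hu0 : 0 < u := hu.1
  have hu1 : 0 < 1 - u := sub_pos.2 hu.2
  have h := (hasDerivAt_hypG ha ha' hu).sub
    ((((hasDerivAt_rpow_div hu0 a).mul (hasDerivAt_one_sub_rpow hu.2 (-(2 * a)))).mul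
      ((hasDerivAt_id u).const_sub 2)).div_const 2)
  refine h.congr_deriv ?_
  simp only [id, Pi.mul_apply]
  field_simp
  ring

/-- `hypT` is u^a times a function that vanishes and is differentiable at 0. -/
theorem tendsto_hypT_zero (ha : -(1 / 2) < a) (ha' : a < 1 / 2) :
    Tendsto (hypT a) (𝓝[>] 0) (𝓝 0) := by
  obtain ⟨d, hd, -⟩ := exists_hasDerivAt_hypergeometric ha ha' (b := 2 * a + 1) (by linarith)
    (x := 0) (by simp)
  have h1 := hd.sub (((hasDerivAt_one_sub_rpow (u := 0) one_pos (-(2 * a))).mul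
    ((hasDerivAt_id (0 : ℝ)).const_sub 2)).div_const 2)
  refine (tendsto_rpow_mul_of_hasDerivAt_zero h1 (by simp) (show -1 < a by linarith)).congr
    fun u => ?_
  simp only [hypT, hypG, id, Pi.sub_apply, Pi.mul_apply]
  ring

theorem tendsto_hypT_one (ha : -(1 / 2) < a) (ha' : a < 1 / 2) :
    Tendsto (hypT a) (𝓝[<] 1) (𝓝 ((1 - a) / 2 * beta (a + 1) (1 - 2 * a))) := by
  obtain ⟨hint, hval⟩ := integral_beta (α := a + 1) (β := 1 - 2 * a) (by linarith) (by linarith)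
  have e : (fun x : ℝ => x ^ (a + 1 - 1) * (1 - x) ^ (1 - 2 * a - 1)) =
      fun x => x ^ a * (1 - x) ^ (-(2 * a)) := by
    ext x; congr 2 <;> ring
  rw [e] at hint hval
  have hT : ∀ x ∈ Set.Ioo (0 : ℝ) 1, (1 - a) / 2 * ∫ u in (0 : ℝ)..x,
      u ^ a * (1 - u) ^ (-(2 * a)) = hypT a x := by
    intro x hx
    rw [← intervalIntegral.integral_const_mul]
    have := intervalIntegral.integral_eq_sub_of_hasDerivAt_of_tendsto (f := hypT a) (a := 0)
      (b := x) (f' := fun u => (1 - a) / 2 * (u ^ a * (1 - u) ^ (-(2 * a)))) hx.1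
      (fun u hu => hasDerivAt_hypT ha ha' ⟨hu.1, hu.2.trans hx.2⟩)
      ((hint.mono_set (by
        rw [Set.uIcc_of_le hx.1.le, Set.uIcc_of_le zero_le_one]
        exact Set.Icc_subset_Icc_right hx.2.le)).const_mul _) (tendsto_hypT_zero ha ha')
      ((hasDerivAt_hypT ha ha' hx).continuousAt.tendsto.mono_left nhdsWithin_le_nhds)
    rw [this, sub_zero]
  have hc := intervalIntegral.continuousOn_primitive_interval' hint
    (by simp : (0 : ℝ) ∈ Set.uIcc (0 : ℝ) 1)
  have h1 := hc 1 (by simp)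
  have h2 : Tendsto (fun x => ∫ u in (0 : ℝ)..x, u ^ a * (1 - u) ^ (-(2 * a))) (𝓝[<] 1)
      (𝓝 (beta (a + 1) (1 - 2 * a))) := by
    rw [← hval]
    refine h1.tendsto.mono_left ?_
    rw [Set.uIcc_of_le zero_le_one]
    rw [← nhdsWithin_Ioo_eq_nhdsLT (zero_lt_one' ℝ)]
    exact nhdsWithin_mono _ Set.Ioo_subset_Icc_self
  refine (h2.const_mul ((1 - a) / 2)).congr' ?_
  filter_upwards [Ioo_mem_nhdsLT (zero_lt_one' ℝ)] with x hx using hT x hx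

/-- An antiderivative of `(2 a + 1) (1 - u) ^ (2 a) (hypG a u) ^ 2`. -/
noncomputable def hypPhi (a u : ℝ) : ℝ :=
  2 * u ^ a * hypG a u - (u ^ a) ^ 2 * (1 - u) ^ (-(2 * a)) -
    (1 - u) ^ (2 * a + 1) * hypG a u ^ 2

/-- Integration by parts: the last term of `hypPhi` produces the wanted integrand, and since
(1-u)^{2a+1} G' = a u^{a-1} is elementary, the first two terms absorb the remainder. -/
theorem hasDerivAt_hypPhi (ha : -(1 / 2) < a) (ha' : a < 1 / 2) {u : ℝ}
    (hu : u ∈ Set.Ioo (0 : ℝ) 1) :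
    HasDerivAt (hypPhi a) ((2 * a + 1) * ((1 - u) ^ (2 * a) * hypG a u ^ 2)) u := by
  have hu0 : 0 < u := hu.1
  have hu1 : 0 < 1 - u := sub_pos.2 hu.2
  have hG := hasDerivAt_hypG ha ha' hu
  have hA := hasDerivAt_rpow_div hu0 a
  have h := (((hA.const_mul 2).mul hG).sub
    ((hA.pow 2).mul (hasDerivAt_one_sub_rpow hu.2 (-(2 * a))))).sub
    ((hasDerivAt_one_sub_rpow hu.2 (2 * a + 1)).mul (hG.pow 2))
  refine h.congr_deriv ?_
  have hC : 0 < (1 - u) ^ (2 * a) := Real.rpow_pos_of_pos hu1 _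
  simp only [Pi.pow_apply]
  rw [Real.rpow_add_one hu1.ne', Real.rpow_neg hu1.le]
  field_simp
  ring

theorem tendsto_hypPhi_zero (ha : -(1 / 2) < a) (ha' : a < 1 / 2) :
    Tendsto (hypPhi a) (𝓝[>] 0) (𝓝 0) := by
  obtain ⟨d, hd, -⟩ := exists_hasDerivAt_hypergeometric ha ha' (b := 2 * a + 1) (by linarith)
    (x := 0) (by simp)
  have h1 := ((hd.const_mul 2).sub (hasDerivAt_one_sub_rpow (u := 0) one_pos (-(2 * a)))).sub
    ((hasDerivAt_one_sub_rpow (u := 0) one_pos (2 * a + 1)).mul (hd.pow 2))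
  refine (tendsto_rpow_mul_of_hasDerivAt_zero h1 (by norm_num)
    (show -1 < 2 * a by linarith)).congr' ?_
  filter_upwards [self_mem_nhdsWithin] with u hu
  have hu : 0 < u := hu
  have e : u ^ (2 * a) = (u ^ a) ^ 2 := by
    rw [← Real.rpow_natCast, ← Real.rpow_mul hu.le]; congr 1; push_cast; ring
  simp only [hypPhi, hypG, Pi.sub_apply, Pi.mul_apply, Pi.pow_apply, e]
  ring

theorem tendsto_hypPhi_one (ha : -(1 / 2) < a) (ha' : a < 1 / 2) :
    Tendsto (hypPhi a) (𝓝[<] 1) (𝓝 ((1 - a) * beta (a + 1) (1 - 2 * a))) := by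
  have hT := tendsto_hypT_one ha ha'
  have hA : Tendsto (fun u : ℝ => u ^ a) (𝓝[<] 1) (𝓝 1) := by
    have := (Real.continuousAt_rpow_const 1 a (Or.inl one_ne_zero)).tendsto
    rw [Real.one_rpow] at this
    exact this.mono_left nhdsWithin_le_nhds
  have hP : ∀ p : ℝ, 0 < p → Tendsto (fun u : ℝ => (1 - u) ^ p) (𝓝[<] 1) (𝓝 0) := by
    intro p hp
    have h1 : Tendsto (fun u : ℝ => 1 - u) (𝓝[<] 1) (𝓝 0) := by
      have : Continuous (fun u : ℝ => 1 - u) := by fun_prop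
      simpa using (this.tendsto 1).mono_left nhdsWithin_le_nhds
    have := (Real.continuousAt_rpow_const 0 p (Or.inr hp.le)).tendsto
    rw [Real.zero_rpow hp.ne'] at this
    exact this.comp h1
  have h2u : Tendsto (fun u : ℝ => 2 - u) (𝓝[<] 1) (𝓝 1) := by
    have : Continuous (fun u : ℝ => 2 - u) := by fun_prop
    have h := (this.tendsto 1).mono_left (nhdsWithin_le_nhds (s := Set.Iio 1))
    norm_num at h
    exact h
  -- Substituting `hypT` for `hypG`, the possibly divergent parts combine through (2 - u) - 1 = 1 -
  -- u. Every remaining power of 1 - u has a positive exponent: 1 - 2a, 1/2 - a or a + 1/2.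
  have main := (((hA.pow 2).mul (hP (1 - 2 * a) (by linarith))).add
    ((hA.const_mul 2).mul hT)).sub (((((hA.mul h2u).mul (hP (1 / 2 - a) (by linarith))).div_const
      2).add ((hP (a + 1 / 2) (by linarith)).mul hT)).pow 2)
  have e : (1 : ℝ) ^ 2 * 0 + 2 * 1 * ((1 - a) / 2 * beta (a + 1) (1 - 2 * a)) -
      (1 * 1 * 0 / 2 + 0 * ((1 - a) / 2 * beta (a + 1) (1 - 2 * a))) ^ 2 =
      (1 - a) * beta (a + 1) (1 - 2 * a) := by ring
  rw [e] at main
  refine main.congr' ?_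
  filter_upwards [Ioo_mem_nhdsLT (zero_lt_one' ℝ)] with u hu
  have hu0 : 0 < u := hu.1
  have hu1 : 0 < 1 - u := sub_pos.2 hu.2
  set D := (1 - u) ^ (1 / 2 - a) with hD
  set E := (1 - u) ^ (a + 1 / 2) with hE
  have hEpos : 0 < E := Real.rpow_pos_of_pos hu1 _
  have e1 : (1 - u) ^ (1 - 2 * a) = D ^ 2 := by
    rw [hD, ← Real.rpow_natCast, ← Real.rpow_mul hu1.le]; congr 1; push_cast; ring
  have e2 : (1 - u) ^ (2 * a + 1) = E ^ 2 := by
    rw [hE, ← Real.rpow_natCast, ← Real.rpow_mul hu1.le]; congr 1; push_cast; ring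
  have e3 : D = E * (1 - u) ^ (-(2 * a)) := by
    rw [hD, hE, ← Real.rpow_add hu1]; congr 1; ring
  have e4 : D ^ 2 = (1 - u) * (1 - u) ^ (-(2 * a)) := by
    rw [← e1, mul_comm (1 - u), ← Real.rpow_add_one hu1.ne']; congr 1; ring
  simp only [hypPhi, e1, e2]
  have hG : hypG a u = hypT a u + u ^ a * (1 - u) ^ (-(2 * a)) * (2 - u) / 2 := by
    simp [hypT]
  rw [hG, e4, e3]
  ring

/-- For 0 < s < t the argument 1 - t/s is negative, so the Pfaff branch applies and its new argument
is u = 1 - s/t. With a = H - 1/2 the kernel becomes c_H t^a (1-u)^a `hypG a u`. -/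
theorem molchanGolosov_sq {H t s : ℝ} (hs : 0 < s) (hst : s < t) :
    molchanGolosov H t s ^ 2 = molchanGolosovConst H ^ 2 * t ^ (2 * (H - 1 / 2)) *
      ((1 - (1 - s / t)) ^ (2 * (H - 1 / 2)) * hypG (H - 1 / 2) (1 - s / t) ^ 2) := by
  have ht : 0 < t := hs.trans hst
  have hmem : s ∈ Set.Icc 0 t := ⟨hs.le, hst.le⟩
  have hz : 1 - t / s < 0 := by
    rw [sub_neg, lt_div_iff₀ hs]; linarith
  have hu : 0 < 1 - s / t := by rw [sub_pos, div_lt_one ht]; exact hst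
  set a := H - 1 / 2 with ha
  have e1 : H + 1 / 2 = a + 1 := by rw [ha]; ring
  have e2 : H + 1 / 2 - (1 / 2 - H) = 2 * a + 1 := by rw [ha]; ring
  have e3 : (1 - t / s) / (1 - t / s - 1) = 1 - s / t := by
    rw [show 1 - t / s - 1 = -(t / s) by ring, div_eq_iff (neg_ne_zero.2 (div_pos ht hs).ne')]
    field_simp
    ring
  have e4 : t - s = t * (1 - s / t) := by rw [mul_sub, mul_div_cancel₀ _ ht.ne', mul_one]
  have e5 : 1 - (1 - t / s) = (s / t)⁻¹ := by rw [inv_div]; ring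
  have e6 : 1 - (1 - s / t) = s / t := by ring
  rw [molchanGolosov, Set.indicator_of_mem hmem, gaussHypergeometric, if_pos hz, e2, e3, e1, e4, e5,
    e6, Real.mul_rpow ht.le hu.le, Real.inv_rpow (by positivity), Real.rpow_neg (by positivity),
    inv_inv, hypG]
  have e7 : ∀ x : ℝ, 0 < x → x ^ (2 * a) = (x ^ a) ^ 2 := fun x hx => by
    rw [← Real.rpow_natCast, ← Real.rpow_mul hx.le]; congr 1; push_cast; ring
  rw [e7 t ht, e7 (s / t) (by positivity)]
  ring

/-- The beta value contains Γ(5/2 - H) = (3/2 - H) Γ(3/2 - H), which cancels the factor 1 - a and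
the numerator of c_H². -/
theorem molchanGolosovConst_sq {H : ℝ} (hH : H ∈ Set.Ioo (0 : ℝ) 1) :
    molchanGolosovConst H ^ 2 * ((1 - (H - 1 / 2)) *
      beta (H - 1 / 2 + 1) (1 - 2 * (H - 1 / 2))) = 2 * H := by
  obtain ⟨h0, h1⟩ := hH
  have g1 : 0 < Real.Gamma (3 / 2 - H) := Real.Gamma_pos_of_pos (by linarith)
  have g2 : 0 < Real.Gamma (2 - 2 * H) := Real.Gamma_pos_of_pos (by linarith)
  have g3 : 0 < Real.Gamma (H + 1 / 2) := Real.Gamma_pos_of_pos (by linarith)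
  rw [molchanGolosovConst, Real.sq_sqrt (by positivity), beta]
  have e1 : H - 1 / 2 + 1 = H + 1 / 2 := by ring
  have e2 : 1 - 2 * (H - 1 / 2) = 2 - 2 * H := by ring
  have e3 : H + 1 / 2 + (2 - 2 * H) = (3 / 2 - H) + 1 := by ring
  have e4 : 1 - (H - 1 / 2) = 3 / 2 - H := by ring
  have hne : 3 / 2 - H ≠ 0 := by linarith
  rw [e1, e2, e3, e4, Real.Gamma_add_one hne]
  generalize Real.Gamma (3 / 2 - H) = x at *
  generalize 3 / 2 - H = y at *
  field_simp

/-- The Molchan-Golosov kernel has squared norm `t ^ (2 H)`. -/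
theorem lintegral_molchanGolosov_sq {H : ℝ} (hH : H ∈ Set.Ioo (0 : ℝ) 1) (t : ℝ≥0) :
    ∫⁻ s : ℝ in Set.Ioc 0 (t : ℝ), ‖molchanGolosov H t s.toNNReal‖ₑ ^ 2 =
      ((t ^ (2 * H) : ℝ≥0) : ℝ≥0∞) := by
  have hH0 : 0 < H := hH.1
  rcases eq_or_lt_of_le (zero_le : (0 : ℝ≥0) ≤ t) with rfl | ht
  · simp [NNReal.zero_rpow (show 2 * H ≠ 0 by positivity)]
  have ht : (0 : ℝ) < t := ht
  set a := H - 1 / 2 with ha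
  have ha1 : -(1 / 2) < a := by rw [ha]; linarith
  have ha2 : a < 1 / 2 := by rw [ha]; linarith [hH.2]
  have h2H : 2 * a + 1 = 2 * H := by rw [ha]; ring
  set c := molchanGolosovConst H ^ 2 with hc
  have hlin : ∀ s : ℝ, HasDerivAt (fun s : ℝ => 1 - s / t) (-(1 / (t : ℝ))) s := fun s =>
    ((hasDerivAt_id s).div_const (t : ℝ)).const_sub 1
  have hIoo : ∀ s ∈ Set.Ioo (0 : ℝ) t, 1 - s / t ∈ Set.Ioo (0 : ℝ) 1 := fun s hs =>
    ⟨by rw [sub_pos, div_lt_one ht]; exact hs.2, by have := div_pos hs.1 ht; linarith⟩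
  -- The antiderivative is `hypPhi` at u = 1 - s/t. As s increases u decreases, hence the minus sign
  -- and the limit of `hypPhi` at 1 appearing at s = 0.
  have h := lintegral_deriv_of_nonneg_of_tendsto (a := 0) (b := t)
    (f := fun s => -(c * t ^ (2 * H) / (2 * H)) * hypPhi a (1 - s / t))
    (f' := fun s => molchanGolosov H t s ^ 2) ht
    (fa := -(c * t ^ (2 * H) / (2 * H)) * ((1 - a) * beta (a + 1) (1 - 2 * a)))
    (fb := -(c * t ^ (2 * H) / (2 * H)) * 0)
    (fun s hs => by
      refine (((hasDerivAt_hypPhi ha1 ha2 (hIoo s hs)).comp s (hlin s)).const_mul _).congr_deriv ?_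
      rw [molchanGolosov_sq hs.1 hs.2, ← ha, ← hc, h2H, ← h2H, Real.rpow_add_one ht.ne', h2H]
      field_simp)
    (fun s hs => sq_nonneg _)
    (by
      refine Tendsto.const_mul _ ((tendsto_hypPhi_one ha1 ha2).comp ?_)
      refine tendsto_nhdsWithin_iff.2 ⟨?_, ?_⟩
      · have := ((hlin 0).continuousAt.tendsto).mono_left
          (nhdsWithin_le_nhds (s := Set.Ioi (0 : ℝ)))
        simpa using this
      · filter_upwards [self_mem_nhdsWithin] with s hs
        have : 0 < s / t := div_pos hs ht
        simp only [Set.mem_Iio]; linarith)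
    (by
      refine Tendsto.const_mul _ ((tendsto_hypPhi_zero ha1 ha2).comp ?_)
      refine tendsto_nhdsWithin_iff.2 ⟨?_, ?_⟩
      · have := ((hlin t).continuousAt.tendsto).mono_left
          (nhdsWithin_le_nhds (s := Set.Iio (t : ℝ)))
        simpa [ht.ne'] using this
      · filter_upwards [self_mem_nhdsWithin] with s hs
        rw [Set.mem_Ioi, sub_pos, div_lt_one ht]; exact hs)
  have hfin : -(c * (t : ℝ) ^ (2 * H) / (2 * H)) * 0 - -(c * t ^ (2 * H) / (2 * H)) *
      ((1 - a) * beta (a + 1) (1 - 2 * a)) = (t : ℝ) ^ (2 * H) := by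
    have := molchanGolosovConst_sq hH
    rw [← ha, ← hc] at this
    rw [mul_zero, zero_sub, neg_mul, neg_neg]
    calc _ = (t : ℝ) ^ (2 * H) / (2 * H) * (c * ((1 - a) * beta (a + 1) (1 - 2 * a))) := by ring
      _ = _ := by rw [this]; field_simp
  rw [hfin] at h
  rw [← ENNReal.ofReal_coe_nnreal, NNReal.coe_rpow, ← h]
  refine setLIntegral_congr_fun measurableSet_Ioc fun s hs => ?_
  simp only [Real.coe_toNNReal s hs.1.le]
  rw [Real.enorm_eq_ofReal_abs, ← ENNReal.ofReal_pow (abs_nonneg _), sq_abs]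

end Variance

/-! ### Uniform closeness of stochastic integrals and Riemann sums on a grid. -/

section DiscreteSDE

variable {Ω : Type*} {mΩ : MeasurableSpace Ω} {P : Measure Ω} {F : Filtration ℝ≥0 mΩ}

/-- A Riemann sum written along a refined grid. -/
theorem riemannSum_mul (G M : ℝ≥0 → Ω → ℝ) (h : ℝ≥0) {m : ℕ} (hm : 0 < m) (i : ℕ) (ω : Ω) :
    riemannSum G M (m * h) i ω = ∑ j ∈ Finset.range (i * m),
      G (((j / m * m : ℕ) : ℝ≥0) * h) ω * (M ((j + 1 : ℕ) * h) ω - M (j * h) ω) := by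
  unfold riemannSum
  induction i with
  | zero => simp
  | succ i ih =>
    rw [Finset.sum_range_succ, ih, Nat.succ_mul, Finset.sum_range_add]
    congr 1
    have e : ∀ x ∈ Finset.range m, G (((((i * m + x) / m * m : ℕ)) : ℝ≥0) * h) ω *
        (M (((i * m + x + 1 : ℕ) : ℝ≥0) * h) ω - M (((i * m + x : ℕ) : ℝ≥0) * h) ω) =
        G (i * (m * h)) ω *
        (M (((i * m + (x + 1) : ℕ) : ℝ≥0) * h) ω - M (((i * m + x : ℕ) : ℝ≥0) * h) ω) := by
      intro x hx
      have : (i * m + x) / m = i := by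
        rw [mul_comm, Nat.mul_add_div hm, Nat.div_eq_of_lt (Finset.mem_range.1 hx), add_zero]
      rw [this, Nat.cast_mul, mul_assoc, add_assoc]
    rw [Finset.sum_congr rfl e, ← Finset.mul_sum,
      Finset.sum_range_sub (fun x => M (((i * m + x : ℕ) : ℝ≥0) * h) ω)]
    congr 3
    · push_cast; ring_nf
    · push_cast; ring_nf

theorem tendsto_measure_exists_le_of_tendsto [IsFiniteMeasure P] {f : ℕ → ℕ → Ω → ℝ} {N : ℕ}
    {ε : ℝ} (h : ∀ i ≤ N, Tendsto (fun m => P {ω | ε ≤ |f m i ω|}) atTop (𝓝 0)) :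
    Tendsto (fun m => P {ω | ∃ i ≤ N, ε ≤ |f m i ω|}) atTop (𝓝 0) := by
  have hs : Tendsto (fun m => ∑ i ∈ Finset.range (N + 1), P {ω | ε ≤ |f m i ω|}) atTop (𝓝 0) := by
    have := tendsto_finsetSum (Finset.range (N + 1))
      (fun i hi => h i (Nat.lt_succ_iff.1 (Finset.mem_range.1 hi)))
    simpa using this
  refine tendsto_of_tendsto_of_tendsto_of_le_of_le tendsto_const_nhds hs (fun _ => zero_le)
    fun m => ?_
  refine le_trans (measure_mono ?_) (measure_biUnion_finset_le (Finset.range (N + 1)) _)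
  rintro ω ⟨i, hi, hω⟩
  exact Set.mem_biUnion (Finset.mem_coe.2 (Finset.mem_range.2 (Nat.lt_succ_of_le hi))) hω

theorem measurable_riemannSum_of_adapted {G M : ℝ≥0 → Ω → ℝ} (hG : Adapted F G)
    (hM : Adapted F M) (h : ℝ≥0) (i : ℕ) : Measurable[F (i * h)] (riemannSum G M h i) := by
  unfold riemannSum
  refine Finset.measurable_fun_sum _ fun j hj => ?_
  have hj' : j + 1 ≤ i := Finset.mem_range.1 hj
  have h1 : ((j + 1 : ℝ≥0)) * h ≤ i * h := by gcongr; exact_mod_cast hj'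
  have h2 : (j : ℝ≥0) * h ≤ i * h := by gcongr; omega
  exact (((hG _).mono (F.mono h2) le_rfl)).mul
    (((hM _).mono (F.mono h1) le_rfl).sub ((hM _).mono (F.mono h2) le_rfl))

/-- The stochastic integral process is uniformly close to its Riemann sums on the grid. -/
theorem tendsto_measure_exists_le_abs_sub_riemannSum [IsProbabilityMeasure P]
    {G M R : ℝ≥0 → Ω → ℝ} {C : ℝ} (hC : 0 < C) (hMa : Adapted F M)
    (hM : ∀ s t : ℝ≥0, s ≤ t → IsNoise (F s) P (fun ω => M t ω - M s ω) (C * (t - s)))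
    (hG : Adapted F G) (hGc : ∀ ω, Continuous fun s => G s ω)
    (hR : ∀ T : ℝ≥0, TendstoInMeasure P (fun n : ℕ => riemannSum G M (T / n) n) atTop (R T))
    {t : ℝ≥0} (ht : 0 < t) {ε : ℝ} (hε : 0 < ε) :
    Tendsto (fun N : ℕ => P {ω | ∃ i ≤ N, ε ≤ |R (i * (t / N)) ω - riemannSum G M (t / N) i ω|})
      atTop (𝓝 0) := by
  have hε2 : 0 < ε / 2 := by positivity
  have key : ∀ N : ℕ, 0 < N → ∀ i ≤ N, Tendsto (fun m : ℕ => P {ω | ε / 2 ≤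
      |riemannSum G M (t / (N * (m + 1 : ℕ))) (i * (m + 1)) ω - R (i * (t / N)) ω|})
      atTop (𝓝 0) := by
    intro N hN i hi
    have h1 := (tendstoInMeasure_real_iff.1 (hR (i * (t / N)))) (ε / 2) hε2
    rcases Nat.eq_zero_or_pos i with rfl | hi0
    · refine h1.congr fun m => ?_
      simp [riemannSum]
    · have h2 : Tendsto (fun m : ℕ => i * (m + 1)) atTop atTop :=
        tendsto_atTop_mono (fun m => by simp only [id]; nlinarith) tendsto_id
      refine (h1.comp h2).congr fun m => ?_
      -- With i(m+1) steps on [0, it/N] the mesh is t/(N(m+1)), independent of i: one refined grid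
      -- serves all i.
      have : (i * (t / N) : ℝ≥0) / ((i * (m + 1) : ℕ) : ℝ≥0) = t / (N * (m + 1 : ℕ)) := by
        have : (i : ℝ≥0) ≠ 0 := by exact_mod_cast hi0.ne'
        have : (N : ℝ≥0) ≠ 0 := by exact_mod_cast hN.ne'
        push_cast
        field_simp
      simp only [Function.comp_apply, this]
  -- For each N, refine until the fine sums are within ε/2 of R at all N + 1 coarse points
  -- simultaneously, up to probability 1/(N+1).
  have hm : ∀ N : ℕ, ∃ m : ℕ, 0 < m ∧ (0 < N → P {ω | ∃ i ≤ N, ε / 2 ≤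
      |riemannSum G M (t / (N * m)) (i * m) ω - R (i * (t / N)) ω|} ≤
        ENNReal.ofReal (1 / (N + 1))) := by
    intro N
    rcases Nat.eq_zero_or_pos N with rfl | hN
    · exact ⟨1, one_pos, fun h => absurd h (lt_irrefl _)⟩
    · have := tendsto_measure_exists_le_of_tendsto (P := P) (N := N) (ε := ε / 2)
        (f := fun m i ω => riemannSum G M (t / (N * (m + 1 : ℕ))) (i * (m + 1)) ω -
          R (i * (t / N)) ω) (key N hN)
      obtain ⟨m, h⟩ := (eventually_le_ofReal_of_tendsto_zero this
        (η := 1 / ((N : ℝ) + 1)) (by positivity)).exists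
      exact ⟨m + 1, by omega, fun _ => h⟩
  choose m hm0 hm using hm
  set h : ℕ → ℝ≥0 := fun N => t / (N * m N) with hh
  -- The fine sum minus the coarse sum is a transform with coefficient U: G at a fine point minus G
  -- at the preceding coarse point. By uniform continuity its energy tends to 0 on every path.
  set U : ℕ → ℕ → Ω → ℝ := fun N j ω =>
    G ((j : ℝ≥0) * h N) ω - G (((j / m N * m N : ℕ) : ℝ≥0) * h N) ω with hU
  set Q : ℕ → Ω → ℝ := fun N ω => ∑ j ∈ Finset.range (N * m N), C * h N * U N j ω ^ 2 with hQ
  have hmh : ∀ N, (m N : ℝ≥0) * h N = t / N := by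
    intro N
    have : (m N : ℝ≥0) ≠ 0 := by exact_mod_cast (hm0 N).ne'
    simp only [hh]
    rw [← div_div, mul_div_cancel₀ _ this]
  have hQm : ∀ N, Measurable (Q N) := by
    intro N
    have hGm : ∀ s, Measurable (G s) := fun s => (hG s).mono (F.le s) le_rfl
    exact Finset.measurable_fun_sum _ fun j _ =>
      (((hGm _).sub (hGm _)).pow_const 2).const_mul _
  have hQ0 : TendstoInMeasure P Q atTop (fun _ => 0) := by
    refine tendstoInMeasure_of_tendsto_ae (fun N => (hQm N).aestronglyMeasurable)
      (ae_of_all _ fun ω => ?_)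
    rw [Metric.tendsto_atTop']
    intro η hη
    have hη' : 0 < √(η / (C * t * 2)) := Real.sqrt_pos.2 (by positivity)
    obtain ⟨δ, hδ, hmod⟩ := exists_modulus_of_continuous (hGc ω) t hη'
    obtain ⟨n₀, hn₀⟩ := (eventually_div_lt t hδ).exists_forall_of_atTop
    refine ⟨n₀ + 1, fun N hN => ?_⟩
    have hN0 : 0 < N := by omega
    have hU' : ∀ j ∈ Finset.range (N * m N), U N j ω ^ 2 ≤ η / (C * t * 2) := by
      intro j hj
      have hj := Finset.mem_range.1 hj
      have hle : ∀ j ≤ N * m N, ((j : ℕ) : ℝ≥0) * h N ≤ t := by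
        intro j hj
        have := nat_mul_div_le t hj
        rwa [Nat.cast_mul] at this
      have hdm := Nat.div_add_mod' j (m N)
      have hml := Nat.mod_lt j (hm0 N)
      have hd : dist ((j : ℝ≥0) * h N) (((j / m N * m N : ℕ) : ℝ≥0) * h N) < δ := by
        refine lt_of_le_of_lt ?_ (hn₀ N (by omega))
        rw [← hmh N, NNReal.dist_eq]
        push_cast
        rw [← sub_mul, abs_mul, abs_of_nonneg (h N).coe_nonneg]
        gcongr
        have e : ((j : ℝ)) - ((j / m N : ℕ) : ℝ) * (m N : ℝ) = ((j % m N : ℕ) : ℝ) := by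
          rw [sub_eq_iff_eq_add', ← Nat.cast_mul, ← Nat.cast_add, hdm]
        rw [e, abs_of_nonneg (by positivity)]
        exact_mod_cast hml.le
      have := hmod _ (hle j hj.le) _ (hle (j / m N * m N) (by omega)) hd
      rw [← sq_abs]
      calc |U N j ω| ^ 2 ≤ (√(η / (C * t * 2))) ^ 2 := by gcongr
        _ = _ := Real.sq_sqrt (by positivity)
    have hQn : 0 ≤ Q N ω := Finset.sum_nonneg fun j _ => by positivity
    rw [Real.dist_eq, sub_zero, abs_of_nonneg hQn]
    calc Q N ω ≤ ∑ j ∈ Finset.range (N * m N), C * h N * (η / (C * t * 2)) := by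
          refine Finset.sum_le_sum fun j hj => ?_
          have := hU' j hj
          gcongr
      _ = η / 2 := by
          have h1 : (N : ℝ) ≠ 0 := by exact_mod_cast hN0.ne'
          have h2 : (m N : ℝ) ≠ 0 := by exact_mod_cast (hm0 N).ne'
          have h3 : (t : ℝ) ≠ 0 := by exact_mod_cast ht.ne'
          simp only [Finset.sum_const, Finset.card_range, nsmul_eq_mul, hh]
          push_cast
          field_simp
      _ < η := by linarith
  refine tendsto_zero_of_forall_eventually_le_ofReal fun η hη => ?_
  set δ := η / 3 * (ε / 2) ^ 2 with hδ
  have hδ0 : 0 < δ := by positivity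
  have hone : Tendsto (fun N : ℕ => ENNReal.ofReal (1 / ((N : ℝ) + 1))) atTop (𝓝 0) := by
    have := ENNReal.tendsto_ofReal (tendsto_one_div_add_atTop_nhds_zero_nat (𝕜 := ℝ))
    simpa using this
  filter_upwards [eventually_gt_atTop 0,
    eventually_le_ofReal_of_tendsto_zero hone (η := η / 3) (by positivity),
    eventually_le_ofReal_of_tendsto_zero (tendstoInMeasure_real_iff.1 hQ0 δ hδ0)
      (η := η / 3) (by positivity)] with N hN h1 h2
  have hhpos : 0 < h N := by
    have := hm0 N
    simp only [hh]; positivity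
  have hL := measure_exists_le_abs_sum_le (P := P) (𝒢 := fun j : ℕ => F (j * h N))
    (ζ := fun j ω => M ((j + 1 : ℕ) * h N) ω - M (j * h N) ω) (U := U N) (c := fun _ => C * h N)
    (fun i j hij => F.mono (by gcongr)) (fun j => F.le _)
    (fun j => ((hMa _).sub ((hMa _).mono (F.mono (by gcongr; omega)) le_rfl)))
    (fun j => mul_pos hC hhpos)
    (fun j => by
      have := hM (j * h N) ((j + 1 : ℕ) * h N) (by gcongr; omega)
      have e : (C * (((((j + 1 : ℕ) : ℝ≥0) * h N : ℝ≥0) : ℝ) - ((j * h N : ℝ≥0) : ℝ))) =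
        C * h N := by push_cast; ring
      rwa [e] at this)
    (fun j => (hG _).sub ((hG _).mono (F.mono (by
      gcongr; exact Nat.div_mul_le_self j (m N))) le_rfl)) Set.univ (N * m N) hε2 hδ0
  simp only [Set.univ_inter] at hL
  have e3 : δ / (ε / 2) ^ 2 = η / 3 := by rw [hδ]; field_simp
  rw [e3] at hL
  calc _ ≤ P ({ω | ∃ i ≤ N, ε / 2 ≤
      |riemannSum G M (t / (N * m N)) (i * m N) ω - R (i * (t / N)) ω|} ∪
      {ω | ∃ k ≤ N * m N, ε / 2 ≤ |∑ j ∈ Finset.range k, U N j ω *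
        (M ((j + 1 : ℕ) * h N) ω - M (j * h N) ω)|}) := by
        apply measure_mono
        rintro ω ⟨i, hi, hω⟩
        by_cases hc : ε / 2 ≤ |riemannSum G M (t / (N * m N)) (i * m N) ω - R (i * (t / N)) ω|
        · exact Or.inl ⟨i, hi, hc⟩
        · refine Or.inr ⟨i * m N, Nat.mul_le_mul_right _ hi, ?_⟩
          have e : ∑ j ∈ Finset.range (i * m N), U N j ω *
              (M ((j + 1 : ℕ) * h N) ω - M (j * h N) ω) =
              riemannSum G M (t / (N * m N)) (i * m N) ω - riemannSum G M (t / N) i ω := by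
            rw [← hmh N, riemannSum_mul G M (h N) (hm0 N), riemannSum, ← Finset.sum_sub_distrib]
            refine Finset.sum_congr rfl fun j _ => ?_
            simp only [hU]
            push_cast
            ring
          rw [e]
          rw [not_le, abs_lt] at hc
          rcases le_abs.1 hω with h | h
          · refine le_trans ?_ (le_abs_self _); linarith
          · refine le_trans ?_ (neg_le_abs _); linarith
    _ ≤ ENNReal.ofReal (η / 3) + (ENNReal.ofReal (η / 3) + ENNReal.ofReal (η / 3)) := by
        refine (measure_union_le _ _).trans (add_le_add ((hm N hN).trans h1) (hL.trans ?_))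
        gcongr
        refine le_trans (measure_mono fun ω hω => ?_) h2
        simp only [Set.mem_ofPred_eq, sub_zero] at hω ⊢
        exact hω.le.trans (le_abs_self _)
    _ = ENNReal.ofReal η := by
        rw [← ENNReal.ofReal_add (by positivity) (by positivity),
          ← ENNReal.ofReal_add (by positivity) (by positivity)]
        congr 1; ring

/-- Tightness of the running maximum of a continuous process. -/
theorem exists_forall_measure_exists_lt_abs_le [IsFiniteMeasure P] {G : ℝ≥0 → Ω → ℝ}
    (hG : ∀ s, Measurable (G s)) (hGc : ∀ ω, Continuous fun s => G s ω) (t : ℝ≥0) {η : ℝ}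
    (hη : 0 < η) :
    ∃ K : ℝ, 0 < K ∧ ∀ N : ℕ, P {ω | ∃ i ≤ N, K < |G (i * (t / N)) ω|} ≤ ENNReal.ofReal η := by
  set E : ℕ → Set Ω := fun K => ⋃ p : ℕ × ℕ, {ω | p.1 ≤ p.2 ∧ (K : ℝ) < |G (p.1 * (t / p.2)) ω|}
    with hE
  have hEm : ∀ K, MeasurableSet (E K) := fun K => MeasurableSet.iUnion fun p => by
    have : MeasurableSet {ω | (K : ℝ) < |G (p.1 * (t / p.2)) ω|} :=
      measurableSet_lt measurable_const (hG _).abs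
    exact (MeasurableSet.const (p.1 ≤ p.2)).inter this
  have hEa : Antitone E := by
    intro K L hKL ω hω
    obtain ⟨p, hp, h⟩ := Set.mem_iUnion.1 hω
    exact Set.mem_iUnion.2 ⟨p, hp, lt_of_le_of_lt (by exact_mod_cast hKL) h⟩
  -- Each path is bounded on [0, t], so it leaves E K for large K; continuity from above then gives
  -- a K that works for all N at once.
  have hE0 : ⋂ K, E K = ∅ := by
    rw [Set.eq_empty_iff_forall_notMem]
    intro ω hω
    obtain ⟨C, hC⟩ := exists_abs_le_of_continuous (hGc ω) t
    obtain ⟨K, hK⟩ := exists_nat_ge C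
    obtain ⟨p, hp, h⟩ := Set.mem_iUnion.1 (Set.mem_iInter.1 hω K)
    have := hC _ (nat_mul_div_le t hp)
    linarith
  have h := tendsto_measure_iInter_atTop (μ := P) (fun K => (hEm K).nullMeasurableSet) hEa
    ⟨0, measure_ne_top _ _⟩
  rw [hE0, measure_empty] at h
  obtain ⟨K, hK, hK0⟩ := ((eventually_le_ofReal_of_tendsto_zero h hη).and
    (eventually_gt_atTop 0)).exists
  refine ⟨K, by exact_mod_cast hK0, fun N => le_trans (measure_mono ?_) hK⟩
  rintro ω ⟨i, hi, h⟩
  exact Set.mem_iUnion.2 ⟨(i, N), hi, h⟩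

end DiscreteSDE

/-! ### Convergence of Euler products to the solution of the linear equation. -/

section DoleansExponential

variable {Ω : Type*} {mΩ : MeasurableSpace Ω} {P : Measure Ω} {F : Filtration ℝ≥0 mΩ}

/-- A discrete Gronwall bound for perturbed linear recursions driven by noise. -/
theorem measure_le_abs_of_linear_recursion [IsProbabilityMeasure P] {𝒢 : ℕ → MeasurableSpace Ω}
    {ζ a e x : ℕ → Ω → ℝ} {c K δ ε : ℝ} (hmono : Monotone 𝒢) (hle : ∀ j, 𝒢 j ≤ mΩ)
    (hζm : ∀ j, Measurable[𝒢 (j + 1)] (ζ j)) (hc : 0 ≤ c) (hζ : ∀ j, IsNoise (𝒢 j) P (ζ j) c)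
    (ha : ∀ j, Measurable[𝒢 j] (a j)) (he : ∀ j, Measurable[𝒢 j] (e j)) (hK : 0 ≤ K)
    (hδ : 0 ≤ δ) (hε : 0 < ε) (hx0 : ∀ ω, x 0 ω = 0)
    (hx : ∀ j ω, x (j + 1) ω = x j ω + a j ω * (x j ω + e j ω) * ζ j ω) (n : ℕ) :
    P {ω | ε ≤ |x n ω|} ≤ P {ω | ∃ j ≤ n, K < |a j ω|} + P {ω | ∃ j ≤ n, δ < |e j ω|} +
      ENNReal.ofReal (δ ^ 2 * Real.exp (2 * c * K ^ 2 * n) / ε ^ 2) := by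
  classical
  set good : ℕ → Set Ω := fun j => {ω | |a j ω| ≤ K} ∩ {ω | |e j ω| ≤ δ} with hgood
  have hgm : ∀ j, MeasurableSet[𝒢 j] (good j) := fun j =>
    MeasurableSet.inter (m := 𝒢 j) ((measurable_abs.comp (ha j)) measurableSet_Iic)
      ((measurable_abs.comp (he j)) measurableSet_Iic)
  -- The same recursion with the noise switched off at every step where a or e is too large. Its
  -- coefficients are bounded, so it is square-integrable, and it agrees with x at time n when no
  -- step is bad.
  let x' : ℕ → Ω → ℝ := fun n => Nat.rec (fun _ => 0) (fun j y ω =>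
    y ω + (good j).indicator (fun ω => a j ω * (y ω + e j ω)) ω * ζ j ω) n
  set X : ℕ → Ω → ℝ := fun j => (good j).indicator (fun ω => a j ω * (x' j ω + e j ω)) with hX
  have hx'0 : x' 0 = fun _ => 0 := rfl
  have hx's : ∀ j, x' (j + 1) = fun ω => x' j ω + X j ω * ζ j ω := fun j => rfl
  have hXm' : ∀ j, Measurable[𝒢 j] (x' j) → Measurable[𝒢 j] (X j) := fun j h =>
    ((ha j).mul (h.add (he j))).indicator (hgm j)
  have hx'm : ∀ j, Measurable[𝒢 j] (x' j) := by
    intro j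
    induction j with
    | zero => exact measurable_const
    | succ j ih =>
      rw [hx's]
      exact (ih.mono (hmono (Nat.le_succ j)) le_rfl).add
        (((hXm' j ih).mono (hmono (Nat.le_succ j)) le_rfl).mul (hζm j))
  have hXm := fun j => hXm' j (hx'm j)
  have hXle : ∀ j ω, |X j ω| ≤ K * (|x' j ω| + δ) := by
    intro j ω
    by_cases hω : ω ∈ good j
    · rw [hX]
      simp only [Set.indicator_of_mem hω, abs_mul]
      have h1 : |a j ω| ≤ K := hω.1
      have h2 : |e j ω| ≤ δ := hω.2
      gcongr
      exact (abs_add_le _ _).trans (by gcongr)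
    · rw [hX]
      simp only [Set.indicator_of_notMem hω, abs_zero]
      positivity
  have hX2' : ∀ j, MemLp (x' j) 2 P → MemLp (X j) 2 P := fun j h =>
    ((h.abs.add (memLp_const δ)).const_mul K).mono'
      ((hXm j).mono (hle j) le_rfl).aestronglyMeasurable (ae_of_all _ (hXle j))
  have hx'2 : ∀ j, MemLp (x' j) 2 P := by
    intro j
    induction j with
    | zero => exact memLp_const 0
    | succ j ih =>
      rw [hx's]
      exact (hζ j).memLp_add (hXm j) (hX2' j ih) ih
  have hX2 := fun j => hX2' j (hx'2 j)
  -- The quantity E[x'²] + δ² grows by a factor of at most 1 + 2cK² ≤ exp(2cK²) per step.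
  have hbd : ∀ j, ∫ ω, x' j ω ^ 2 ∂P + δ ^ 2 ≤ δ ^ 2 * Real.exp (2 * c * K ^ 2 * j) := by
    intro j
    induction j with
    | zero => simp [hx'0]
    | succ j ih =>
      have h1 := (hζ j).integral_add_sq_le (hXm j) (hX2 j) (hx'm j) (hx'2 j)
      have h2 : ∫ ω, X j ω ^ 2 ∂P ≤ 2 * K ^ 2 * (∫ ω, x' j ω ^ 2 ∂P + δ ^ 2) := by
        have hi := (hx'2 j).integrable_sq
        calc ∫ ω, X j ω ^ 2 ∂P ≤ ∫ ω, 2 * K ^ 2 * (x' j ω ^ 2 + δ ^ 2) ∂P := by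
              refine integral_mono (hX2 j).integrable_sq
                ((hi.add (integrable_const _)).const_mul _) fun ω => ?_
              have h := hXle j ω
              simp only
              rw [← sq_abs (X j ω), ← sq_abs (x' j ω)]
              calc |X j ω| ^ 2 ≤ (K * (|x' j ω| + δ)) ^ 2 := by gcongr
                _ ≤ _ := by
                  rw [mul_pow, mul_comm 2, mul_assoc]
                  gcongr
                  nlinarith [sq_nonneg (|x' j ω| - δ)]
          _ = _ := by
              rw [integral_const_mul, integral_add hi (integrable_const _)]; simp
      rw [hx's]
      have h3 : (1 : ℝ) + 2 * c * K ^ 2 ≤ Real.exp (2 * c * K ^ 2) := by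
        linarith [Real.add_one_le_exp (2 * c * K ^ 2)]
      have h4 : 0 ≤ ∫ ω, x' j ω ^ 2 ∂P + δ ^ 2 :=
        add_nonneg (integral_nonneg fun ω => sq_nonneg _) (sq_nonneg _)
      calc _ ≤ (∫ ω, x' j ω ^ 2 ∂P + δ ^ 2) * (1 + 2 * c * K ^ 2) := by
            have := mul_le_mul_of_nonneg_left h2 hc
            nlinarith
        _ ≤ (δ ^ 2 * Real.exp (2 * c * K ^ 2 * j)) * Real.exp (2 * c * K ^ 2) := by gcongr
        _ = _ := by
            rw [mul_assoc, ← Real.exp_add]; congr 2; push_cast; ring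
  have hcheb : P {ω | ε ^ 2 ≤ x' n ω ^ 2} ≤
      ENNReal.ofReal (δ ^ 2 * Real.exp (2 * c * K ^ 2 * n) / ε ^ 2) := by
    have h1 := mul_meas_ge_le_integral_of_nonneg (μ := P) (f := fun ω => x' n ω ^ 2)
      (ae_of_all _ fun ω => sq_nonneg _) (hx'2 n).integrable_sq (ε ^ 2)
    rw [← ofReal_measureReal]
    apply ENNReal.ofReal_le_ofReal
    rw [le_div_iff₀ (by positivity)]
    have := hbd n
    nlinarith [sq_nonneg δ]
  calc _ ≤ P (({ω | ∃ j ≤ n, K < |a j ω|} ∪ {ω | ∃ j ≤ n, δ < |e j ω|}) ∪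
      {ω | ε ^ 2 ≤ x' n ω ^ 2}) := by
        apply measure_mono
        intro ω hω
        by_cases h1 : ∃ j ≤ n, K < |a j ω|
        · exact Or.inl (Or.inl h1)
        by_cases h2 : ∃ j ≤ n, δ < |e j ω|
        · exact Or.inl (Or.inr h2)
        refine Or.inr ?_
        push Not at h1 h2
        have : ∀ j ≤ n, x' j ω = x j ω := by
          intro j hj
          induction j with
          | zero => rw [hx0, hx'0]
          | succ j ih =>
            have hg : ω ∈ good j := ⟨h1 j (by omega), h2 j (by omega)⟩
            rw [hx's, hx]
            simp only [hX, Set.indicator_of_mem hg, ih (by omega)]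
        simp only [Set.mem_ofPred_eq] at hω ⊢
        rw [this n le_rfl, ← sq_abs (x n ω)]
        gcongr
    _ ≤ _ := (measure_union_le _ _).trans (add_le_add (measure_union_le _ _) hcheb)

/-- The solution of `dS = α S dM` is the limit of the discrete stochastic exponentials. -/
theorem tendstoInMeasure_prod_one_add [IsProbabilityMeasure P]
    {M α S : ℝ≥0 → Ω → ℝ} {C s₀ : ℝ} (hC : 0 < C) (hMa : Adapted F M)
    (hM : ∀ s t : ℝ≥0, s ≤ t → IsNoise (F s) P (fun ω => M t ω - M s ω) (C * (t - s)))
    (hα : Adapted F α) (hαc : ∀ ω, Continuous fun s => α s ω)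
    (hS : Adapted F S) (hSc : ∀ ω, Continuous fun s => S s ω)
    (hR : ∀ T : ℝ≥0, TendstoInMeasure P
      (fun n : ℕ => riemannSum (fun s ω => α s ω * S s ω) M (T / n) n) atTop
      (fun ω => S T ω - s₀)) {t : ℝ≥0} (ht : 0 < t) :
    TendstoInMeasure P (fun N ω => s₀ * ∏ j ∈ Finset.range N, (1 + α (j * (t / N)) ω *
      (M ((j + 1 : ℕ) * (t / N)) ω - M (j * (t / N)) ω))) atTop (S t) := by
  refine tendstoInMeasure_real_iff.2 fun ε hε => ?_
  refine tendsto_zero_of_forall_eventually_le_ofReal fun η hη => ?_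
  obtain ⟨K, hK, hKη⟩ := exists_forall_measure_exists_lt_abs_le (P := P)
    (fun s => (hα s).mono (F.le s) le_rfl) hαc t (η := η / 4) (by positivity)
  -- Tuned so that the Gronwall bound δ² exp(2CK²t)/(ε/2)² is at most η/4, as checked in `hδy`.
  set y := √(η / 4 * Real.exp (-(2 * C * K ^ 2 * t))) with hy
  have hy0 : 0 < y := Real.sqrt_pos.2 (by positivity)
  set δ := ε / 2 * min 1 y with hδ
  have hδ0 : 0 < δ := by positivity
  have hδε : δ ≤ ε / 2 := by
    rw [hδ]; exact mul_le_of_le_one_right (by positivity) (min_le_left _ _)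
  have hδy : δ ^ 2 * Real.exp (2 * C * K ^ 2 * t) / (ε / 2) ^ 2 ≤ η / 4 := by
    have h1 : δ ^ 2 ≤ (ε / 2) ^ 2 * (η / 4 * Real.exp (-(2 * C * K ^ 2 * t))) := by
      rw [← Real.sq_sqrt (show 0 ≤ η / 4 * Real.exp (-(2 * C * K ^ 2 * t)) by positivity), ← hy,
        ← mul_pow, hδ]
      gcongr
      exact min_le_right _ _
    rw [div_le_iff₀ (by positivity)]
    calc _ ≤ (ε / 2) ^ 2 * (η / 4 * Real.exp (-(2 * C * K ^ 2 * t))) *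
          Real.exp (2 * C * K ^ 2 * t) := by gcongr
      _ = (ε / 2) ^ 2 * (η / 4) * (Real.exp (-(2 * C * K ^ 2 * t)) *
          Real.exp (2 * C * K ^ 2 * t)) := by ring
      _ = _ := by rw [← Real.exp_add]; simp; ring
  have hG : Adapted F (fun s ω => α s ω * S s ω) := fun s => (hα s).mul (hS s)
  have h3a := tendsto_measure_exists_le_abs_sub_riemannSum (P := P) hC hMa hM hG
    (fun ω => (hαc ω).mul (hSc ω)) hR ht hδ0
  filter_upwards [eventually_gt_atTop 0, eventually_le_ofReal_of_tendsto_zero h3a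
      (η := η / 4) (by positivity)] with N hN h1
  set h : ℝ≥0 := t / N with hh
  -- A takes its Riemann sum along S itself, and E is the Euler product. Their difference x
  -- satisfies Δx = α(x + e)ΔM with e = S - A, because x + e = S - E, and e is uniformly small on
  -- the grid by `h3a`.
  set A : ℕ → Ω → ℝ := fun j ω => s₀ + riemannSum (fun s ω => α s ω * S s ω) M h j ω with hA
  set E : ℕ → Ω → ℝ := fun n ω => s₀ * ∏ j ∈ Finset.range n, (1 + α (j * h) ω *
      (M ((j + 1 : ℕ) * h) ω - M (j * h) ω)) with hE
  have hAm : ∀ j : ℕ, Measurable[F (j * h)] (A j) := fun j =>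
    measurable_const.add (measurable_riemannSum_of_adapted hG hMa h j)
  have hNh : (N : ℝ) * h = t := by
    have : (N : ℝ) ≠ 0 := by exact_mod_cast hN.ne'
    rw [hh]; push_cast; field_simp
  have hNh' : (N : ℝ≥0) * h = t := by exact_mod_cast hNh
  have hL := measure_le_abs_of_linear_recursion (P := P) (𝒢 := fun j : ℕ => F (j * h))
    (ζ := fun j ω => M ((j + 1 : ℕ) * h) ω - M (j * h) ω) (a := fun j => α (j * h))
    (e := fun j ω => S (j * h) ω - A j ω) (x := fun j ω => A j ω - E j ω) (c := C * h) (K := K)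
    (δ := δ) (ε := ε / 2)
    (fun i j hij => F.mono (by gcongr)) (fun j => F.le _)
    (fun j => ((hMa _).sub ((hMa _).mono (F.mono (by gcongr; omega)) le_rfl)))
    (mul_nonneg hC.le h.coe_nonneg)
    (fun j => by
      have := hM (j * h) ((j + 1 : ℕ) * h) (by gcongr; omega)
      have e : (C * (((((j + 1 : ℕ) : ℝ≥0) * h : ℝ≥0) : ℝ) - ((j * h : ℝ≥0) : ℝ))) =
        C * h := by push_cast; ring
      rwa [e] at this)
    (fun j => hα _) (fun j => (hS _).sub (hAm j)) hK.le hδ0.le (by positivity)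
    (fun ω => by simp [hA, hE, riemannSum])
    (fun j ω => by
      simp only [hA, hE, riemannSum, Finset.sum_range_succ, Finset.prod_range_succ]
      push_cast
      ring) N
  have e1 : 2 * (C * h) * K ^ 2 * N = 2 * C * K ^ 2 * t := by rw [← hNh]; ring
  rw [e1] at hL
  have hbad : {ω | ∃ j ≤ N, δ < |S (j * h) ω - A j ω|} ⊆ {ω | ∃ i ≤ N, δ ≤
      |S (i * h) ω - s₀ - riemannSum (fun s ω => α s ω * S s ω) M h i ω|} := by
    rintro ω ⟨j, hj, hω⟩
    refine ⟨j, hj, hω.le.trans_eq ?_⟩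
    simp only [hA]; congr 1; ring
  have hprob : P {ω | ∃ i ≤ N, δ ≤
      |S (i * h) ω - s₀ - riemannSum (fun s ω => α s ω * S s ω) M h i ω|} ≤
      ENNReal.ofReal (η / 4) := h1
  have hsub : {ω | ε ≤ |E N ω - S t ω|} ⊆ {ω | ε / 2 ≤ |A N ω - E N ω|} ∪ {ω | ∃ i ≤ N, δ ≤
      |S (i * h) ω - s₀ - riemannSum (fun s ω => α s ω * S s ω) M h i ω|} := by
    intro ω hω
    by_cases hc : δ ≤ |S (N * h) ω - s₀ - riemannSum (fun s ω => α s ω * S s ω) M h N ω|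
    · exact Or.inr ⟨N, le_rfl, hc⟩
    · refine Or.inl ?_
      rw [hNh', not_le] at hc
      have e2 : E N ω - S t ω = -(A N ω - E N ω) -
          (S t ω - s₀ - riemannSum (fun s ω => α s ω * S s ω) M h N ω) := by
        simp only [hA]; ring
      have h4 : ε ≤ |E N ω - S t ω| := hω
      rw [e2] at h4
      have h5 := h4.trans (abs_sub _ _)
      rw [abs_neg] at h5
      simp only [Set.mem_ofPred_eq]
      linarith
  calc _ ≤ P ({ω | ε / 2 ≤ |A N ω - E N ω|} ∪ {ω | ∃ i ≤ N, δ ≤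
        |S (i * h) ω - s₀ - riemannSum (fun s ω => α s ω * S s ω) M h i ω|}) := measure_mono hsub
    _ ≤ (ENNReal.ofReal (η / 4) + ENNReal.ofReal (η / 4) + ENNReal.ofReal (η / 4)) +
        ENNReal.ofReal (η / 4) := by
        refine (measure_union_le _ _).trans (add_le_add (hL.trans ?_) hprob)
        gcongr
        · exact hKη N
        · exact (measure_mono hbad).trans hprob
    _ = ENNReal.ofReal η := by
        rw [← ENNReal.ofReal_add (by positivity) (by positivity), ← ENNReal.ofReal_add (by positivity) (by positivity),
          ← ENNReal.ofReal_add (by positivity) (by positivity)]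
        congr 1; ring

end DoleansExponential

/-! ### Freezing one of two independent variables. -/

section Independence

variable {Ω E E' : Type*} {mΩ : MeasurableSpace Ω} {P : Measure Ω} [MeasurableSpace E]
  [MeasurableSpace E']

theorem ProbabilityTheory.IndepFun.lintegral_prod_eq [IsFiniteMeasure P] {X : Ω → E} {Y : Ω → E'}
    (h : IndepFun X Y P) (hX : AEMeasurable X P) (hY : AEMeasurable Y P) {f : E × E' → ℝ≥0∞}
    (hf : Measurable f) :
    ∫⁻ ω, f (X ω, Y ω) ∂P = ∫⁻ ω, ∫⁻ ω', f (X ω, Y ω') ∂P ∂P := by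
  have e := h.map_prod_eq_prod_map_map hX hY
  rw [← lintegral_map' hf.aemeasurable (hX.prodMk hY), e, lintegral_prod _ hf.aemeasurable,
    lintegral_map' hf.lintegral_prod_right'.aemeasurable hX]
  refine lintegral_congr fun ω => ?_
  exact lintegral_map' (hf.comp measurable_prodMk_left).aemeasurable hY

theorem ProbabilityTheory.IndepFun.integral_prod_eq [IsFiniteMeasure P] {X : Ω → E} {Y : Ω → E'}
    (h : IndepFun X Y P) (hX : AEMeasurable X P) (hY : AEMeasurable Y P) {f : E × E' → ℂ}
    (hf : Measurable f) {C : ℝ} (hC : ∀ p, ‖f p‖ ≤ C) :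
    ∫ ω, f (X ω, Y ω) ∂P = ∫ ω, ∫ ω', f (X ω, Y ω') ∂P ∂P := by
  have e := h.map_prod_eq_prod_map_map hX hY
  have hi : Integrable f ((P.map X).prod (P.map Y)) :=
    Integrable.of_bound hf.aestronglyMeasurable C (ae_of_all _ hC)
  rw [← integral_map (hX.prodMk hY) hf.aestronglyMeasurable, e, integral_prod _ hi,
    integral_map hX hf.stronglyMeasurable.integral_prod_right'.aestronglyMeasurable]
  refine integral_congr_ae (ae_of_all _ fun ω => ?_)
  exact integral_map hY (hf.comp measurable_prodMk_left).aestronglyMeasurable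

/-- Variables that are σ(X)-measurable only up to null sets are replaced by exact representatives,
all at once because the family is countable. -/
theorem ProbabilityTheory.IndepFun.of_aestronglyMeasurable_comap {X : Ω → E} {Y : Ω → E'}
    (h : IndepFun X Y P) {ι E'' : Type*} [Countable ι] [MeasurableSpace E''] {u : ι → Ω → ℝ}
    (hu : ∀ k, AEStronglyMeasurable[MeasurableSpace.comap X inferInstance] (u k) P)
    {φ : E' → E''} (hφ : Measurable φ) :
    IndepFun (fun ω k => u k ω) (fun ω => φ (Y ω)) P := by
  choose u' hu' hue using hu
  have h1 : Measurable[MeasurableSpace.comap X inferInstance] (fun ω k => u' k ω) :=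
    @measurable_pi_lambda _ _ _ (MeasurableSpace.comap X inferInstance) _ _
      fun k => (hu' k).measurable
  have h2 : IndepFun (fun ω k => u' k ω) (fun ω => φ (Y ω)) P := by
    rw [IndepFun_iff_Indep] at h ⊢
    refine indep_of_indep_of_le_left (indep_of_indep_of_le_right h ?_) h1.comap_le
    rw [← measurable_iff_comap_le]
    exact hφ.comp (comap_measurable Y)
  refine h2.congr ?_ EventuallyEq.rfl
  filter_upwards [ae_all_iff.2 hue] with ω hω
  ext k
  exact (hω k).symm

end Independence

/-! ### Quadratic variation and vanishing cross variation. -/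

section QuadraticVariation

variable {Ω : Type*} {mΩ : MeasurableSpace Ω} {P : Measure Ω} {F : Filtration ℝ≥0 mΩ}
  {B W : ℝ≥0 → Ω → ℝ}

theorem IsNoise.mono {m : MeasurableSpace Ω} {ζ : Ω → ℝ} {c c' : ℝ} (h : IsNoise m P ζ c)
    (hc : c ≤ c') : IsNoise m P ζ c' := fun X hX hX2 =>
  ⟨(h X hX hX2).1, (h X hX hX2).2.1.trans
    (mul_le_mul_of_nonneg_right hc (integral_nonneg fun _ => sq_nonneg _)), (h X hX hX2).2.2⟩

/-- By scaling; the numerical value of the fourth moment is never needed. -/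
theorem integral_pow_four_gaussianReal (v : ℝ≥0) :
    ∫ x, x ^ 4 ∂(gaussianReal 0 v) = v ^ 2 * ∫ x, x ^ 4 ∂(gaussianReal 0 1) := by
  have h := gaussianReal_map_const_mul (μ := 0) (v := 1) (√v)
  have e : (NNReal.mk (√(v : ℝ) ^ 2) (sq_nonneg _) * 1 : ℝ≥0) = v := by
    ext; simp
  rw [mul_zero, e] at h
  rw [← h, integral_map (by fun_prop) (by fun_prop), ← integral_const_mul]
  refine integral_congr_ae (ae_of_all _ fun x => ?_)
  have : (√(v : ℝ)) ^ 4 = v ^ 2 := by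
    rw [show 4 = 2 * 2 by norm_num, pow_mul, Real.sq_sqrt v.coe_nonneg]
  simp only [mul_pow, this]

/-- A compensated square has variance of order (t - s)², so N of them with mesh t/N contribute only
order 1/N. The constant is the fourth moment plus 1, to make it positive at no cost. -/
theorem IsFilteredBrownian.isNoise_sq [IsProbabilityMeasure P] (hB : IsFilteredBrownian F P B) :
    ∃ κ : ℝ, 0 < κ ∧ ∀ s t : ℝ≥0, s ≤ t → IsNoise (F s) P
      (fun ω => (B t ω - B s ω) ^ 2 - ((t : ℝ) - s)) (κ * ((t : ℝ) - s) ^ 2) := by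
  set κ := ∫ x, x ^ 4 ∂(gaussianReal 0 1) with hκ
  have hκ0 : 0 ≤ κ := integral_nonneg fun x => by positivity
  refine ⟨κ + 1, by linarith, fun s t hst => ?_⟩
  have hm : Measurable (fun ω => B t ω - B s ω) := (hB.measurable t).sub (hB.measurable s)
  have h4 : Integrable (fun ω => (B t ω - B s ω) ^ 4) P := by
    have := (hB.memLp_sub hst 4).integrable_norm_pow (p := 4) (by norm_num)
    refine this.congr (ae_of_all _ fun ω => ?_)
    simp only [Real.norm_eq_abs]
    rw [Even.pow_abs (by decide)]
  have h2 : Integrable (fun ω => (B t ω - B s ω) ^ 2) P := (hB.memLp_sub hst 2).integrable_sq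
  have hts : (((t - s : ℝ≥0)) : ℝ) = t - s := NNReal.coe_sub hst
  have e4 : ∫ ω, (B t ω - B s ω) ^ 4 ∂P = ((t : ℝ) - s) ^ 2 * κ := by
    have := (hB.hasLaw_sub hst).integral_comp (f := fun x => x ^ 4) (by fun_prop)
    simp only [Function.comp_def] at this
    rw [this, integral_pow_four_gaussianReal, hts]
  have e2 := hB.integral_sub_sq hst
  have hsq : ∀ ω, ((B t ω - B s ω) ^ 2 - ((t : ℝ) - s)) ^ 2 =
      (B t ω - B s ω) ^ 4 - 2 * ((t : ℝ) - s) * (B t ω - B s ω) ^ 2 + ((t : ℝ) - s) ^ 2 :=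
    fun ω => by ring
  have hi : Integrable (fun ω => ((B t ω - B s ω) ^ 2 - ((t : ℝ) - s)) ^ 2) P := by
    simp only [hsq]
    exact (h4.sub (h2.const_mul _)).add (integrable_const _)
  refine (IsNoise.of_indep (F.le s) ((memLp_two_iff_integrable_sq
    ((hm.pow_const 2).sub_const _).aestronglyMeasurable).2 hi) ((hm.pow_const 2).sub_const _)
    ?_ ?_ rfl).mono ?_
  · refine indep_of_indep_of_le_right (hB.indep s t hst) ?_
    rw [← measurable_iff_comap_le]
    exact ((comap_measurable (fun ω => B t ω - B s ω)).pow_const 2).sub_const _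
  · rw [MeasureTheory.integral_sub h2 (integrable_const _), e2]; simp
  · simp only [hsq]
    rw [integral_add (f := fun ω => (B t ω - B s ω) ^ 4 - 2 * ((t : ℝ) - s) * (B t ω - B s ω) ^ 2)
      (h4.sub (h2.const_mul _)) (integrable_const _),
      MeasureTheory.integral_sub h4 (h2.const_mul _), integral_const_mul, e4, e2]
    simp
    nlinarith [sq_nonneg ((t : ℝ) - s)]

/-- The compensated squares of Brownian increments are negligible. -/
theorem IsFilteredBrownian.tendstoInMeasure_sum_mul_sq_sub [IsProbabilityMeasure P]
    (hB : IsFilteredBrownian F P B) {G : ℝ≥0 → Ω → ℝ} (hG : Adapted F G)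
    (hGc : ∀ ω, Continuous fun s => G s ω) {t : ℝ≥0} (ht : 0 < t) :
    TendstoInMeasure P (fun (N : ℕ) ω => ∑ j ∈ Finset.range N, G (j * (t / N)) ω *
      ((B ((j + 1 : ℕ) * (t / N)) ω - B (j * (t / N)) ω) ^ 2 - (t / N : ℝ≥0))) atTop
      (fun _ => 0) := by
  obtain ⟨κ, hκ, hn⟩ := hB.isNoise_sq
  set Q : ℕ → Ω → ℝ := fun N ω => ∑ j ∈ Finset.range N, κ * ((t / N : ℝ≥0) : ℝ) ^ 2 *
    G (j * (t / N)) ω ^ 2 with hQ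
  have hQ0 : TendstoInMeasure P Q atTop (fun _ => 0) := by
    refine tendstoInMeasure_of_tendsto_ae (fun N => ?_) (ae_of_all _ fun ω => ?_)
    · have hm : ∀ s, Measurable (G s) := fun s => (hG s).mono (F.le s) le_rfl
      have : Measurable (Q N) := Finset.measurable_fun_sum _ fun j _ =>
        ((hm _).pow_const 2).const_mul _
      exact this.aestronglyMeasurable
    · obtain ⟨C, hC⟩ := exists_abs_le_of_continuous (hGc ω) t
      have hlim : Tendsto (fun N : ℕ => κ * t * C ^ 2 * ((t : ℝ) / N)) atTop (𝓝 0) := by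
        have := (tendsto_const_div_atTop_nhds_zero_nat (t : ℝ)).const_mul (κ * t * C ^ 2)
        rwa [mul_zero] at this
      refine squeeze_zero' (Eventually.of_forall fun N =>
        Finset.sum_nonneg fun j _ => by positivity) ?_ hlim
      filter_upwards [eventually_gt_atTop 0] with N hN
      have hN' : (N : ℝ) ≠ 0 := by exact_mod_cast hN.ne'
      calc Q N ω ≤ ∑ j ∈ Finset.range N, κ * ((t / N : ℝ≥0) : ℝ) ^ 2 * C ^ 2 := by
            refine Finset.sum_le_sum fun j hj => ?_
            have := hC _ (nat_mul_div_le t (Finset.mem_range.1 hj).le)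
            rw [← sq_abs (G _ ω)]
            gcongr
        _ = κ * t * C ^ 2 * ((t : ℝ) / N) := by
            simp only [Finset.sum_const, Finset.card_range, nsmul_eq_mul]
            push_cast
            field_simp
  refine tendstoInMeasure_real_iff.2 fun ε hε => ?_
  refine tendsto_zero_of_forall_eventually_le_ofReal fun η hη => ?_
  set δ := η / 2 * ε ^ 2 with hδ
  have hδ0 : 0 < δ := by positivity
  filter_upwards [eventually_gt_atTop 0, eventually_le_ofReal_of_tendsto_zero
    (tendstoInMeasure_real_iff.1 hQ0 δ hδ0) (η := η / 2) (by positivity)] with N hN h2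
  set h : ℝ≥0 := t / N with hh
  have hh0 : 0 < h := by rw [hh]; positivity
  have hζm : ∀ j : ℕ, Measurable[F ((j + 1 : ℕ) * h)]
      (fun ω => (B ((j + 1 : ℕ) * h) ω - B (j * h) ω) ^ 2 - h) := by
    intro j
    have h1 : Measurable[F ((j + 1 : ℕ) * h)] (B (j * h)) :=
      (hB.adapted _).mono (F.mono (by gcongr; omega)) le_rfl
    have h2 : Measurable[F ((j + 1 : ℕ) * h)] (B ((j + 1 : ℕ) * h)) := hB.adapted _
    exact ((h2.sub h1).pow_const 2).sub measurable_const
  have hL := measure_exists_le_abs_sum_le (P := P) (𝒢 := fun j : ℕ => F (j * h))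
    (ζ := fun j ω => (B ((j + 1 : ℕ) * h) ω - B (j * h) ω) ^ 2 - h)
    (U := fun j => G (j * h)) (c := fun _ => κ * (h : ℝ) ^ 2)
    (fun i j hij => F.mono (by gcongr)) (fun j => F.le _)
    hζm (fun j => by positivity)
    (fun j => by
      have := hn (j * h) ((j + 1 : ℕ) * h) (by gcongr; omega)
      have e : (((((j + 1 : ℕ) : ℝ≥0) * h : ℝ≥0) : ℝ) - ((j * h : ℝ≥0) : ℝ)) = h := by
        push_cast; ring
      rwa [e] at this)
    (fun j => hG _) Set.univ N hε hδ0
  simp only [Set.univ_inter] at hL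
  have e3 : δ / ε ^ 2 = η / 2 := by rw [hδ]; field_simp
  rw [e3] at hL
  refine le_trans (measure_mono ?_) (hL.trans ?_)
  · intro ω hω
    exact ⟨N, le_rfl, by simpa using hω⟩
  calc _ ≤ ENNReal.ofReal (η / 2) + ENNReal.ofReal (η / 2) := by
        gcongr
        refine le_trans (measure_mono fun ω hω => ?_) h2
        simp only [Set.mem_ofPred_eq, sub_zero] at hω ⊢
        exact hω.le.trans (le_abs_self _)
    _ = ENNReal.ofReal η := by
        rw [← ENNReal.ofReal_add (by positivity) (by positivity)]
        congr 1; ring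

/-- Chebyshev's inequality together with the isometry bound. -/
theorem IsFilteredBrownian.measure_le_abs_sum_const_le [IsProbabilityMeasure P]
    (hW : IsFilteredBrownian F P W) (u : ℕ → ℝ) (h : ℝ≥0) (N : ℕ) {ε : ℝ} (hε : 0 < ε) :
    P {ω | ε ≤ |∑ j ∈ Finset.range N, u j * (W ((j + 1 : ℕ) * h) ω - W (j * h) ω)|} ≤
      ENNReal.ofReal ((∑ j ∈ Finset.range N, h * u j ^ 2) / ε ^ 2) := by
  have hζ : ∀ j : ℕ, IsNoise (F (j * h)) P (fun ω => W ((j + 1 : ℕ) * h) ω - W (j * h) ω) h := by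
    intro j
    have := hW.isNoise (s := j * h) (t := (j + 1 : ℕ) * h) (by gcongr; omega)
    have e : (((((j + 1 : ℕ) : ℝ≥0) * h : ℝ≥0) : ℝ) - ((j * h : ℝ≥0) : ℝ)) = h := by
      push_cast; ring
    rwa [e] at this
  have h1 := integral_sum_mul_noise_sq_le (P := P) (𝒢 := fun j : ℕ => F (j * h))
    (ζ := fun j ω => W ((j + 1 : ℕ) * h) ω - W (j * h) ω) (U := fun j _ => u j) (c := fun _ => h)
    (fun i j hij => F.mono (by gcongr))
    (fun j => ((hW.adapted _).sub ((hW.adapted _).mono (F.mono (by gcongr; omega)) le_rfl)))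
    hζ (fun j => measurable_const) (fun j => memLp_const _) N
  have h2 := memLp_sum_mul_noise (P := P) (𝒢 := fun j : ℕ => F (j * h))
    (U := fun j _ => u j) hζ (fun j => measurable_const) (fun j => memLp_const _) N
  have h3 := mul_meas_ge_le_integral_of_nonneg (μ := P) (ae_of_all _ fun ω => sq_nonneg _)
      h2.integrable_sq (ε ^ 2)
  simp only [integral_const, probReal_univ, one_smul] at h1
  rw [← ofReal_measureReal]
  apply ENNReal.ofReal_le_ofReal
  rw [le_div_iff₀ (by positivity), mul_comm]
  refine le_trans (mul_le_mul_of_nonneg_left (measureReal_mono fun ω hω => ?_) (sq_nonneg ε))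
    (h3.trans h1)
  have hω' : ε ≤ |∑ j ∈ Finset.range N, u j * (W ((j + 1 : ℕ) * h) ω - W (j * h) ω)| := hω
  simp only [Set.mem_ofPred_eq]
  rw [← sq_abs (Finset.sum _ _)]
  gcongr

/-- Integrals with respect to increments of a Brownian motion of an independent discrete integrand
of vanishing energy are negligible. -/
theorem tendstoInMeasure_sum_mul_of_indep [IsProbabilityMeasure P]
    (hB : ∀ s, Measurable (B s)) (hW : IsFilteredBrownian F P W)
    (hBW : IndepFun (fun ω t => B t ω) (fun ω t => W t ω) P) (t : ℝ≥0) {u : ℕ → ℕ → Ω → ℝ}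
    (hu : ∀ N k, AEStronglyMeasurable[MeasurableSpace.comap (fun ω t => B t ω) inferInstance]
      (u N k) P)
    (hlim : ∀ᵐ ω ∂P, Tendsto (fun N : ℕ => ∑ j ∈ Finset.range N, ((t / N : ℝ≥0) : ℝ) *
      u N j ω ^ 2) atTop (𝓝 0)) :
    TendstoInMeasure P (fun (N : ℕ) ω => ∑ j ∈ Finset.range N, u N j ω *
      (W ((j + 1 : ℕ) * (t / N)) ω - W (j * (t / N)) ω)) atTop (fun _ => 0) := by
  have hle : MeasurableSpace.comap (fun ω t => B t ω) inferInstance ≤ mΩ :=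
    (measurable_pi_lambda _ hB).comap_le
  have hu' : ∀ N k, AEMeasurable (u N k) P := fun N k => ((hu N k).mono hle).aemeasurable
  refine tendstoInMeasure_real_iff.2 fun ε hε => ?_
  simp only [sub_zero]
  set φ : ℕ → (ℝ≥0 → ℝ) → ℕ → ℝ := fun N w j => w ((j + 1 : ℕ) * (t / N)) - w (j * (t / N))
    with hφ
  have hφm : ∀ N, Measurable (φ N) := fun N => measurable_pi_lambda _ fun j =>
    (measurable_pi_apply _).sub (measurable_pi_apply _)
  set A : ℕ → Set ((ℕ → ℝ) × (ℕ → ℝ)) := fun N =>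
    {p | ε ≤ |∑ j ∈ Finset.range N, p.1 j * p.2 j|} with hA
  have hAm : ∀ N, MeasurableSet (A N) := fun N => measurableSet_le measurable_const (by fun_prop)
  have hWm : Measurable (fun ω t => W t ω) := measurable_pi_lambda _ hW.measurable
  -- By independence the coefficients can be frozen and Chebyshev applied in W alone; u may look
  -- into the future of B. The minimum with 1 supplies domination, so almost sure decay of the
  -- energy suffices.
  have key : ∀ N, P {ω | ε ≤ |∑ j ∈ Finset.range N, u N j ω *
      (W ((j + 1 : ℕ) * (t / N)) ω - W (j * (t / N)) ω)|} ≤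
      ∫⁻ ω, min 1 (ENNReal.ofReal ((∑ j ∈ Finset.range N, ((t / N : ℝ≥0) : ℝ) *
        u N j ω ^ 2) / ε ^ 2)) ∂P := by
    intro N
    have hX : AEMeasurable (fun ω k => u N k ω) P := aemeasurable_pi_lambda _ (hu' N)
    have hY : AEMeasurable (fun ω => φ N (fun t => W t ω)) P := ((hφm N).comp hWm).aemeasurable
    have hi := hBW.of_aestronglyMeasurable_comap (hu N) (hφm N)
    have e := hi.lintegral_prod_eq hX hY (f := (A N).indicator 1) (measurable_one.indicator (hAm N))
    have e1 : ∫⁻ ω, (A N).indicator 1 ((fun k => u N k ω), φ N (fun t => W t ω)) ∂P =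
        P {ω | ε ≤ |∑ j ∈ Finset.range N, u N j ω *
          (W ((j + 1 : ℕ) * (t / N)) ω - W (j * (t / N)) ω)|} := by
      have hn : NullMeasurableSet {ω | ε ≤ |∑ j ∈ Finset.range N, u N j ω *
          (W ((j + 1 : ℕ) * (t / N)) ω - W (j * (t / N)) ω)|} P :=
        (hX.prodMk hY).nullMeasurable (hAm N)
      rw [← lintegral_indicator_one₀ hn]
      rfl
    rw [← e1, e]
    refine lintegral_mono fun ω => ?_
    have hm : MeasurableSet {ω' | ε ≤ |∑ j ∈ Finset.range N, u N j ω *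
          (W ((j + 1 : ℕ) * (t / N)) ω' - W (j * (t / N)) ω')|} :=
      measurable_prodMk_left.comp ((hφm N).comp hWm) (hAm N)
    have e2 : ∫⁻ ω', (A N).indicator 1 ((fun k => u N k ω), φ N (fun t => W t ω')) ∂P =
        P {ω' | ε ≤ |∑ j ∈ Finset.range N, u N j ω *
          (W ((j + 1 : ℕ) * (t / N)) ω' - W (j * (t / N)) ω')|} := by
      rw [← lintegral_indicator_one hm]
      rfl
    rw [e2]
    exact le_min prob_le_one (hW.measure_le_abs_sum_const_le _ _ N hε)
  refine tendsto_of_tendsto_of_tendsto_of_le_of_le tendsto_const_nhds ?_ (fun _ => zero_le) key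
  have h0 : ∫⁻ _ : Ω, (0 : ℝ≥0∞) ∂P = 0 := lintegral_zero
  rw [← h0]
  refine tendsto_lintegral_of_dominated_convergence' (fun _ => 1) (fun N => ?_)
    (fun N => ae_of_all _ fun ω => min_le_left _ _) (by simp) ?_
  · refine aemeasurable_const.min (AEMeasurable.ennreal_ofReal ?_)
    exact (Finset.aemeasurable_fun_sum _ fun j _ => ((hu' N j).pow_const 2).const_mul _).div_const _
  · filter_upwards [hlim] with ω hω
    have h1 := ENNReal.tendsto_ofReal (hω.div_const (ε ^ 2))
    rw [zero_div, ENNReal.ofReal_zero] at h1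
    have := (tendsto_const_nhds (x := (1 : ℝ≥0∞))).min h1
    simpa using this

end QuadraticVariation

/-! ### Deterministic limits along one path. -/

section Pathwise

theorem abs_log_one_add_sub_le {x : ℝ} (hx : |x| ≤ 1 / 2) :
    |Real.log (1 + x) - (x - x ^ 2 / 2)| ≤ 2 * |x| ^ 3 := by
  have h := Real.abs_log_sub_add_sum_range_le (x := -x) (by rw [abs_neg]; linarith) 2
  rw [abs_neg, sub_neg_eq_add] at h
  simp only [Finset.sum_range_succ, Finset.sum_range_zero] at h
  have e : Real.log (1 + x) - (x - x ^ 2 / 2) = 0 + (-x) ^ (0 + 1) / ((0 : ℕ) + 1) +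
      (-x) ^ (1 + 1) / ((1 : ℕ) + 1) + Real.log (1 + x) := by push_cast; ring
  rw [e]
  refine h.trans ?_
  rw [div_le_iff₀ (by linarith)]
  calc |x| ^ (2 + 1) = 2 * |x| ^ 3 * (1 / 2) := by ring
    _ ≤ 2 * |x| ^ 3 * (1 - |x|) := by gcongr; linarith

/-- Sum log(1 + x) = x - x²/2 + O(|x|³): the cubic error is at most max|x| times the convergent sum
of squares. -/
theorem tendsto_prod_one_add_exp {x : ℕ → ℕ → ℝ} {n : ℕ → ℕ} {a q : ℝ}
    (hmax : ∀ η : ℝ, 0 < η → ∀ᶠ k in atTop, ∀ j < n k, |x k j| < η)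
    (ha : Tendsto (fun k => ∑ j ∈ Finset.range (n k), x k j) atTop (𝓝 a))
    (hq : Tendsto (fun k => ∑ j ∈ Finset.range (n k), x k j ^ 2) atTop (𝓝 q)) :
    Tendsto (fun k => ∏ j ∈ Finset.range (n k), (1 + x k j)) atTop (𝓝 (Real.exp (a - q / 2))) := by
  have hlog : Tendsto (fun k => ∑ j ∈ Finset.range (n k), Real.log (1 + x k j)) atTop
      (𝓝 (a - q / 2)) := by
    have hd : Tendsto (fun k => ∑ j ∈ Finset.range (n k), Real.log (1 + x k j) -
        (∑ j ∈ Finset.range (n k), x k j - (∑ j ∈ Finset.range (n k), x k j ^ 2) / 2)) atTop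
        (𝓝 0) := by
      rw [Metric.tendsto_atTop']
      intro ε hε
      have hq1 : 0 < |q| + 1 := by positivity
      -- The threshold makes the cubic error 2|x|³ at most ε/(|q|+1) · x², while the sum of squares
      -- stays below |q| + 1.
      have hev := (hmax (min (1 / 2) (ε / (2 * (|q| + 1)))) (by positivity)).and
        (hq.eventually (gt_mem_nhds (show q < |q| + 1 by linarith [le_abs_self q])))
      obtain ⟨k₀, hk₀⟩ := hev.exists_forall_of_atTop
      refine ⟨k₀, fun k hk => ?_⟩
      obtain ⟨h1, h2⟩ := hk₀ k hk.le
      rw [Real.dist_eq, sub_zero, Finset.sum_div, ← Finset.sum_sub_distrib,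
        ← Finset.sum_sub_distrib]
      have hb : ∀ j ∈ Finset.range (n k), |Real.log (1 + x k j) - (x k j - x k j ^ 2 / 2)| ≤
          ε / (|q| + 1) * x k j ^ 2 := by
        intro j hj
        have h3 := h1 j (Finset.mem_range.1 hj)
        refine (abs_log_one_add_sub_le (h3.le.trans (min_le_left _ _))).trans ?_
        rw [← sq_abs (x k j), pow_succ, ← mul_assoc, mul_comm, ← mul_assoc]
        gcongr
        have h4 := (h3.le.trans (min_le_right _ _))
        calc |x k j| * 2 ≤ ε / (2 * (|q| + 1)) * 2 := by gcongr
          _ = _ := by field_simp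
      calc _ ≤ ∑ j ∈ Finset.range (n k), ε / (|q| + 1) * x k j ^ 2 :=
            (Finset.abs_sum_le_sum_abs _ _).trans (Finset.sum_le_sum hb)
        _ = ε / (|q| + 1) * ∑ j ∈ Finset.range (n k), x k j ^ 2 := by rw [Finset.mul_sum]
        _ < ε / (|q| + 1) * (|q| + 1) := by gcongr
        _ = ε := by field_simp
    have := hd.add (ha.sub (hq.div_const 2))
    rw [zero_add] at this
    refine this.congr fun k => ?_
    ring
  refine ((Real.continuous_exp.tendsto _).comp hlog).congr' ?_
  filter_upwards [hmax (1 / 2) (by norm_num)] with k hk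
  simp only [Function.comp_apply, Real.exp_sum]
  refine Finset.prod_congr rfl fun j hj => Real.exp_log ?_
  have := (abs_lt.1 (hk j (Finset.mem_range.1 hj))).1
  linarith

theorem tendsto_riemannSum_integral {f : ℝ≥0 → ℝ} (hf : Continuous f) (t : ℝ≥0) :
    Tendsto (fun N : ℕ => ∑ j ∈ Finset.range N, ((t / N : ℝ≥0) : ℝ) * f (j * (t / N))) atTop
      (𝓝 (∫ s in (0 : ℝ)..t, f s.toNNReal)) := by
  rw [Metric.tendsto_atTop']
  intro ε hε
  have hη : 0 < ε / (t + 1) := by positivity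
  obtain ⟨δ, hδ, hmod⟩ := exists_modulus_of_continuous hf t hη
  obtain ⟨n₀, hn₀⟩ := (eventually_div_lt t hδ).exists_forall_of_atTop
  refine ⟨n₀, fun N hN => ?_⟩
  have hN0 : (N : ℝ) ≠ 0 := by exact_mod_cast (by omega : N ≠ 0)
  set h : ℝ≥0 := t / N with hh
  have hNh : (N : ℝ) * h = t := by rw [hh]; push_cast; field_simp
  have hg : Continuous (fun s : ℝ => f s.toNNReal) := hf.comp continuous_real_toNNReal
  have hint : ∀ a b : ℝ, IntervalIntegrable (fun s : ℝ => f s.toNNReal) volume a b :=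
    fun a b => hg.intervalIntegrable a b
  have hsum : ∫ s in (0 : ℝ)..t, f s.toNNReal = ∑ j ∈ Finset.range N,
      ∫ s in ((j : ℕ) * (h : ℝ))..((j + 1 : ℕ) * (h : ℝ)), f s.toNNReal := by
    rw [intervalIntegral.sum_integral_adjacent_intervals (a := fun j : ℕ => (j : ℝ) * (h : ℝ))
      (fun k _ => hint _ _), hNh]
    simp
  rw [hsum, Real.dist_eq, ← Finset.sum_sub_distrib]
  have hb : ∀ j ∈ Finset.range N, |(h : ℝ) * f (j * h) -
      ∫ s in ((j : ℕ) * (h : ℝ))..((j + 1 : ℕ) * (h : ℝ)), f s.toNNReal| ≤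
      ε / (t + 1) * h := by
    intro j hj
    have hjN : j + 1 ≤ N := Finset.mem_range.1 hj
    have hlen : ((j + 1 : ℕ) : ℝ) * (h : ℝ) - (j : ℕ) * (h : ℝ) = h := by push_cast; ring
    have e : (h : ℝ) * f (j * h) = ∫ _ in ((j : ℕ) * (h : ℝ))..((j + 1 : ℕ) * (h : ℝ)),
        f (j * h) := by
      rw [intervalIntegral.integral_const, hlen, smul_eq_mul]
    rw [e, ← intervalIntegral.integral_sub (by simp) (hint _ _), ← Real.norm_eq_abs]
    refine (intervalIntegral.norm_integral_le_of_norm_le_const (C := ε / (t + 1)) ?_).trans_eq ?_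
    · intro s hs
      have hle : (j : ℝ) * (h : ℝ) ≤ ((j + 1 : ℕ) : ℝ) * h := by
        gcongr; omega
      rw [Set.uIoc_of_le hle] at hs
      have hs0 : 0 ≤ s := (by positivity : (0 : ℝ) ≤ (j : ℝ) * h).trans hs.1.le
      lift s to ℝ≥0 using hs0
      rw [Real.toNNReal_coe, Real.norm_eq_abs]
      have h1 : ((j + 1 : ℕ) : ℝ≥0) * h ≤ t := nat_mul_div_le t hjN
      have hst : s ≤ t := le_trans (by exact_mod_cast hs.2) h1
      refine (hmod _ (nat_mul_div_le t (by omega)) _ hst ?_).le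
      refine lt_of_le_of_lt ?_ (hn₀ N hN.le)
      change _ ≤ (h : ℝ)
      rw [NNReal.dist_eq, abs_sub_comm, NNReal.coe_mul, NNReal.coe_natCast, abs_of_nonneg]
      · linarith [hs.2]
      · linarith [hs.1]
    · rw [hlen, abs_of_nonneg h.coe_nonneg]
  calc _ ≤ ∑ j ∈ Finset.range N, ε / (t + 1) * h :=
        (Finset.abs_sum_le_sum_abs _ _).trans (Finset.sum_le_sum hb)
    _ = ε / (t + 1) * t := by
        rw [Finset.sum_const, Finset.card_range, nsmul_eq_mul, ← hNh]; ring
    _ < ε := by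
        rw [div_mul_eq_mul_div, div_lt_iff₀ (by positivity)]
        nlinarith [t.coe_nonneg]

theorem eventually_forall_abs_mul_increment_lt {g m : ℝ≥0 → ℝ} (hg : Continuous g)
    (hm : Continuous m) (t : ℝ≥0) {η : ℝ} (hη : 0 < η) :
    ∀ᶠ N : ℕ in atTop, ∀ j < N,
      |g (j * (t / N)) * (m ((j + 1 : ℕ) * (t / N)) - m (j * (t / N)))| < η := by
  obtain ⟨C, hC⟩ := exists_abs_le_of_continuous hg t
  have hC0 : 0 ≤ C := (abs_nonneg _).trans (hC 0 zero_le)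
  obtain ⟨δ, hδ, hmod⟩ := exists_modulus_of_continuous hm t (η := η / (C + 1)) (by positivity)
  filter_upwards [eventually_div_lt t hδ] with N hN j hj
  have h1 := hC _ (nat_mul_div_le t hj.le)
  have h2 := hmod ((j + 1 : ℕ) * (t / N)) (nat_mul_div_le t hj) _ (nat_mul_div_le t hj.le) (by
    refine lt_of_le_of_lt (le_of_eq ?_) hN
    rw [NNReal.dist_eq]
    push_cast
    rw [← sub_mul]
    simp only [add_sub_cancel_left, one_mul]
    exact abs_of_nonneg (by positivity))
  rw [abs_mul]
  calc _ ≤ C * (η / (C + 1)) := by gcongr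
    _ < η := by rw [mul_div_assoc', div_lt_iff₀ (by positivity)]; nlinarith

end Pathwise

/-! ### The explicit exponential formula for S. -/

section Solution

variable {Ω : Type*} {mΩ : MeasurableSpace Ω} {P : Measure Ω} {F : Filtration ℝ≥0 mΩ}
  {B W : ℝ≥0 → Ω → ℝ}

theorem MeasureTheory.TendstoInMeasure.abs_sub_real {κ : Type*} {l : Filter κ} {f : κ → Ω → ℝ}
    {g : Ω → ℝ} (h : TendstoInMeasure P f l g) :
    TendstoInMeasure P (fun k ω => |f k ω - g ω|) l (fun _ => 0) := by
  rw [tendstoInMeasure_real_iff] at h ⊢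
  simpa using h

theorem riemannSum_add_mul (G B W : ℝ≥0 → Ω → ℝ) (ρ ρ' : ℝ) (h : ℝ≥0) (n : ℕ) (ω : Ω) :
    riemannSum G (fun s ω => ρ * B s ω + ρ' * W s ω) h n ω =
      ρ * riemannSum G B h n ω + ρ' * riemannSum G W h n ω := by
  simp only [riemannSum, Finset.mul_sum, ← Finset.sum_add_distrib]
  refine Finset.sum_congr rfl fun j _ => ?_
  ring

/-- Expand the square. The two pure terms are compensated squares. The cross term is an integral
against W with the B-measurable coefficient α²ΔB, which is not adapted at the left endpoint; hence
the use of independence. -/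
theorem tendstoInMeasure_sum_sq_mul_sq_sub [IsProbabilityMeasure P]
    (hB : IsFilteredBrownian F P B) (hW : IsFilteredBrownian F P W)
    (hBW : IndepFun (fun ω t => B t ω) (fun ω t => W t ω) P) {α : ℝ≥0 → Ω → ℝ}
    (hα : Adapted F α) (hαc : ∀ ω, Continuous fun s => α s ω)
    (hαB : ∀ s, AEStronglyMeasurable[MeasurableSpace.comap (fun ω t => B t ω) inferInstance]
      (α s) P) {ρ ρ' : ℝ} (hρ : ρ ^ 2 + ρ' ^ 2 = 1) {t : ℝ≥0} (ht : 0 < t) :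
    TendstoInMeasure P (fun (N : ℕ) ω => ∑ j ∈ Finset.range N, α (j * (t / N)) ω ^ 2 *
      ((ρ * (B ((j + 1 : ℕ) * (t / N)) ω - B (j * (t / N)) ω) +
        ρ' * (W ((j + 1 : ℕ) * (t / N)) ω - W (j * (t / N)) ω)) ^ 2 - (t / N : ℝ≥0))) atTop
      (fun _ => 0) := by
  have hG : Adapted F (fun s ω => α s ω ^ 2) := fun s => (hα s).pow_const 2
  have hGc : ∀ ω, Continuous fun s => α s ω ^ 2 := fun ω => (hαc ω).pow 2
  have h1 := (hB.tendstoInMeasure_sum_mul_sq_sub hG hGc ht).const_mul_real (ρ ^ 2)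
  have h2 := (hW.tendstoInMeasure_sum_mul_sq_sub hG hGc ht).const_mul_real (ρ' ^ 2)
  have hBm : ∀ s, StronglyMeasurable[MeasurableSpace.comap (fun ω t => B t ω) inferInstance]
      (B s) := fun s => Measurable.stronglyMeasurable
    ((measurable_pi_apply s).comp (comap_measurable (fun ω t => B t ω)))
  have h3 := (tendstoInMeasure_sum_mul_of_indep hB.measurable hW hBW t
    (u := fun N j ω => α (j * (t / N)) ω ^ 2 *
      (B ((j + 1 : ℕ) * (t / N)) ω - B (j * (t / N)) ω))
    (fun N j => ((hαB _).pow 2).mul ((hBm _).sub (hBm _)).aestronglyMeasurable) (by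
      filter_upwards [hB.brownian.cont] with ω hω
      rw [Metric.tendsto_atTop']
      intro ε hε
      have hη : 0 < √(ε / (t + 1)) := Real.sqrt_pos.2 (by positivity)
      obtain ⟨n₀, hn₀⟩ :=
        (eventually_forall_abs_mul_increment_lt (hGc ω) hω t hη).exists_forall_of_atTop
      refine ⟨n₀, fun N hN => ?_⟩
      rw [Real.dist_eq, sub_zero, abs_of_nonneg (Finset.sum_nonneg fun j _ => by positivity)]
      have hN0 : (N : ℝ) ≠ 0 := by exact_mod_cast (by omega : N ≠ 0)
      calc _ ≤ ∑ j ∈ Finset.range N, ((t / N : ℝ≥0) : ℝ) * (ε / (t + 1)) := by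
            refine Finset.sum_le_sum fun j hj => ?_
            have := hn₀ N hN.le j (Finset.mem_range.1 hj)
            rw [← sq_abs, ← Real.sq_sqrt (show 0 ≤ ε / (t + 1) by positivity)]
            gcongr
        _ = t * (ε / (t + 1)) := by
            simp only [Finset.sum_const, Finset.card_range, nsmul_eq_mul]
            push_cast
            field_simp
        _ < ε := by
            rw [mul_div_assoc', div_lt_iff₀ (by positivity)]
            nlinarith [t.coe_nonneg])).const_mul_real (2 * ρ * ρ')
  have h := (h1.add_real h2).add_real h3
  simp only [mul_zero, add_zero] at h
  refine h.congr_left fun N => ae_of_all _ fun ω => ?_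
  simp only [Finset.mul_sum, ← Finset.sum_add_distrib]
  refine Finset.sum_congr rfl fun j _ => ?_
  linear_combination (α (j * (t / N)) ω ^ 2 * ((t / N : ℝ≥0) : ℝ)) * (-hρ)

/-- The stochastic exponential solves, uniquely, the linear equation `dS = α S (ρ dB + ρ' dW)`. -/
theorem ae_eq_mul_exp_of_sde [IsProbabilityMeasure P]
    (hB : IsFilteredBrownian F P B) (hW : IsFilteredBrownian F P W)
    (hBW : IndepFun (fun ω t => B t ω) (fun ω t => W t ω) P) {α S : ℝ≥0 → Ω → ℝ}
    (hα : Adapted F α) (hαc : ∀ ω, Continuous fun s => α s ω)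
    (hαB : ∀ s, AEStronglyMeasurable[MeasurableSpace.comap (fun ω t => B t ω) inferInstance]
      (α s) P) (hS : Adapted F S) (hSc : ∀ ω, Continuous fun s => S s ω)
    {s₀ ρ ρ' : ℝ} (hρ : ρ ^ 2 + ρ' ^ 2 = 1)
    (hsde : ∀ T, ∃ I J : Ω → ℝ, IsItoIntegral F P B (fun r ω => α r ω * S r ω) T I ∧
      IsItoIntegral F P W (fun r ω => α r ω * S r ω) T J ∧
      ∀ᵐ ω ∂P, S T ω = s₀ + (ρ * I ω + ρ' * J ω))
    {t : ℝ≥0} (ht : 0 < t) {Z Y : Ω → ℝ} (hZ : IsItoIntegral F P B α t Z)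
    (hY : IsItoIntegral F P W α t Y) :
    ∀ᵐ ω ∂P, S t ω = s₀ * Real.exp (ρ * Z ω + ρ' * Y ω -
      (∫ s in (0 : ℝ)..t, α s.toNNReal ω ^ 2) / 2) := by
  set M : ℝ≥0 → Ω → ℝ := fun s ω => ρ * B s ω + ρ' * W s ω with hMdef
  have hMa : Adapted F M := fun s => ((hB.adapted s).const_mul ρ).add ((hW.adapted s).const_mul ρ')
  have hM : ∀ s t : ℝ≥0, s ≤ t → IsNoise (F s) P (fun ω => M t ω - M s ω) (2 * (t - s)) := by
    intro s t hst
    have h := (hB.isNoise hst).linear_comb (hW.isNoise hst) ρ ρ'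
    have e1 : (fun ω => M t ω - M s ω) =
        fun ω => ρ * (B t ω - B s ω) + ρ' * (W t ω - W s ω) := by
      ext ω; simp only [hMdef]; ring
    have e2 : 2 * ((t : ℝ) - s) = 2 * (ρ ^ 2 * (t - s) + ρ' ^ 2 * (t - s)) := by
      rw [← add_mul, hρ, one_mul]
    rw [e1, e2]
    exact h
  have hG : Adapted F (fun s ω => α s ω * S s ω) := fun s => (hα s).mul (hS s)
  have hGc : ∀ ω, Continuous fun s => α s ω * S s ω := fun ω => (hαc ω).mul (hSc ω)
  have hR : ∀ T : ℝ≥0, TendstoInMeasure P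
      (fun n : ℕ => riemannSum (fun s ω => α s ω * S s ω) M (T / n) n) atTop
      (fun ω => S T ω - s₀) := by
    intro T
    obtain ⟨I, J, hI, hJ, hIJ⟩ := hsde T
    have h := ((hI.tendsto_riemannSum hB hG hGc).const_mul_real ρ).add_real
      ((hJ.tendsto_riemannSum hW hG hGc).const_mul_real ρ')
    refine h.congr (fun n => ae_of_all _ fun ω => ?_) ?_
    · exact (riemannSum_add_mul _ B W ρ ρ' _ _ _).symm
    · filter_upwards [hIJ] with ω hω
      rw [hω]; ring
  have h1 := (tendstoInMeasure_prod_one_add (by norm_num) hMa hM hα hαc hS hSc hR ht).abs_sub_real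
  have h2 := (((hZ.tendsto_riemannSum hB hα hαc).const_mul_real ρ).add_real
      ((hY.tendsto_riemannSum hW hα hαc).const_mul_real ρ')).abs_sub_real
  have h3 := (tendstoInMeasure_sum_sq_mul_sq_sub hB hW hBW hα hαc hαB hρ ht).abs_sub_real
  -- Adding the three nonnegative errors yields one subsequence along which all three convergences
  -- hold almost surely.
  obtain ⟨n, hn, hlim⟩ := ((h1.add_real h2).add_real h3).exists_seq_tendsto_ae
  simp only [add_zero] at hlim
  filter_upwards [hlim, hB.brownian.cont, hW.brownian.cont] with ω hω hBω hWω
  have hMω : Continuous fun s => M s ω := (hBω.const_mul ρ).add (hWω.const_mul ρ')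
  set x : ℕ → ℕ → ℝ := fun k j => α (j * (t / n k)) ω *
    (M ((j + 1 : ℕ) * (t / n k)) ω - M (j * (t / n k)) ω) with hx
  have l1 : Tendsto (fun k => s₀ * ∏ j ∈ Finset.range (n k), (1 + x k j)) atTop (𝓝 (S t ω)) := by
    rw [tendsto_iff_dist_tendsto_zero]
    refine squeeze_zero (fun _ => dist_nonneg) (fun k => ?_) hω
    rw [Real.dist_eq, add_assoc]
    exact le_add_of_nonneg_right (by positivity)
  have l2 : Tendsto (fun k => ∑ j ∈ Finset.range (n k), x k j) atTop
      (𝓝 (ρ * Z ω + ρ' * Y ω)) := by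
    rw [tendsto_iff_dist_tendsto_zero]
    refine squeeze_zero (fun _ => dist_nonneg) (fun k => ?_) hω
    have e : ∑ j ∈ Finset.range (n k), x k j = ρ * riemannSum α B (t / n k) (n k) ω +
        ρ' * riemannSum α W (t / n k) (n k) ω := by
      rw [← riemannSum_add_mul, riemannSum]
      simp only [hx, hMdef]
      push_cast
      rfl
    rw [Real.dist_eq, e, add_assoc, add_left_comm]
    exact le_add_of_nonneg_right (by positivity)
  have l3 : Tendsto (fun k => ∑ j ∈ Finset.range (n k), x k j ^ 2) atTop
      (𝓝 (∫ s in (0 : ℝ)..t, α s.toNNReal ω ^ 2)) := by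
    have hr := (tendsto_riemannSum_integral (f := fun s => α s ω ^ 2)
      ((hαc ω).pow 2) t).comp hn.tendsto_atTop
    have hd : Tendsto (fun k => ∑ j ∈ Finset.range (n k), x k j ^ 2 -
        ∑ j ∈ Finset.range (n k), ((t / n k : ℝ≥0) : ℝ) * α (j * (t / n k)) ω ^ 2) atTop
        (𝓝 0) := by
      rw [tendsto_iff_dist_tendsto_zero]
      refine squeeze_zero (fun _ => dist_nonneg) (fun k => ?_) hω
      rw [dist_zero_right, Real.norm_eq_abs, ← Finset.sum_sub_distrib]
      refine le_trans (le_of_eq ?_) (le_add_of_nonneg_left (by positivity))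
      rw [sub_zero]
      congr 1
      refine Finset.sum_congr rfl fun j _ => ?_
      simp only [hx, hMdef]
      ring
    have := hd.add hr
    rw [zero_add] at this
    refine this.congr fun k => ?_
    simp only [Function.comp_apply]
    ring
  have hmax : ∀ η : ℝ, 0 < η → ∀ᶠ k in atTop, ∀ j < n k, |x k j| < η := fun η hη =>
    hn.tendsto_atTop.eventually (eventually_forall_abs_mul_increment_lt (hαc ω) hMω t hη)
  exact tendsto_nhds_unique l1 ((tendsto_prod_one_add_exp hmax l2 l3).const_mul s₀)

end Solution

/-! ### The integral against W is Gaussian given B. -/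

section ConditionalGaussian

variable {Ω : Type*} {mΩ : MeasurableSpace Ω} {P : Measure Ω} {F : Filtration ℝ≥0 mΩ}
  {B W : ℝ≥0 → Ω → ℝ}

theorem aestronglyMeasurable_of_tendsto_ae_sub {m : MeasurableSpace Ω} {f : ℕ → Ω → ℝ}
    {g : Ω → ℝ} (hf : ∀ n, AEStronglyMeasurable[m] (f n) P)
    (h : ∀ᵐ ω ∂P, Tendsto (fun n => f n ω) atTop (𝓝 (g ω))) : AEStronglyMeasurable[m] g P := by
  obtain ⟨g', hg', hgg'⟩ := exists_measurable_ae_eq_of_tendsto (m := m) (P := P) (f := f) (g := g)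
    (fun n => by
      obtain ⟨f', h1, h2⟩ := hf n
      exact ⟨f', h1.measurable, h2⟩) h
  exact ⟨g', hg'.stronglyMeasurable, hgg'⟩

theorem aestronglyMeasurable_sum_sub {m : MeasurableSpace Ω} (s : Finset ℕ) {f : ℕ → Ω → ℝ}
    (h : ∀ j, AEStronglyMeasurable[m] (f j) P) :
    AEStronglyMeasurable[m] (fun ω => ∑ j ∈ s, f j ω) P := by
  classical
  induction s using Finset.induction_on with
  | empty => simpa using aestronglyMeasurable_const
  | insert a s ha ih =>
    simp only [Finset.sum_insert ha]
    exact (h a).add ih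

theorem measurable_comap_process (B : ℝ≥0 → Ω → ℝ) (s : ℝ≥0) :
    StronglyMeasurable[MeasurableSpace.comap (fun ω t => B t ω) inferInstance] (B s) :=
  Measurable.stronglyMeasurable
    ((measurable_pi_apply s).comp (comap_measurable (fun ω t => B t ω)))

theorem aestronglyMeasurable_comap_integral_sq {m : MeasurableSpace Ω} {α : ℝ≥0 → Ω → ℝ}
    (hαc : ∀ ω, Continuous fun s => α s ω) (hαB : ∀ s, AEStronglyMeasurable[m] (α s) P)
    (t : ℝ≥0) :
    AEStronglyMeasurable[m] (fun ω => ∫ s in (0 : ℝ)..t, α s.toNNReal ω ^ 2) P := by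
  refine aestronglyMeasurable_of_tendsto_ae_sub (f := fun N ω => ∑ j ∈ Finset.range N,
    ((t / N : ℝ≥0) : ℝ) * α (j * (t / N)) ω ^ 2) (fun N => ?_) (ae_of_all _ fun ω =>
      tendsto_riemannSum_integral (f := fun s => α s ω ^ 2) ((hαc ω).pow 2) t)
  exact aestronglyMeasurable_sum_sub _ fun j => ((hαB _).pow 2).const_mul _

theorem IsItoIntegral.aestronglyMeasurable_comap [IsProbabilityMeasure P]
    (hB : IsFilteredBrownian F P B) {α : ℝ≥0 → Ω → ℝ}
    (hα : Adapted F α) (hαc : ∀ ω, Continuous fun s => α s ω)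
    (hαB : ∀ s, AEStronglyMeasurable[MeasurableSpace.comap (fun ω t => B t ω) inferInstance]
      (α s) P) {t : ℝ≥0} {Z : Ω → ℝ} (hZ : IsItoIntegral F P B α t Z) :
    AEStronglyMeasurable[MeasurableSpace.comap (fun ω t => B t ω) inferInstance] Z P := by
  obtain ⟨n, -, hlim⟩ := (hZ.tendsto_riemannSum hB hα hαc).exists_seq_tendsto_ae
  refine aestronglyMeasurable_of_tendsto_ae_sub (fun k => ?_) hlim
  exact aestronglyMeasurable_sum_sub _ fun j => (hαB _).mul
    ((measurable_comap_process B _).sub (measurable_comap_process B _)).aestronglyMeasurable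

/-- Freeze everything measurable with respect to B; the sum over increments of W is then Gaussian
with explicit variance. -/
theorem integral_cexp_add_sum [IsProbabilityMeasure P] (hB : ∀ s, Measurable (B s))
    (hW : IsFilteredBrownian F P W) (hBW : IndepFun (fun ω t => B t ω) (fun ω t => W t ω) P)
    {R : Ω → ℝ} {a : ℕ → Ω → ℝ}
    (hR : AEStronglyMeasurable[MeasurableSpace.comap (fun ω t => B t ω) inferInstance] R P)
    (ha : ∀ j, AEStronglyMeasurable[MeasurableSpace.comap (fun ω t => B t ω) inferInstance]
      (a j) P) (h : ℝ≥0) (N : ℕ) :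
    ∫ ω, Complex.exp ((R ω + ∑ j ∈ Finset.range N, a j ω *
      (W ((j + 1 : ℕ) * h) ω - W (j * h) ω) : ℝ) * Complex.I) ∂P =
    ∫ ω, Complex.exp ((R ω : ℝ) * Complex.I) *
      Complex.exp ((-((∑ j ∈ Finset.range N, (h : ℝ) * a j ω ^ 2) / 2) : ℝ)) ∂P := by
  have hle : MeasurableSpace.comap (fun ω t => B t ω) inferInstance ≤ mΩ :=
    (measurable_pi_lambda _ hB).comap_le
  -- R and the coefficients are packed into one sequence so that a single independence statement
  -- covers them jointly.
  set u : ℕ → Ω → ℝ := fun k => Nat.casesOn k R a with hu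
  have huB : ∀ k, AEStronglyMeasurable[MeasurableSpace.comap (fun ω t => B t ω) inferInstance]
      (u k) P := by
    intro k
    cases k with
    | zero => exact hR
    | succ j => exact ha j
  set φ : (ℝ≥0 → ℝ) → ℕ → ℝ := fun w j => w ((j + 1 : ℕ) * h) - w (j * h) with hφ
  have hφm : Measurable φ := measurable_pi_lambda _ fun j =>
    (measurable_pi_apply _).sub (measurable_pi_apply _)
  have hWm : Measurable (fun ω t => W t ω) := measurable_pi_lambda _ hW.measurable
  have hi := hBW.of_aestronglyMeasurable_comap huB hφm
  have e := hi.integral_prod_eq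
    (f := fun p => Complex.exp ((p.1 0 + ∑ j ∈ Finset.range N, p.1 (j + 1) * p.2 j : ℝ) *
      Complex.I))
    (aemeasurable_pi_lambda _ fun k => ((huB k).mono hle).aemeasurable)
    (hφm.comp hWm).aemeasurable (by fun_prop) (C := 1)
    (fun p => (Complex.norm_exp_ofReal_mul_I _).le)
  refine e.trans (integral_congr_ae (ae_of_all _ fun ω => ?_))
  have h1 := hW.integral_cexp_sum (τ := fun j : ℕ => (j : ℝ≥0) * h)
    (fun i j hij => by dsimp only; gcongr) (fun j => a j ω) N
  have h2 : ∀ j : ℕ, ((((j + 1 : ℕ) : ℝ≥0) * h : ℝ≥0) : ℝ) - ((j * h : ℝ≥0) : ℝ) = h := by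
    intro j; push_cast; ring
  simp only [h2] at h1
  dsimp only
  rw [← h1, ← integral_const_mul]
  refine integral_congr_ae (ae_of_all _ fun ω' => ?_)
  simp only [hu, hφ]
  rw [← Complex.exp_add, ← add_mul, ← Complex.ofReal_add]
  rfl

/-- Conditionally on `B`, the integral of a `B`-measurable integrand against an independent Brownian
motion is centred Gaussian. -/
theorem IsItoIntegral.integral_cexp_add_mul [IsProbabilityMeasure P] (hB : ∀ s, Measurable (B s))
    (hW : IsFilteredBrownian F P W) (hBW : IndepFun (fun ω t => B t ω) (fun ω t => W t ω) P)
    {α : ℝ≥0 → Ω → ℝ} (hα : Adapted F α) (hαc : ∀ ω, Continuous fun s => α s ω)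
    (hαB : ∀ s, AEStronglyMeasurable[MeasurableSpace.comap (fun ω t => B t ω) inferInstance]
      (α s) P) {t : ℝ≥0} {Y : Ω → ℝ} (hY : IsItoIntegral F P W α t Y) {R : Ω → ℝ}
    (hR : AEStronglyMeasurable[MeasurableSpace.comap (fun ω t => B t ω) inferInstance] R P)
    (ξ : ℝ) :
    ∫ ω, Complex.exp ((R ω + ξ * Y ω : ℝ) * Complex.I) ∂P =
    ∫ ω, Complex.exp ((R ω : ℝ) * Complex.I) *
      Complex.exp ((-(ξ ^ 2 * (∫ s in (0 : ℝ)..t, α s.toNNReal ω ^ 2) / 2) : ℝ)) ∂P := by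
  have hle : MeasurableSpace.comap (fun ω t => B t ω) inferInstance ≤ mΩ :=
    (measurable_pi_lambda _ hB).comap_le
  have hRm : AEMeasurable R P := (hR.mono hle).aemeasurable
  have hαm : ∀ s, Measurable (α s) := fun s => (hα s).mono (F.le s) le_rfl
  obtain ⟨n, hn, hlim⟩ := (hY.tendsto_riemannSum hW hα hαc).exists_seq_tendsto_ae
  have key : ∀ k, ∫ ω, Complex.exp ((R ω + ξ * riemannSum α W (t / n k) (n k) ω : ℝ) *
      Complex.I) ∂P = ∫ ω, Complex.exp ((R ω : ℝ) * Complex.I) *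
      Complex.exp ((-((∑ j ∈ Finset.range (n k), ((t / n k : ℝ≥0) : ℝ) *
        (ξ * α (j * (t / n k)) ω) ^ 2) / 2) : ℝ)) ∂P := by
    intro k
    rw [← integral_cexp_add_sum hB hW hBW hR (fun j => (hαB _).const_mul ξ)]
    refine integral_congr_ae (ae_of_all _ fun ω => ?_)
    simp only [riemannSum, Finset.mul_sum, mul_assoc]
    push_cast
    rfl
  have l1 : Tendsto (fun k => ∫ ω, Complex.exp ((R ω + ξ * riemannSum α W (t / n k) (n k) ω : ℝ) *
      Complex.I) ∂P) atTop (𝓝 (∫ ω, Complex.exp ((R ω + ξ * Y ω : ℝ) * Complex.I) ∂P)) := by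
    refine tendsto_integral_of_dominated_convergence (fun _ => 1) (fun k => ?_)
      (integrable_const _) (fun k => ae_of_all _ fun ω => (Complex.norm_exp_ofReal_mul_I _).le) ?_
    · have hm := measurable_riemannSum hW hα (t / n k) (n k)
      exact AEMeasurable.aestronglyMeasurable (by fun_prop)
    · filter_upwards [hlim] with ω hω
      have hc : Continuous fun y : ℝ => Complex.exp ((R ω + ξ * y : ℝ) * Complex.I) := by fun_prop
      exact (hc.tendsto _).comp hω
  have l2 : Tendsto (fun k => ∫ ω, Complex.exp ((R ω : ℝ) * Complex.I) *
      Complex.exp ((-((∑ j ∈ Finset.range (n k), ((t / n k : ℝ≥0) : ℝ) *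
        (ξ * α (j * (t / n k)) ω) ^ 2) / 2) : ℝ)) ∂P) atTop (𝓝 (∫ ω, Complex.exp ((R ω : ℝ) *
          Complex.I) * Complex.exp ((-(ξ ^ 2 * (∫ s in (0 : ℝ)..t, α s.toNNReal ω ^ 2) / 2) : ℝ))
          ∂P)) := by
    refine tendsto_integral_of_dominated_convergence (fun _ => 1) (fun k => ?_)
      (integrable_const _) (fun k => ae_of_all _ fun ω => ?_) (ae_of_all _ fun ω => ?_)
    · exact AEMeasurable.aestronglyMeasurable (by fun_prop)
    · rw [norm_mul, Complex.norm_exp_ofReal_mul_I, one_mul, ← Complex.ofReal_exp,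
        Complex.norm_real, Real.norm_eq_abs, Real.abs_exp]
      refine Real.exp_le_one_iff.2 (neg_nonpos.2 (div_nonneg ?_ (by norm_num)))
      exact Finset.sum_nonneg fun j _ => by positivity
    · refine Tendsto.const_mul _ ?_
      have hr := ((tendsto_riemannSum_integral (f := fun s => α s ω ^ 2)
        ((hαc ω).pow 2) t).comp hn.tendsto_atTop).const_mul (ξ ^ 2)
      have hc : Continuous fun y : ℝ => Complex.exp ((-(y / 2) : ℝ)) := by fun_prop
      refine ((hc.tendsto _).comp hr).congr fun k => ?_
      have e : ξ ^ 2 * ∑ j ∈ Finset.range (n k), ((t / n k : ℝ≥0) : ℝ) *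
          α (j * (t / n k)) ω ^ 2 = ∑ j ∈ Finset.range (n k), ((t / n k : ℝ≥0) : ℝ) *
          (ξ * α (j * (t / n k)) ω) ^ 2 := by
        rw [Finset.mul_sum]
        exact Finset.sum_congr rfl fun j _ => by ring
      simp only [Function.comp_apply, e]
  refine tendsto_nhds_unique l1 (l2.congr fun k => (key k).symm)

/-- The joint law of a conditionally Gaussian integral and `B`-measurable functionals. -/
theorem IsItoIntegral.map_add_mul_prodMk [IsProbabilityMeasure P] (hB : ∀ s, Measurable (B s))
    (hW : IsFilteredBrownian F P W) (hBW : IndepFun (fun ω t => B t ω) (fun ω t => W t ω) P)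
    {α : ℝ≥0 → Ω → ℝ} (hα : Adapted F α) (hαc : ∀ ω, Continuous fun s => α s ω)
    (hαB : ∀ s, AEStronglyMeasurable[MeasurableSpace.comap (fun ω t => B t ω) inferInstance]
      (α s) P) {t : ℝ≥0} {Y : Ω → ℝ} (hY : IsItoIntegral F P W α t Y) (hYm : AEMeasurable Y P)
    {m η : Ω → ℝ}
    (hm : AEStronglyMeasurable[MeasurableSpace.comap (fun ω t => B t ω) inferInstance] m P)
    (hη : AEStronglyMeasurable[MeasurableSpace.comap (fun ω t => B t ω) inferInstance] η P)
    (c : ℝ) :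
    P.map (fun ω => (m ω + c * Y ω, η ω)) =
      (P.prod (gaussianReal 0 1)).map (fun p => (m p.1 +
        c * √(∫ s in (0 : ℝ)..t, α s.toNNReal p.1 ^ 2) * p.2, η p.1)) := by
  have hle : MeasurableSpace.comap (fun ω t => B t ω) inferInstance ≤ mΩ :=
    (measurable_pi_lambda _ hB).comap_le
  have hmm : AEMeasurable m P := (hm.mono hle).aemeasurable
  have hηm : AEMeasurable η P := (hη.mono hle).aemeasurable
  have hqm : AEMeasurable (fun ω => ∫ s in (0 : ℝ)..t, α s.toNNReal ω ^ 2) P :=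
    ((aestronglyMeasurable_comap_integral_sq hαc hαB t).mono hle).aemeasurable
  set q : Ω → ℝ := fun ω => ∫ s in (0 : ℝ)..t, α s.toNNReal ω ^ 2 with hq
  have hq0 : ∀ ω, 0 ≤ q ω := fun ω =>
    intervalIntegral.integral_nonneg t.coe_nonneg fun s _ => sq_nonneg _
  have hM1 : AEMeasurable (fun ω => (m ω + c * Y ω, η ω)) P := by fun_prop
  have hM2 : AEMeasurable (fun p : Ω × ℝ => (m p.1 + c * √(q p.1) * p.2, η p.1))
      (P.prod (gaussianReal 0 1)) := by
    have h1 : AEMeasurable (fun p : Ω × ℝ => m p.1) (P.prod (gaussianReal 0 1)) := hmm.comp_fst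
    have h2 : AEMeasurable (fun p : Ω × ℝ => η p.1) (P.prod (gaussianReal 0 1)) := hηm.comp_fst
    have h3 : AEMeasurable (fun p : Ω × ℝ => q p.1) (P.prod (gaussianReal 0 1)) := hqm.comp_fst
    exact (h1.add ((h3.sqrt.const_mul c).mul (by fun_prop))).prodMk h2
  have : IsProbabilityMeasure (P.map (fun ω => (m ω + c * Y ω, η ω))) :=
    Measure.isProbabilityMeasure_map hM1
  have : IsProbabilityMeasure ((P.prod (gaussianReal 0 1)).map
    (fun p : Ω × ℝ => (m p.1 + c * √(q p.1) * p.2, η p.1))) := Measure.isProbabilityMeasure_map hM2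
  -- Every functional on ℝ × ℝ is (x, y) ↦ ax + by, so the conditional formula with R = am + bη and
  -- frequency ac determines the law.
  refine Measure.ext_of_charFunDual (funext fun L => ?_)
  have hL : ∀ x y : ℝ, L (x, y) = L (1, 0) * x + L (0, 1) * y := by
    intro x y
    have : ((x, y) : ℝ × ℝ) = x • (1, 0) + y • (0, 1) := by simp
    rw [this, map_add, map_smul, map_smul, smul_eq_mul, smul_eq_mul, mul_comm x, mul_comm y]
  set a := L (1, 0)
  set b := L (0, 1)
  rw [charFunDual_apply, charFunDual_apply, integral_map hM1 (by fun_prop),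
    integral_map hM2 (by fun_prop)]
  simp only [hL]
  have hR : AEStronglyMeasurable[MeasurableSpace.comap (fun ω t => B t ω) inferInstance]
      (fun ω => a * m ω + b * η ω) P := (hm.const_mul a).add (hη.const_mul b)
  have h1 := hY.integral_cexp_add_mul hB hW hBW hα hαc hαB hR (a * c)
  have e1 : ∀ ω, a * (m ω + c * Y ω) + b * η ω = a * m ω + b * η ω + a * c * Y ω := fun ω => by ring
  simp only [e1]
  rw [h1, integral_prod]
  · refine integral_congr_ae (ae_of_all _ fun ω => ?_)
    have h2 : ∫ x, Complex.exp ((a * c * √(q ω) * x : ℝ) * Complex.I) ∂(gaussianReal 0 1) =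
        Complex.exp ((-((a * c) ^ 2 * q ω / 2) : ℝ)) := by
      have h3 := charFun_gaussianReal (μ := 0) (v := 1) (a * c * √(q ω))
      rw [charFun_apply_real] at h3
      have e : -(((a * c) ^ 2 * q ω / 2 : ℝ)) = -((a * c * √(q ω)) ^ 2 / 2) := by
        rw [mul_pow _ (√_), Real.sq_sqrt (hq0 ω)]
      rw [e]
      push_cast at h3 ⊢
      rw [h3]
      congr 1
      ring
    dsimp only
    rw [← h2, ← integral_const_mul]
    refine integral_congr_ae (ae_of_all _ fun x => ?_)
    dsimp only
    rw [← Complex.exp_add, ← add_mul, ← Complex.ofReal_add]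
    congr 3
    ring
  · refine Integrable.of_bound (C := 1) ?_ (ae_of_all _ fun p =>
      (Complex.norm_exp_ofReal_mul_I _).le)
    have hc : Continuous fun p : ℝ × ℝ => Complex.exp ((a * p.1 + b * p.2 : ℝ) * Complex.I) := by
      fun_prop
    exact (hc.measurable.comp_aemeasurable hM2).aestronglyMeasurable

end ConditionalGaussian

/-! ### Fourier representation of Gaussian mixtures. -/

section FourierMixture

theorem integral_cexp_mul_exp_neg_sq {V : ℝ} (hV : 0 < V) (y : ℝ) :
    ∫ ξ : ℝ, Complex.exp ((ξ * y : ℝ) * Complex.I) * ((Real.exp (-(V / 2 * ξ ^ 2)) : ℝ) : ℂ) =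
      ((√(2 * Real.pi / V) * Real.exp (-(y ^ 2 / (2 * V))) : ℝ) : ℂ) := by
  have hVc : (V : ℂ) ≠ 0 := by exact_mod_cast hV.ne'
  have h := integral_cexp_quadratic (b := ((-(V / 2) : ℝ) : ℂ))
    (by rw [Complex.ofReal_re]; linarith) (y * Complex.I) 0
  have e1 : (Real.pi : ℂ) / -((-(V / 2) : ℝ) : ℂ) = ((2 * Real.pi / V : ℝ) : ℂ) := by
    push_cast; field_simp
  have e2 : (0 : ℂ) - (y * Complex.I) ^ 2 / (4 * ((-(V / 2) : ℝ) : ℂ)) =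
      ((-(y ^ 2 / (2 * V)) : ℝ) : ℂ) := by
    rw [mul_pow, Complex.I_sq]; push_cast; field_simp; ring
  rw [e1, e2] at h
  rw [Complex.ofReal_mul, Complex.ofReal_exp, Real.sqrt_eq_rpow,
    Complex.ofReal_cpow (by positivity)]
  push_cast at h ⊢
  rw [← h]
  refine integral_congr_ae (ae_of_all _ fun ξ => ?_)
  dsimp only
  rw [← Complex.exp_add]
  congr 1
  ring

theorem sqrt_mul_exp_eq_gaussianPDFReal {V : ℝ} (hV : 0 < V) (m x : ℝ) :
    √(2 * Real.pi / V) * Real.exp (-((x - m) ^ 2 / (2 * V))) =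
      2 * Real.pi * gaussianPDFReal m V.toNNReal x := by
  have h1 : √(2 * Real.pi / V) = 2 * Real.pi * (√(2 * Real.pi * V))⁻¹ := by
    have hp := Real.pi_pos
    rw [← div_eq_mul_inv, eq_div_iff (by positivity), ← Real.sqrt_mul (by positivity),
      show 2 * Real.pi / V * (2 * Real.pi * V) = (2 * Real.pi) ^ 2 by field_simp,
      Real.sqrt_sq (by positivity)]
  rw [gaussianPDFReal, Real.coe_toNNReal _ hV.le, h1, neg_div, mul_assoc]

variable {E : Type*} [MeasurableSpace E] {μ : Measure E} [IsFiniteMeasure μ] {m V : E → ℝ}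

/-- For fixed z the norm integrates over ξ to √(2π / V z), so joint integrability is finiteness of
the integral of V^{-1/2}. -/
theorem integrable_fourier_mixture (hm : Measurable m) (hV : Measurable V)
    (hV0 : ∀ᵐ z ∂μ, 0 < V z) (hfin : ∫⁻ z, ENNReal.ofReal (1 / √(V z)) ∂μ ≠ ⊤) (x : ℝ) :
    Integrable (fun p : ℝ × E => Complex.exp ((p.1 * (x - m p.2) : ℝ) * Complex.I) *
      ((Real.exp (-(V p.2 / 2 * p.1 ^ 2)) : ℝ) : ℂ)) (volume.prod μ) := by
  have hmeas : Measurable (fun p : ℝ × E => Complex.exp ((p.1 * (x - m p.2) : ℝ) * Complex.I) *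
      ((Real.exp (-(V p.2 / 2 * p.1 ^ 2)) : ℝ) : ℂ)) := by fun_prop
  have hnorm : ∀ p : ℝ × E, ‖Complex.exp ((p.1 * (x - m p.2) : ℝ) * Complex.I) *
      ((Real.exp (-(V p.2 / 2 * p.1 ^ 2)) : ℝ) : ℂ)‖ = Real.exp (-(V p.2 / 2) * p.1 ^ 2) := by
    intro p
    rw [norm_mul, Complex.norm_exp_ofReal_mul_I, one_mul, Complex.norm_real, Real.norm_eq_abs,
      Real.abs_exp, neg_mul]
  refine (integrable_prod_iff' hmeas.aestronglyMeasurable).2 ⟨?_, ?_⟩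
  · filter_upwards [hV0] with z hz
    refine (integrable_exp_neg_mul_sq (half_pos hz)).mono'
      (hmeas.comp measurable_prodMk_right).aestronglyMeasurable (ae_of_all _ fun ξ => ?_)
    exact (hnorm (ξ, z)).le
  · have e : ∀ᵐ z ∂μ, √(2 * Real.pi) * (1 / √(V z)) =
        ∫ ξ : ℝ, ‖Complex.exp ((ξ * (x - m z) : ℝ) * Complex.I) *
          ((Real.exp (-(V z / 2 * ξ ^ 2)) : ℝ) : ℂ)‖ := by
      filter_upwards [hV0] with z hz
      have h1 : ∀ ξ : ℝ, ‖Complex.exp ((ξ * (x - m z) : ℝ) * Complex.I) *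
          ((Real.exp (-(V z / 2 * ξ ^ 2)) : ℝ) : ℂ)‖ = Real.exp (-(V z / 2) * ξ ^ 2) :=
        fun ξ => hnorm (ξ, z)
      simp only [h1]
      rw [integral_gaussian, mul_one_div, ← Real.sqrt_div (by positivity)]
      congr 1
      field_simp
    refine Integrable.congr (Integrable.const_mul ?_ _) e
    refine ⟨(hV.sqrt.const_div 1).aestronglyMeasurable, ?_⟩
    rw [hasFiniteIntegral_iff_ofReal (ae_of_all _ fun z => by positivity)]
    exact hfin.lt_top

theorem integrable_integral_fourier_mixture (hm : Measurable m) (hV : Measurable V)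
    (hV0 : ∀ᵐ z ∂μ, 0 < V z) (hfin : ∫⁻ z, ENNReal.ofReal (1 / √(V z)) ∂μ ≠ ⊤) (x : ℝ) :
    Integrable (fun ξ : ℝ => ∫ z, Complex.exp ((ξ * (x - m z) : ℝ) * Complex.I) *
      ((Real.exp (-(V z / 2 * ξ ^ 2)) : ℝ) : ℂ) ∂μ) :=
  (integrable_fourier_mixture hm hV hV0 hfin x).integral_prod_left

/-- Fubini, then Gaussian Fourier inversion inside the mixture. -/
theorem integral_integral_fourier_mixture (hm : Measurable m) (hV : Measurable V)
    (hV0 : ∀ᵐ z ∂μ, 0 < V z) (hfin : ∫⁻ z, ENNReal.ofReal (1 / √(V z)) ∂μ ≠ ⊤) (x : ℝ) :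
    ∫ ξ : ℝ, ∫ z, Complex.exp ((ξ * (x - m z) : ℝ) * Complex.I) *
      ((Real.exp (-(V z / 2 * ξ ^ 2)) : ℝ) : ℂ) ∂μ =
      ((2 * Real.pi * (∫⁻ z, gaussianPDF (m z) (V z).toNNReal x ∂μ).toReal : ℝ) : ℂ) := by
  rw [integral_integral_swap (integrable_fourier_mixture hm hV hV0 hfin x)]
  have e : ∀ᵐ z ∂μ, ∫ ξ : ℝ, Complex.exp ((ξ * (x - m z) : ℝ) * Complex.I) *
      ((Real.exp (-(V z / 2 * ξ ^ 2)) : ℝ) : ℂ) =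
      ((2 * Real.pi * gaussianPDFReal (m z) (V z).toNNReal x : ℝ) : ℂ) := by
    filter_upwards [hV0] with z hz
    rw [integral_cexp_mul_exp_neg_sq hz, sqrt_mul_exp_eq_gaussianPDFReal hz]
  rw [integral_congr_ae e, integral_complex_ofReal, integral_const_mul]
  congr 2
  rw [integral_eq_lintegral_of_nonneg_ae (ae_of_all _ fun z => gaussianPDFReal_nonneg _ _ _)]
  · rfl
  · unfold gaussianPDFReal
    fun_prop

end FourierMixture

/-! ### Finiteness of E[v^{-1/2}]. -/

section NegativeMoment

/-- The convex function x ↦ x^{-1/2} lies above its tangent at r², evaluated at x = w². -/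
theorem one_div_sqrt_le_of_pos {r w : ℝ} (hr : 0 < r) (hw : 0 < w) :
    1 / r * (3 / 2 - w ^ 2 / (2 * r ^ 2)) ≤ 1 / w := by
  rw [← sub_nonneg]
  have e : 1 / w - 1 / r * (3 / 2 - w ^ 2 / (2 * r ^ 2)) =
      (w - r) ^ 2 * (w + 2 * r) / (2 * r ^ 3 * w) := by field_simp; ring
  rw [e]
  positivity

/-- Jensen's inequality for the inverse square root of an integral. -/
theorem one_div_sqrt_integral_le {w : ℝ → ℝ} (hw : Continuous w) (hw0 : ∀ s, 0 < w s) {t : ℝ}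
    (ht : 0 < t) :
    1 / √(∫ s in (0 : ℝ)..t, w s ^ 2) ≤ (t * √t)⁻¹ * ∫ s in (0 : ℝ)..t, 1 / w s := by
  set v := ∫ s in (0 : ℝ)..t, w s ^ 2 with hv
  have hi : IntervalIntegrable (fun s => w s ^ 2) volume 0 t := (hw.pow 2).intervalIntegrable _ _
  have hv0 : 0 < v := intervalIntegral.intervalIntegral_pos_of_pos hi
    (fun s => pow_pos (hw0 s) 2) ht
  -- Tangency is taken at the mean of w², where the integrated tangent line equals t / r.
  set r := √(v / t) with hr
  have hr0 : 0 < r := Real.sqrt_pos.2 (div_pos hv0 ht)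
  have hr2 : r ^ 2 = v / t := Real.sq_sqrt (div_pos hv0 ht).le
  have hwi : Continuous fun s => 1 / w s := continuous_const.div hw fun s => (hw0 s).ne'
  have h1 : ∫ s in (0 : ℝ)..t, 1 / r * (3 / 2 - w s ^ 2 / (2 * r ^ 2)) ≤
      ∫ s in (0 : ℝ)..t, 1 / w s :=
    intervalIntegral.integral_mono_on ht.le (Continuous.intervalIntegrable (by fun_prop) _ _)
      (hwi.intervalIntegrable _ _) fun s _ => one_div_sqrt_le_of_pos hr0 (hw0 s)
  have h2 : ∫ s in (0 : ℝ)..t, 1 / r * (3 / 2 - w s ^ 2 / (2 * r ^ 2)) = t / r := by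
    rw [intervalIntegral.integral_const_mul, intervalIntegral.integral_sub (by simp)
      (hi.div_const _), intervalIntegral.integral_const, intervalIntegral.integral_div, ← hv, hr2]
    field_simp
    simp
    ring
  have h3 : 1 / √v = (t * √t)⁻¹ * (t / r) := by
    rw [hr, Real.sqrt_div hv0.le]
    have := Real.sqrt_pos.2 ht
    have := Real.sqrt_pos.2 hv0
    field_simp
  rw [h3]
  rw [h2] at h1
  gcongr

variable {Ω : Type*} {mΩ : MeasurableSpace Ω} {P : Measure Ω}

/-- Jensen bounds v^{-1/2} by a constant times ∫ exp(-νX_s) ds. By Tonelli its mean is an integral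
of Gaussian exponential moments, each at most exp(Tν²/2). -/
theorem lintegral_one_div_sqrt_integratedVar_ne_top [IsProbabilityMeasure P] {X : ℝ≥0 → Ω → ℝ}
    (hX : ∀ s, Measurable (X s)) (hXc : ∀ ω, Continuous fun s => X s ω) {τ : ℝ≥0 → ℝ≥0} {T : ℝ≥0}
    {t : ℝ≥0} (ht : 0 < t) (hlaw : ∀ s, HasLaw (X s) (gaussianReal 0 (τ s)) P)
    (hτ : ∀ s ≤ t, τ s ≤ T) (ν : ℝ) :
    ∫⁻ ω, ENNReal.ofReal (1 / √(integratedVar ν X t ω)) ∂P ≠ ⊤ := by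
  have hjoint : Measurable (Function.uncurry fun (s : ℝ) (ω : Ω) => X s.toNNReal ω) :=
    measurable_uncurry_of_continuous_of_measurable
      (fun ω => (hXc ω).comp continuous_real_toNNReal) fun s => hX _
  set C := (t * √(t : ℝ))⁻¹ with hC
  have hpt : ∀ ω, ENNReal.ofReal (1 / √(integratedVar ν X t ω)) ≤
      ENNReal.ofReal C * ∫⁻ s in Set.Ioc (0 : ℝ) t,
        ENNReal.ofReal (Real.exp (-ν * X s.toNNReal ω)) := by
    intro ω
    have hc : Continuous fun s : ℝ => X s.toNNReal ω := (hXc ω).comp continuous_real_toNNReal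
    have h := one_div_sqrt_integral_le (w := fun s => Real.exp (ν * X s.toNNReal ω)) (by fun_prop)
      (fun s => Real.exp_pos _) (show (0 : ℝ) < t from ht)
    have e1 : ∫ s in (0 : ℝ)..t, Real.exp (ν * X s.toNNReal ω) ^ 2 = integratedVar ν X t ω := by
      rw [integratedVar]
      refine intervalIntegral.integral_congr fun s _ => ?_
      simp only [← Real.exp_nat_mul]
      congr 1; push_cast; ring
    have e2 : ∀ s : ℝ, 1 / Real.exp (ν * X s.toNNReal ω) = Real.exp (-ν * X s.toNNReal ω) := by
      intro s; rw [one_div, ← Real.exp_neg, neg_mul]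
    rw [e1] at h
    simp only [e2] at h
    have hi : IntegrableOn (fun s : ℝ => Real.exp (-ν * X s.toNNReal ω)) (Set.Ioc 0 t) :=
      (Continuous.integrableOn_Icc (by fun_prop)).mono_set Set.Ioc_subset_Icc_self
    rw [← ofReal_integral_eq_lintegral_ofReal hi (ae_of_all _ fun s => (Real.exp_pos _).le),
      ← ENNReal.ofReal_mul (by positivity), ← intervalIntegral.integral_of_le t.coe_nonneg]
    exact ENNReal.ofReal_le_ofReal h
  have hmgf : ∀ s : ℝ≥0, ∫⁻ ω, ENNReal.ofReal (Real.exp (-ν * X s ω)) ∂P =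
      ENNReal.ofReal (Real.exp (τ s * ν ^ 2 / 2)) := by
    intro s
    have h1 : Integrable (fun ω => Real.exp (-ν * X s ω)) P := by
      have := integrable_exp_mul_gaussianReal (μ := 0) (v := τ s) (-ν)
      rw [← (hlaw s).map_eq] at this
      exact this.comp_measurable (hX s)
    rw [← ofReal_integral_eq_lintegral_ofReal h1 (ae_of_all _ fun s => (Real.exp_pos _).le)]
    have h2 := (hlaw s).integral_comp (f := fun x => Real.exp (-ν * x)) (by fun_prop)
    have h3 := congrFun (mgf_id_gaussianReal (μ := 0) (v := τ s)) (-ν)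
    simp only [mgf, id, Function.comp_def] at h2 h3
    rw [h2, h3]
    congr 2
    ring
  refine ne_top_of_le_ne_top ?_ (lintegral_mono hpt)
  rw [lintegral_const_mul']
  · refine ENNReal.mul_ne_top ENNReal.ofReal_ne_top ?_
    rw [lintegral_lintegral_swap]
    · refine ne_top_of_le_ne_top ?_ (setLIntegral_mono (g := fun _ =>
        ENNReal.ofReal (Real.exp (T * ν ^ 2 / 2))) measurable_const fun s hs => ?_)
      · rw [setLIntegral_const, Real.volume_Ioc]
        exact ENNReal.mul_ne_top ENNReal.ofReal_ne_top ENNReal.ofReal_ne_top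
      · rw [hmgf]
        apply ENNReal.ofReal_le_ofReal
        have : ((τ s.toNNReal : ℝ≥0) : ℝ) ≤ T := by
          exact_mod_cast hτ _ (Real.toNNReal_le_iff_le_coe.2 hs.2)
        gcongr
    · have : Measurable (fun p : Ω × ℝ => X p.2.toNNReal p.1) := hjoint.comp measurable_swap
      exact ((this.const_mul (-ν)).exp.ennreal_ofReal).aemeasurable
  · exact ENNReal.ofReal_ne_top

end NegativeMoment

/-! ### Disintegration of a conditionally Gaussian pair. -/

section Mixture

theorem gaussianReal_zero_one_map_add_mul {V : ℝ} (hV : 0 ≤ V) (m : ℝ) :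
    (gaussianReal 0 1).map (fun x => m + √V * x) = gaussianReal m V.toNNReal := by
  have h1 := gaussianReal_map_const_mul (μ := 0) (v := 1) (√V)
  have e : (NNReal.mk (√V ^ 2) (sq_nonneg _) * 1 : ℝ≥0) = V.toNNReal := by
    ext; simp [Real.sq_sqrt hV, hV]
  rw [mul_zero, e] at h1
  have h2 := gaussianReal_map_const_add (μ := 0) (v := V.toNNReal) m
  rw [← h1, Measure.map_map (by fun_prop) (by fun_prop), zero_add] at h2
  exact h2

theorem lintegral_gaussianReal_zero_one_add_mul {V : ℝ} (hV : 0 < V) (m : ℝ) {g : ℝ → ℝ≥0∞}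
    (hg : Measurable g) :
    ∫⁻ x, g (m + √V * x) ∂(gaussianReal 0 1) =
      ∫⁻ x, gaussianPDF m V.toNNReal x * g x := by
  rw [← lintegral_map (f := g) (g := fun x => m + √V * x) hg (by fun_prop),
    gaussianReal_zero_one_map_add_mul hV.le,
    gaussianReal_of_var_ne_zero _ (Real.toNNReal_pos.2 hV).ne',
    lintegral_withDensity_eq_lintegral_mul _ (measurable_gaussianPDF _ _) hg]
  rfl

variable {E : Type*} [MeasurableSpace E]

theorem measurable_gaussianPDF_comp {m V x : E → ℝ} (hm : Measurable m) (hV : Measurable V)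
    (hx : Measurable x) : Measurable fun z => gaussianPDF (m z) (V z).toNNReal (x z) := by
  unfold gaussianPDF gaussianPDFReal
  fun_prop

variable {Ω : Type*} {mΩ : MeasurableSpace Ω} {P : Measure Ω} [StandardBorelSpace E] [Nonempty E]

theorem measurable_lintegral_condDistrib_gaussianPDF [IsProbabilityMeasure P] (ζ : Ω → E)
    (η : Ω → ℝ) {m V : E → ℝ} (hm : Measurable m) (hV : Measurable V) :
    Measurable fun p : ℝ × ℝ =>
      ∫⁻ z, gaussianPDF (m z) (V z).toNNReal p.1 ∂(condDistrib ζ η P p.2) := by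
  have h : Measurable (Function.uncurry fun (p : ℝ × ℝ) (z : E) =>
      gaussianPDF (m z) (V z).toNNReal p.1) :=
    measurable_gaussianPDF_comp (hm.comp measurable_snd) (hV.comp measurable_snd)
      (measurable_fst.comp measurable_fst)
  exact h.lintegral_kernel_prod_right (κ := (condDistrib ζ η P).comap Prod.snd measurable_snd)

/-- The density of a conditionally Gaussian variable together with a Gaussian conditioning
variable. -/
theorem map_mixture_eq_withDensity [IsProbabilityMeasure P] {ζ : Ω → E} (hζ : AEMeasurable ζ P)
    {η : Ω → ℝ} (hη : AEMeasurable η P) {T : ℝ≥0} (hT : T ≠ 0)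
    (hlaw : P.map η = gaussianReal 0 T) {m V : E → ℝ} (hm : Measurable m) (hV : Measurable V)
    (hV0 : ∀ᵐ ω ∂P, 0 < V (ζ ω)) :
    (P.prod (gaussianReal 0 1)).map (fun p => (m (ζ p.1) + √(V (ζ p.1)) * p.2, η p.1)) =
      (volume : Measure (ℝ × ℝ)).withDensity fun p => gaussianPDF 0 T p.2 *
        ∫⁻ z, gaussianPDF (m z) (V z).toNNReal p.1 ∂(condDistrib ζ η P p.2) := by
  have hD := measurable_lintegral_condDistrib_gaussianPDF (P := P) ζ η hm hV
  have hfD : Measurable fun p : ℝ × ℝ => gaussianPDF 0 T p.2 *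
      ∫⁻ z, gaussianPDF (m z) (V z).toNNReal p.1 ∂(condDistrib ζ η P p.2) :=
    ((measurable_gaussianPDF _ _).comp measurable_snd).mul hD
  have hζ' : AEMeasurable (fun p : Ω × ℝ => ζ p.1) (P.prod (gaussianReal 0 1)) := hζ.comp_fst
  have hη' : AEMeasurable (fun p : Ω × ℝ => η p.1) (P.prod (gaussianReal 0 1)) := hη.comp_fst
  have hM : AEMeasurable (fun p : Ω × ℝ => (m (ζ p.1) + √(V (ζ p.1)) * p.2, η p.1))
      (P.prod (gaussianReal 0 1)) :=
    ((hm.comp_aemeasurable hζ').add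
      ((hV.comp_aemeasurable hζ').sqrt.mul measurable_snd.aemeasurable)).prodMk hη'
  refine Measure.ext_of_lintegral _ fun g hg => ?_
  have hG : Measurable fun p : ℝ × E => ∫⁻ x, gaussianPDF (m p.2) (V p.2).toNNReal x * g (x, p.1) := by
    refine Measurable.lintegral_prod_right' (f := fun q : (ℝ × E) × ℝ =>
      gaussianPDF (m q.1.2) (V q.1.2).toNNReal q.2 * g (q.2, q.1.1)) ?_
    refine (measurable_gaussianPDF_comp ?_ ?_ measurable_snd).mul (hg.comp ?_)
    · exact hm.comp (measurable_snd.comp measurable_fst)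
    · exact hV.comp (measurable_snd.comp measurable_fst)
    · exact measurable_snd.prodMk (measurable_fst.comp measurable_fst)
  rw [lintegral_map' hg.aemeasurable hM, 
    lintegral_prod (fun p : Ω × ℝ => g (m (ζ p.1) + √(V (ζ p.1)) * p.2, η p.1))
      (hg.comp_aemeasurable hM)]
  calc _ = ∫⁻ ω, (∫⁻ x, gaussianPDF (m (ζ ω)) (V (ζ ω)).toNNReal x * g (x, η ω)) ∂P := by
        refine lintegral_congr_ae ?_
        filter_upwards [hV0] with ω hω
        exact lintegral_gaussianReal_zero_one_add_mul hω (m (ζ ω)) (g := fun x => g (x, η ω))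
          (hg.comp measurable_prodMk_right)
    -- The joint law of (η, ζ) is the law of η composed with the conditional distribution of ζ.
    _ = ∫⁻ y, (∫⁻ z, (∫⁻ x, gaussianPDF (m z) (V z).toNNReal x * g (x, y))
          ∂(condDistrib ζ η P y)) ∂(P.map η) := by
        rw [← Measure.lintegral_compProd (f := fun p : ℝ × E =>
          ∫⁻ x, gaussianPDF (m p.2) (V p.2).toNNReal x * g (x, p.1)) hG,
          compProd_map_condDistrib hζ, lintegral_map' hG.aemeasurable (hη.prodMk hζ)]
    _ = ∫⁻ y, (∫⁻ x, (∫⁻ z, gaussianPDF (m z) (V z).toNNReal x ∂(condDistrib ζ η P y)) * g (x, y))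
          ∂(P.map η) := by
        refine lintegral_congr fun y => ?_
        rw [lintegral_lintegral_swap]
        · refine lintegral_congr fun x => ?_
          rw [lintegral_mul_const _ (measurable_gaussianPDF_comp hm hV measurable_const)]
        · refine Measurable.aemeasurable ?_
          exact (measurable_gaussianPDF_comp (hm.comp measurable_fst) (hV.comp measurable_fst)
            measurable_snd).mul (hg.comp (measurable_snd.prodMk measurable_const))
    _ = _ := by
        rw [hlaw, gaussianReal_of_var_ne_zero _ hT,
          lintegral_withDensity_eq_lintegral_mul _ (measurable_gaussianPDF _ _)
            (g := fun y => ∫⁻ x, (∫⁻ z, gaussianPDF (m z) (V z).toNNReal x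
              ∂(condDistrib ζ η P y)) * g (x, y)) (Measurable.lintegral_prod_left' (f := fun p : ℝ × ℝ => (∫⁻ z, gaussianPDF (m z)
              (V z).toNNReal p.1 ∂(condDistrib ζ η P p.2)) * g (p.1, p.2)) (hD.mul hg)),
          lintegral_withDensity_eq_lintegral_mul _ hfD hg, Measure.volume_eq_prod,
          lintegral_prod_symm' _ (hfD.mul hg)]
        refine lintegral_congr fun y => ?_
        simp only [Pi.mul_apply]
        rw [← lintegral_const_mul]
        · simp only [mul_assoc]
        · exact (hD.comp measurable_prodMk_right).mul (hg.comp measurable_prodMk_right)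

/-- A finite mean has almost surely finite conditional means. Almost every value of η may be read as
Lebesgue almost every y, because a nondegenerate Gaussian dominates Lebesgue measure. -/
theorem ae_condDistrib_of_lintegral_ne_top [IsProbabilityMeasure P] {ζ : Ω → E}
    (hζ : AEMeasurable ζ P) {η : Ω → ℝ} (hη : AEMeasurable η P) {T : ℝ≥0} (hT : T ≠ 0)
    (hlaw : P.map η = gaussianReal 0 T) {V : E → ℝ} (hV : Measurable V)
    (hV0 : ∀ᵐ ω ∂P, 0 < V (ζ ω)) (hfin : ∫⁻ ω, ENNReal.ofReal (1 / √(V (ζ ω))) ∂P ≠ ⊤) :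
    ∀ᵐ y : ℝ, (∀ᵐ z ∂(condDistrib ζ η P y), 0 < V z) ∧
      ∫⁻ z, ENNReal.ofReal (1 / √(V z)) ∂(condDistrib ζ η P y) ≠ ⊤ := by
  have hac : (volume : Measure ℝ) ≪ P.map η := by
    rw [hlaw]; exact gaussianReal_absolutelyContinuous' 0 hT
  refine hac.ae_le ?_
  have hcomp := compProd_map_condDistrib (μ := P) (X := η) (mβ := Real.measurableSpace) hζ
  have hW : Measurable fun z => ENNReal.ofReal (1 / √(V z)) := (hV.sqrt.const_div 1).ennreal_ofReal
  refine Filter.Eventually.and ?_ ?_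
  · have h1 : ∀ᵐ p ∂((P.map η) ⊗ₘ (condDistrib ζ η P)), 0 < V p.2 := by
      rw [hcomp, ae_map_iff (hη.prodMk hζ) (p := fun p : ℝ × E => 0 < V p.2)
        (measurableSet_lt measurable_const (hV.comp measurable_snd))]
      exact hV0
    exact Measure.ae_ae_of_ae_compProd h1
  · have h2 : ∫⁻ y, ∫⁻ z, ENNReal.ofReal (1 / √(V z)) ∂(condDistrib ζ η P y) ∂(P.map η) ≠ ⊤ := by
      rw [← Measure.lintegral_compProd (f := fun p : ℝ × E => ENNReal.ofReal (1 / √(V p.2)))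
        (hW.comp measurable_snd), hcomp,
        lintegral_map' (f := fun p : ℝ × E => ENNReal.ofReal (1 / √(V p.2)))
          (hW.comp measurable_snd).aemeasurable (hη.prodMk hζ)]
      exact hfin
    filter_upwards [ae_lt_top (Measurable.lintegral_kernel hW) h2] with y hy using hy.ne

end Mixture

/-! ### Change of variables to logarithms. -/

section LogCoordinates

/-- Substitute x = log(s/c)/l, a bijection from (0, ∞) onto ℝ; l is 1 for the price and ν for the
volatility, and |l| allows ν < 0. -/
theorem lintegral_eq_setLIntegral_log {c l : ℝ} (hc : 0 < c) (hl : l ≠ 0) (h : ℝ → ℝ≥0∞) :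
    ∫⁻ x, h x = ∫⁻ s in Set.Ioi (0 : ℝ), ENNReal.ofReal (1 / (s * |l|)) *
      h (Real.log (s / c) / l) := by
  have hder : ∀ s ∈ Set.Ioi (0 : ℝ), HasDerivWithinAt (fun s => Real.log (s / c) / l)
      (1 / (s * l)) (Set.Ioi 0) s := by
    intro s hs
    have hs : 0 < s := hs
    have h1 := (((hasDerivAt_id s).div_const c).log (div_pos hs hc).ne').div_const l
    refine (h1.congr_deriv ?_).hasDerivWithinAt
    simp only [id]
    field_simp
  have hinj : Set.InjOn (fun s => Real.log (s / c) / l) (Set.Ioi 0) := by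
    intro s hs u hu hsu
    have hs : 0 < s := hs
    have hu : 0 < u := hu
    have h1 : Real.log (s / c) = Real.log (u / c) := by
      simp only at hsu; field_simp at hsu; exact hsu
    have h2 := Real.log_injOn_pos (Set.mem_Ioi.2 (div_pos hs hc)) (Set.mem_Ioi.2 (div_pos hu hc)) h1
    field_simp at h2
    exact h2
  have himg : (fun s => Real.log (s / c) / l) '' Set.Ioi 0 = Set.univ := by
    refine Set.eq_univ_of_forall fun x => ⟨c * Real.exp (l * x), ?_, ?_⟩
    · exact mul_pos hc (Real.exp_pos _)
    · simp only
      rw [mul_div_cancel_left₀ _ hc.ne', Real.log_exp, mul_div_cancel_left₀ _ hl]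
  have := lintegral_image_eq_lintegral_abs_deriv_mul measurableSet_Ioi hder hinj h
  rw [himg, setLIntegral_univ] at this
  rw [this]
  refine setLIntegral_congr_fun measurableSet_Ioi fun s hs => ?_
  have hs : 0 < s := hs
  rw [abs_div, abs_one, abs_mul, abs_of_pos hs]

/-- Apply the change of variables to the indicator of a measurable null superset of the exceptional
set. -/
theorem ae_pos_imp_log {c l : ℝ} (hc : 0 < c) (hl : l ≠ 0) {Q : ℝ → Prop} (hQ : ∀ᵐ x, Q x) :
    ∀ᵐ s : ℝ, 0 < s → Q (Real.log (s / c) / l) := by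
  obtain ⟨A, hA, hAm, hA0⟩ := exists_measurable_superset_of_null (ae_iff.1 hQ)
  have h := lintegral_eq_setLIntegral_log hc hl (A.indicator 1)
  rw [lintegral_indicator_one hAm, hA0, eq_comm, lintegral_eq_zero_iff] at h
  · have h' := (ae_restrict_iff' measurableSet_Ioi).1 h
    filter_upwards [h'] with s hs hs0
    by_contra hcon
    have h1 : Real.log (s / c) / l ∈ A := hA hcon
    have h2 := hs hs0
    simp only [Set.indicator_of_mem h1, Pi.one_apply, mul_one, Pi.zero_apply,
      ENNReal.ofReal_eq_zero] at h2
    have : 0 < 1 / (s * |l|) := by positivity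
    linarith
  · exact Measurable.mul (by fun_prop) ((measurable_one.indicator hAm).comp (by fun_prop))

/-- The density of the exponentials of two variables with a joint density. -/
theorem withDensity_map_exp {s₀ a₀ ν : ℝ} (hs₀ : 0 < s₀) (ha₀ : 0 < a₀) (hν : ν ≠ 0)
    {f : ℝ × ℝ → ℝ≥0∞} (hf : Measurable f) :
    ((volume : Measure (ℝ × ℝ)).withDensity f).map
      (fun p => (s₀ * Real.exp p.1, a₀ * Real.exp (ν * p.2))) =
    (volume : Measure (ℝ × ℝ)).withDensity ((Set.Ioi (0 : ℝ) ×ˢ Set.Ioi (0 : ℝ)).indicator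
      fun p => ENNReal.ofReal (1 / p.1) * ENNReal.ofReal (1 / (p.2 * |ν|)) *
        f (Real.log (p.1 / s₀), Real.log (p.2 / a₀) / ν)) := by
  have hS : MeasurableSet (Set.Ioi (0 : ℝ) ×ˢ Set.Ioi (0 : ℝ)) :=
    measurableSet_Ioi.prod measurableSet_Ioi
  have hfl : Measurable fun p : ℝ × ℝ => f (Real.log (p.1 / s₀), Real.log (p.2 / a₀) / ν) :=
    hf.comp (by fun_prop)
  have hF : Measurable fun p : ℝ × ℝ => ENNReal.ofReal (1 / p.1) *
      ENNReal.ofReal (1 / (p.2 * |ν|)) * f (Real.log (p.1 / s₀), Real.log (p.2 / a₀) / ν) :=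
    Measurable.mul (by fun_prop) hfl
  have hE : Measurable fun p : ℝ × ℝ => (s₀ * Real.exp p.1, a₀ * Real.exp (ν * p.2)) := by
    fun_prop
  refine Measure.ext_of_lintegral _ fun g hg => ?_
  rw [lintegral_map hg hE, 
    lintegral_withDensity_eq_lintegral_mul _ hf
      (g := fun p => g (s₀ * Real.exp p.1, a₀ * Real.exp (ν * p.2))) (hg.comp hE),
    lintegral_withDensity_eq_lintegral_mul _ (hF.indicator hS) hg]
  have e : ∀ p, ((Set.Ioi (0 : ℝ) ×ˢ Set.Ioi (0 : ℝ)).indicator (fun p : ℝ × ℝ =>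
      ENNReal.ofReal (1 / p.1) * ENNReal.ofReal (1 / (p.2 * |ν|)) *
        f (Real.log (p.1 / s₀), Real.log (p.2 / a₀) / ν)) * g) p =
      (Set.Ioi (0 : ℝ) ×ˢ Set.Ioi (0 : ℝ)).indicator (fun p : ℝ × ℝ =>
      ENNReal.ofReal (1 / p.1) * ENNReal.ofReal (1 / (p.2 * |ν|)) *
        f (Real.log (p.1 / s₀), Real.log (p.2 / a₀) / ν) * g p) p := by
    intro p
    simp only [Pi.mul_apply, Set.indicator]
    split_ifs <;> simp
  simp only [e]
  have hfg : Measurable (f * fun p : ℝ × ℝ => g (s₀ * Real.exp p.1, a₀ * Real.exp (ν * p.2))) :=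
    hf.mul (hg.comp hE)
  rw [lintegral_indicator hS, Measure.volume_eq_prod, ← Measure.prod_restrict,
    lintegral_prod _ hfg.aemeasurable, 
    lintegral_prod (fun p : ℝ × ℝ => ENNReal.ofReal (1 / p.1) * ENNReal.ofReal (1 / (p.2 * |ν|)) *
      f (Real.log (p.1 / s₀), Real.log (p.2 / a₀) / ν) * g p) (hF.mul hg).aemeasurable,
    lintegral_eq_setLIntegral_log hs₀ one_ne_zero]
  refine setLIntegral_congr_fun measurableSet_Ioi fun s hs => ?_
  have hs : 0 < s := hs
  simp only
  rw [lintegral_eq_setLIntegral_log ha₀ hν, ← lintegral_const_mul' _ _ ENNReal.ofReal_ne_top]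
  refine setLIntegral_congr_fun measurableSet_Ioi fun a ha => ?_
  have ha : 0 < a := ha
  simp only [Pi.mul_apply, div_one, abs_one, mul_one]
  rw [Real.exp_log (div_pos hs hs₀), mul_div_cancel₀ _ hν, Real.exp_log (div_pos ha ha₀),
    mul_div_cancel₀ _ hs₀.ne', mul_div_cancel₀ _ ha₀.ne']
  ring

end LogCoordinates

/-! ### The joint density of the price and the volatility. -/

section FSABR

variable {Ω : Type*} {mΩ : MeasurableSpace Ω} {P : Measure Ω} {F : Filtration ℝ≥0 mΩ}
  {B W BH S : ℝ≥0 → Ω → ℝ}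

theorem continuous_fsabrVol {a₀ ν : ℝ} {ω : Ω} (h : Continuous fun s => BH s ω) :
    Continuous fun s => fsabrVol a₀ ν BH s ω := by
  unfold fsabrVol; fun_prop

theorem adapted_fsabrVol (a₀ ν : ℝ) (h : Adapted F BH) : Adapted F (fsabrVol a₀ ν BH) :=
  fun s => (((h s).const_mul ν).exp).const_mul a₀

theorem integral_fsabrVol_sq (a₀ ν : ℝ) (BH : ℝ≥0 → Ω → ℝ) (t : ℝ≥0) (ω : Ω) :
    ∫ s in (0 : ℝ)..t, fsabrVol a₀ ν BH s.toNNReal ω ^ 2 = a₀ ^ 2 * integratedVar ν BH t ω := by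
  rw [integratedVar, ← intervalIntegral.integral_const_mul]
  refine intervalIntegral.integral_congr fun s _ => ?_
  simp only [fsabrVol]
  rw [mul_pow, ← Real.exp_nat_mul]
  congr 2
  push_cast
  ring

theorem integratedVar_pos {ν : ℝ} {ω : Ω} (h : Continuous fun s => BH s ω) {t : ℝ≥0}
    (ht : 0 < t) : 0 < integratedVar ν BH t ω := by
  have hc : Continuous fun s : ℝ => BH s.toNNReal ω := h.comp continuous_real_toNNReal
  exact intervalIntegral.intervalIntegral_pos_of_pos
    (Continuous.intervalIntegrable (by fun_prop) _ _) (fun s => Real.exp_pos _) ht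

/-- The density of `(S t, α t)` in terms of the conditional law of `(Z, v)` given `BH t`. -/
noncomputable def fsabrDensity {Ω : Type*} {mΩ : MeasurableSpace Ω} (P : Measure Ω)
    [IsFiniteMeasure P] (BH : ℝ≥0 → Ω → ℝ) (H s₀ a₀ ν ρ : ℝ) (t : ℝ≥0) (Z : Ω → ℝ) :
    ℝ × ℝ → ℝ≥0∞ :=
  (Set.Ioi (0 : ℝ) ×ˢ Set.Ioi (0 : ℝ)).indicator fun p =>
    ENNReal.ofReal (1 / p.1) * ENNReal.ofReal (1 / (p.2 * |ν|)) *
      (gaussianPDF 0 (t ^ (2 * H)) (Real.log (p.2 / a₀) / ν) *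
        ∫⁻ z : ℝ × ℝ, gaussianPDF (ρ * z.1 - a₀ ^ 2 * z.2 / 2)
          ((1 - ρ ^ 2) * a₀ ^ 2 * z.2).toNNReal (Real.log (p.1 / s₀))
          ∂(condDistrib (fun ω => (Z ω, integratedVar ν BH t ω)) (BH t) P
            (Real.log (p.2 / a₀) / ν)))

theorem measurable_fsabrDensity [IsProbabilityMeasure P] (BH : ℝ≥0 → Ω → ℝ) (H s₀ a₀ ν ρ : ℝ)
    (t : ℝ≥0) (Z : Ω → ℝ) : Measurable (fsabrDensity P BH H s₀ a₀ ν ρ t Z) := by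
  refine Measurable.indicator ?_ (measurableSet_Ioi.prod measurableSet_Ioi)
  have hD := measurable_lintegral_condDistrib_gaussianPDF (P := P)
    (fun ω => (Z ω, integratedVar ν BH t ω)) (BH t)
    (m := fun z : ℝ × ℝ => ρ * z.1 - a₀ ^ 2 * z.2 / 2)
    (V := fun z : ℝ × ℝ => (1 - ρ ^ 2) * a₀ ^ 2 * z.2) (by fun_prop) (by fun_prop)
  have hl : Measurable fun p : ℝ × ℝ => (Real.log (p.1 / s₀), Real.log (p.2 / a₀) / ν) := by
    fun_prop
  have h1 : Measurable fun p : ℝ × ℝ =>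
      ENNReal.ofReal (1 / p.1) * ENNReal.ofReal (1 / (p.2 * |ν|)) := by fun_prop
  have h2 : Measurable fun p : ℝ × ℝ => gaussianPDF 0 (t ^ (2 * H)) (Real.log (p.2 / a₀) / ν) :=
    (measurable_gaussianPDF _ _).comp (by fun_prop)
  exact h1.mul (h2.mul (hD.comp hl))

/-- The extracted |ν| cancels the one in the Jacobian 1/(a|ν|). -/
theorem gaussianPDFReal_log_div {ν τ L : ℝ} (hν : ν ≠ 0) {T : ℝ≥0} (hT : (T : ℝ) = τ) :
    gaussianPDFReal 0 T (L / ν) =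
      |ν| * (Real.exp (-(L ^ 2 / (2 * ν ^ 2 * τ))) / √(2 * Real.pi * ν ^ 2 * τ)) := by
  have h1 : √(2 * Real.pi * ν ^ 2 * τ) = |ν| * √(2 * Real.pi * τ) := by
    rw [show 2 * Real.pi * ν ^ 2 * τ = ν ^ 2 * (2 * Real.pi * τ) by ring,
      Real.sqrt_mul (sq_nonneg _), Real.sqrt_sq_eq_abs]
  have h2 : -(L / ν - 0) ^ 2 / (2 * τ) = -(L ^ 2 / (2 * ν ^ 2 * τ)) := by
    rw [sub_zero, div_pow, neg_div, div_div]
    congr 2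
    ring
  have hν' : |ν| ≠ 0 := abs_ne_zero.2 hν
  rw [gaussianPDFReal, hT, h2, h1, ← mul_div_assoc, mul_div_mul_left _ _ hν']
  exact (div_eq_inv_mul _ _).symm

/-- Since r^{iξ} = exp(iξ log r), the two oscillating factors merge into the integrand of the
Fourier mixture with x = log r. -/
theorem cpow_mul_bridgeCondExp [IsProbabilityMeasure P] {r : ℝ} (hr : 0 < r) (BH : ℝ≥0 → Ω → ℝ)
    (ν ρ a₀ : ℝ) (t : ℝ≥0) (Z : Ω → ℝ) (η ξ : ℝ) :
    (r : ℂ) ^ (Complex.I * (ξ : ℂ)) * bridgeCondExp P BH ν ρ a₀ t Z η ξ =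
      ∫ z : ℝ × ℝ, Complex.exp ((ξ * (Real.log r - (ρ * z.1 - a₀ ^ 2 * z.2 / 2)) : ℝ) *
        Complex.I) * ((Real.exp (-((1 - ρ ^ 2) * a₀ ^ 2 * z.2 / 2 * ξ ^ 2)) : ℝ) : ℂ)
        ∂(condDistrib (fun ω => (Z ω, integratedVar ν BH t ω)) (BH t) P η) := by
  have hr' : (r : ℂ) ≠ 0 := by exact_mod_cast hr.ne'
  rw [bridgeCondExp, ← integral_const_mul]
  refine integral_congr_ae (ae_of_all _ fun z => ?_)
  dsimp only
  rw [Complex.cpow_def_of_ne_zero hr', ← Complex.ofReal_log hr.le, ← mul_assoc, ← Complex.exp_add]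
  congr 2
  push_cast
  ring

/-- The density formula for the joint law. -/
theorem fsabrDensity_eq [IsProbabilityMeasure P] {H s₀ a₀ ν ρ : ℝ} (hs₀ : 0 < s₀)
    (hν : ν ≠ 0) {t : ℝ≥0} (Z : Ω → ℝ) {p : ℝ × ℝ} (hp1 : 0 < p.1)
    (hp2 : 0 < p.2)
    (hV0 : ∀ᵐ z ∂(condDistrib (fun ω => (Z ω, integratedVar ν BH t ω)) (BH t) P
      (Real.log (p.2 / a₀) / ν)), 0 < (1 - ρ ^ 2) * a₀ ^ 2 * z.2)
    (hfin : ∫⁻ z, ENNReal.ofReal (1 / √((1 - ρ ^ 2) * a₀ ^ 2 * z.2))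
      ∂(condDistrib (fun ω => (Z ω, integratedVar ν BH t ω)) (BH t) P
        (Real.log (p.2 / a₀) / ν)) ≠ ⊤) :
    Integrable (fun ξ : ℝ => ((p.1 / s₀ : ℝ) : ℂ) ^ (Complex.I * (ξ : ℂ)) *
      bridgeCondExp P BH ν ρ a₀ t Z (Real.log (p.2 / a₀) / ν) ξ) ∧
    ((fsabrDensity P BH H s₀ a₀ ν ρ t Z p).toReal : ℂ) =
      ((Real.exp (-(Real.log (p.2 / a₀) ^ 2 / (2 * ν ^ 2 * (t : ℝ) ^ (2 * H)))) /
        (p.2 * √(2 * Real.pi * ν ^ 2 * (t : ℝ) ^ (2 * H))) : ℝ) : ℂ) *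
      ((1 / (2 * Real.pi * p.1) : ℝ) : ℂ) *
      ∫ ξ : ℝ, ((p.1 / s₀ : ℝ) : ℂ) ^ (Complex.I * (ξ : ℂ)) *
        bridgeCondExp P BH ν ρ a₀ t Z (Real.log (p.2 / a₀) / ν) ξ := by
  have hm : Measurable fun z : ℝ × ℝ => ρ * z.1 - a₀ ^ 2 * z.2 / 2 := by fun_prop
  have hV : Measurable fun z : ℝ × ℝ => (1 - ρ ^ 2) * a₀ ^ 2 * z.2 := by fun_prop
  simp only [cpow_mul_bridgeCondExp (div_pos hp1 hs₀)]
  refine ⟨integrable_integral_fourier_mixture hm hV hV0 hfin _, ?_⟩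
  rw [integral_integral_fourier_mixture hm hV hV0 hfin, ← Complex.ofReal_mul,
    ← Complex.ofReal_mul, Complex.ofReal_inj]
  have hmem : p ∈ Set.Ioi (0 : ℝ) ×ˢ Set.Ioi (0 : ℝ) := ⟨hp1, hp2⟩
  rw [fsabrDensity, Set.indicator_of_mem hmem, ENNReal.toReal_mul, ENNReal.toReal_mul,
    ENNReal.toReal_mul, ENNReal.toReal_ofReal (by positivity),
    ENNReal.toReal_ofReal (by positivity), gaussianPDF,
    ENNReal.toReal_ofReal (gaussianPDFReal_nonneg _ _ _),
    gaussianPDFReal_log_div hν (NNReal.coe_rpow t (2 * H))]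
  generalize √(2 * Real.pi * ν ^ 2 * (t : ℝ) ^ (2 * H)) = A
  generalize Real.exp (-(Real.log (p.2 / a₀) ^ 2 / (2 * ν ^ 2 * (t : ℝ) ^ (2 * H)))) = A'
  generalize (∫⁻ z : ℝ × ℝ, gaussianPDF (ρ * z.1 - a₀ ^ 2 * z.2 / 2)
          ((1 - ρ ^ 2) * a₀ ^ 2 * z.2).toNNReal (Real.log (p.1 / s₀))
          ∂(condDistrib (fun ω => (Z ω, integratedVar ν BH t ω)) (BH t) P
            (Real.log (p.2 / a₀) / ν))).toReal = D
  have hν' : |ν| ≠ 0 := abs_ne_zero.2 hν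
  have hpi := Real.pi_pos
  field_simp

theorem aestronglyMeasurable_comap_fsabrVol
    {a₀ ν : ℝ} (h : ∀ s, AEStronglyMeasurable[MeasurableSpace.comap (fun ω t => B t ω) inferInstance]
      (BH s) P) (s : ℝ≥0) :
    AEStronglyMeasurable[MeasurableSpace.comap (fun ω t => B t ω) inferInstance]
      (fsabrVol a₀ ν BH s) P := by
  have hc : Continuous fun x : ℝ => a₀ * Real.exp (ν * x) := by fun_prop
  exact hc.comp_aestronglyMeasurable (h s)

theorem aemeasurable_integratedVar (hBHc : ∀ ω, Continuous fun s => BH s ω)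
    (hBHm : ∀ s, Measurable (BH s)) (ν : ℝ) (t : ℝ≥0) :
    AEMeasurable (fun ω => integratedVar ν BH t ω) P := by
  have h := aestronglyMeasurable_comap_integral_sq (P := P) (m := mΩ) (α := fsabrVol 1 ν BH)
    (fun ω => continuous_fsabrVol (hBHc ω)) (fun s =>
      (((hBHm s).const_mul ν).exp.const_mul 1).aestronglyMeasurable) t
  refine h.aemeasurable.congr (ae_of_all _ fun ω => ?_)
  simp only [integral_fsabrVol_sq, one_pow, one_mul]

section Core

variable [IsProbabilityMeasure P]

theorem aestronglyMeasurable_comap_of_fractional (hB : IsFilteredBrownian F P B) {H : ℝ}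
    (hBHi : ∀ t : ℝ≥0, IsItoIntegral F P B (fun s _ => molchanGolosov H t s) t (BH t)) (s : ℝ≥0) :
    AEStronglyMeasurable[MeasurableSpace.comap (fun ω t => B t ω) inferInstance] (BH s) P := by
  obtain ⟨I', hI', h⟩ := IsItoIntegral.exists_measurable_comap (K := fun r : ℝ≥0 =>
    molchanGolosov H s r) hB (hBHi s)
  exact ⟨I', hI'.stronglyMeasurable, h⟩

/-- S_t is a function of (m + ρ'Y, B^H_t), whose law is a Gaussian mixture with the measure
conditioned on B^H_t; exponentiating both coordinates gives the density. -/
theorem map_fsabr_eq_withDensity (hF : UsualConditions F P)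
    (hB : IsFilteredBrownian F P B) (hW : IsFilteredBrownian F P W)
    (hBW : IndepFun (fun ω t => B t ω) (fun ω t => W t ω) P) {H : ℝ} (hH : H ∈ Set.Ioo (0 : ℝ) 1)
    (hBHa : Adapted F BH) (hBHc : ∀ ω, Continuous fun s => BH s ω)
    (hBHi : ∀ t : ℝ≥0, IsItoIntegral F P B (fun s _ => molchanGolosov H t s) t (BH t))
    {s₀ a₀ ν ρ : ℝ} (hs₀ : 0 < s₀) (ha₀ : 0 < a₀) (hν : ν ≠ 0) (hρ : ρ ∈ Set.Ioo (-1 : ℝ) 1)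
    (hSa : Adapted F S) (hSc : ∀ ω, Continuous fun s => S s ω)
    (hsde : ∀ t : ℝ≥0, ∃ I J : Ω → ℝ,
      IsItoIntegral F P B (fun r ω => fsabrVol a₀ ν BH r ω * S r ω) t I ∧
      IsItoIntegral F P W (fun r ω => fsabrVol a₀ ν BH r ω * S r ω) t J ∧
      ∀ᵐ ω ∂P, S t ω = s₀ + (ρ * I ω + √(1 - ρ ^ 2) * J ω))
    {t : ℝ≥0} (ht : 0 < t) {Z : Ω → ℝ} (hZ : IsItoIntegral F P B (fsabrVol a₀ ν BH) t Z) :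
    P.map (fun ω => (S t ω, fsabrVol a₀ ν BH t ω)) =
      (volume : Measure (ℝ × ℝ)).withDensity (fsabrDensity P BH H s₀ a₀ ν ρ t Z) := by
  have hρ2 : 0 < 1 - ρ ^ 2 := by nlinarith [hρ.1, hρ.2]
  have hαa := adapted_fsabrVol a₀ ν hBHa
  have hαc : ∀ ω, Continuous fun s => fsabrVol a₀ ν BH s ω := fun ω => continuous_fsabrVol (hBHc ω)
  have hBHB := aestronglyMeasurable_comap_of_fractional hB hBHi
  have hαB := aestronglyMeasurable_comap_fsabrVol (a₀ := a₀) (ν := ν) hBHB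
  obtain ⟨Y, hY⟩ := exists_isItoIntegral hW hαa hαc t
  have hYm : AEMeasurable Y P := ((hY.measurable hF hW).mono (F.le t) le_rfl).aemeasurable
  have hZm : AEMeasurable Z P := ((hZ.measurable hF hB).mono (F.le t) le_rfl).aemeasurable
  have hBHm : ∀ s, Measurable (BH s) := fun s => (hBHa s).mono (F.le s) le_rfl
  have hvm := aemeasurable_integratedVar (P := P) hBHc hBHm ν t
  have hZB := hZ.aestronglyMeasurable_comap hB hαa hαc hαB
  have hqB := aestronglyMeasurable_comap_integral_sq hαc hαB t
  set ζ : Ω → ℝ × ℝ := fun ω => (Z ω, integratedVar ν BH t ω) with hζ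
  set m : ℝ × ℝ → ℝ := fun z => ρ * z.1 - a₀ ^ 2 * z.2 / 2 with hm
  set V : ℝ × ℝ → ℝ := fun z => (1 - ρ ^ 2) * a₀ ^ 2 * z.2 with hV
  have hmB : AEStronglyMeasurable[MeasurableSpace.comap (fun ω t => B t ω) inferInstance]
      (fun ω => m (ζ ω)) P := by
    have h1 : AEStronglyMeasurable[MeasurableSpace.comap (fun ω t => B t ω) inferInstance]
      (fun ω => ρ * Z ω - 1 / 2 * ∫ s in (0 : ℝ)..t, fsabrVol a₀ ν BH s.toNNReal ω ^ 2) P :=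
      (hZB.const_mul ρ).sub (hqB.const_mul (1 / 2))
    refine h1.congr (ae_of_all _ fun ω => ?_)
    simp only [hm, hζ, integral_fsabrVol_sq]
    ring
  have hT : t ^ (2 * H) ≠ 0 := (NNReal.rpow_pos ht).ne'
  have hlaw := IsItoIntegral.hasLaw_gaussian (K := fun r : ℝ≥0 => molchanGolosov H t r) hB (hBHi t)
    (lintegral_molchanGolosov_sq hH t)
  have hVpos : ∀ ω, 0 < V (ζ ω) := fun ω => by
    have := integratedVar_pos (ν := ν) (hBHc ω) ht
    simp only [hV, hζ]
    positivity
  have hS : ∀ᵐ ω ∂P, S t ω = s₀ * Real.exp (m (ζ ω) + √(1 - ρ ^ 2) * Y ω) := by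
    filter_upwards [ae_eq_mul_exp_of_sde hB hW hBW hαa hαc hαB hSa hSc
      (show ρ ^ 2 + √(1 - ρ ^ 2) ^ 2 = 1 by rw [Real.sq_sqrt hρ2.le]; ring) hsde ht hZ hY]
      with ω hω
    rw [hω, integral_fsabrVol_sq]
    simp only [hm, hζ]
    congr 2
    ring
  have hX := hY.map_add_mul_prodMk hB.measurable hW hBW hαa hαc hαB hYm hmB (hBHB t)
    (√(1 - ρ ^ 2))
  have hsq : ∀ ω, √(1 - ρ ^ 2) * √(∫ s in (0 : ℝ)..t, fsabrVol a₀ ν BH s.toNNReal ω ^ 2) =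
      √(V (ζ ω)) := by
    intro ω
    rw [integral_fsabrVol_sq, ← Real.sqrt_mul hρ2.le]
    simp only [hV, hζ, mul_assoc]
  simp only [hsq] at hX
  rw [map_mixture_eq_withDensity (hZm.prodMk hvm) (hBHm t).aemeasurable hT hlaw.map_eq
    (m := m) (V := V) (by fun_prop) (by fun_prop) (ae_of_all _ hVpos)] at hX
  have hXm : AEMeasurable (fun ω => (m (ζ ω) + √(1 - ρ ^ 2) * Y ω, BH t ω)) P := by
    have h1 : AEMeasurable (fun ω => m (ζ ω)) P :=
      (show Measurable m by fun_prop).comp_aemeasurable (hZm.prodMk hvm)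
    exact (h1.add (hYm.const_mul _)).prodMk (hBHm t).aemeasurable
  have hE : Measurable fun p : ℝ × ℝ => (s₀ * Real.exp p.1, a₀ * Real.exp (ν * p.2)) := by
    fun_prop
  have hfm := ((measurable_gaussianPDF 0 (t ^ (2 * H))).comp measurable_snd).mul
    (measurable_lintegral_condDistrib_gaussianPDF (P := P) ζ (BH t) (m := m) (V := V)
      (by fun_prop) (by fun_prop))
  have h2 := withDensity_map_exp hs₀ ha₀ hν hfm
  have h3 : P.map (fun ω => (S t ω, fsabrVol a₀ ν BH t ω)) =
      (P.map (fun ω => (m (ζ ω) + √(1 - ρ ^ 2) * Y ω, BH t ω))).map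
        (fun p => (s₀ * Real.exp p.1, a₀ * Real.exp (ν * p.2))) := by
    rw [AEMeasurable.map_map_of_aemeasurable hE.aemeasurable hXm]
    refine Measure.map_congr ?_
    filter_upwards [hS] with ω hω
    rw [hω]
    rfl
  rw [h3, hX]
  exact h2

theorem fsabr_density_of_continuous (hF : UsualConditions F P)
    (hB : IsFilteredBrownian F P B) (hW : IsFilteredBrownian F P W)
    (hBW : IndepFun (fun ω t => B t ω) (fun ω t => W t ω) P) {H : ℝ} (hH : H ∈ Set.Ioo (0 : ℝ) 1)
    (hBHa : Adapted F BH) (hBHc : ∀ ω, Continuous fun s => BH s ω)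
    (hBHi : ∀ t : ℝ≥0, IsItoIntegral F P B (fun s _ => molchanGolosov H t s) t (BH t))
    {s₀ a₀ ν ρ : ℝ} (hs₀ : 0 < s₀) (ha₀ : 0 < a₀) (hν : ν ≠ 0) (hρ : ρ ∈ Set.Ioo (-1 : ℝ) 1)
    (hSa : Adapted F S) (hSc : ∀ ω, Continuous fun s => S s ω)
    (hsde : ∀ t : ℝ≥0, ∃ I J : Ω → ℝ,
      IsItoIntegral F P B (fun r ω => fsabrVol a₀ ν BH r ω * S r ω) t I ∧
      IsItoIntegral F P W (fun r ω => fsabrVol a₀ ν BH r ω * S r ω) t J ∧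
      ∀ᵐ ω ∂P, S t ω = s₀ + (ρ * I ω + √(1 - ρ ^ 2) * J ω))
    {t : ℝ≥0} (ht : 0 < t) :
    HasPDF (fun ω => (S t ω, fsabrVol a₀ ν BH t ω)) P volume ∧
    (∃ Z : Ω → ℝ, IsItoIntegral F P B (fsabrVol a₀ ν BH) t Z) ∧
    ∀ Z : Ω → ℝ, IsItoIntegral F P B (fsabrVol a₀ ν BH) t Z →
      ∀ᵐ p : ℝ × ℝ,
        (¬ (0 < p.1 ∧ 0 < p.2) →
          pdf (fun ω => (S t ω, fsabrVol a₀ ν BH t ω)) P volume p = 0) ∧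
        (0 < p.1 ∧ 0 < p.2 →
          Integrable (fun ξ : ℝ => ((p.1 / s₀ : ℝ) : ℂ) ^ (Complex.I * (ξ : ℂ)) *
            bridgeCondExp P BH ν ρ a₀ t Z (Real.log (p.2 / a₀) / ν) ξ) ∧
          ((pdf (fun ω => (S t ω, fsabrVol a₀ ν BH t ω)) P volume p).toReal : ℂ) =
            ((Real.exp (-(Real.log (p.2 / a₀) ^ 2 / (2 * ν ^ 2 * (t : ℝ) ^ (2 * H)))) /
              (p.2 * √(2 * Real.pi * ν ^ 2 * (t : ℝ) ^ (2 * H))) : ℝ) : ℂ) *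
            ((1 / (2 * Real.pi * p.1) : ℝ) : ℂ) *
            ∫ ξ : ℝ, ((p.1 / s₀ : ℝ) : ℂ) ^ (Complex.I * (ξ : ℂ)) *
              bridgeCondExp P BH ν ρ a₀ t Z (Real.log (p.2 / a₀) / ν) ξ) := by
  have hρ2 : 0 < 1 - ρ ^ 2 := by nlinarith [hρ.1, hρ.2]
  have hαa := adapted_fsabrVol a₀ ν hBHa
  have hαc : ∀ ω, Continuous fun s => fsabrVol a₀ ν BH s ω := fun ω => continuous_fsabrVol (hBHc ω)
  have hBHm : ∀ s, Measurable (BH s) := fun s => (hBHa s).mono (F.le s) le_rfl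
  have hmeas : AEMeasurable (fun ω => (S t ω, fsabrVol a₀ ν BH t ω)) P :=
    (((hSa t).mono (F.le t) le_rfl).prodMk ((hαa t).mono (F.le t) le_rfl)).aemeasurable
  have hmap := fun {Z : Ω → ℝ} (hZ : IsItoIntegral F P B (fsabrVol a₀ ν BH) t Z) =>
    map_fsabr_eq_withDensity hF hB hW hBW hH hBHa hBHc hBHi hs₀ ha₀ hν hρ hSa hSc hsde ht hZ
  obtain ⟨Z₀, hZ₀⟩ := exists_isItoIntegral hB hαa hαc t
  have hpdf : HasPDF (fun ω => (S t ω, fsabrVol a₀ ν BH t ω)) P volume :=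
    hasPDF_of_map_eq_withDensity hmeas _
      (measurable_fsabrDensity BH H s₀ a₀ ν ρ t Z₀).aemeasurable (hmap hZ₀)
  refine ⟨hpdf, ⟨Z₀, hZ₀⟩, fun Z hZ => ?_⟩
  have hZm : AEMeasurable Z P := ((hZ.measurable hF hB).mono (F.le t) le_rfl).aemeasurable
  have hvm := aemeasurable_integratedVar (P := P) hBHc hBHm ν t
  have hae := (pdf.eq_of_map_eq_withDensity _
    (measurable_fsabrDensity BH H s₀ a₀ ν ρ t Z).aemeasurable).1 (hmap hZ)
  have hlaw : ∀ s, HasLaw (BH s) (gaussianReal 0 (s ^ (2 * H))) P := fun s =>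
    IsItoIntegral.hasLaw_gaussian (K := fun r : ℝ≥0 => molchanGolosov H s r) hB (hBHi s)
      (lintegral_molchanGolosov_sq hH s)
  have hfin := lintegral_one_div_sqrt_integratedVar_ne_top hBHm hBHc ht hlaw
    (T := t ^ (2 * H)) (fun s hs => NNReal.rpow_le_rpow hs (by linarith [hH.1])) ν
  have hfin' : ∫⁻ ω, ENNReal.ofReal (1 / √((1 - ρ ^ 2) * a₀ ^ 2 * integratedVar ν BH t ω)) ∂P ≠
      ⊤ := by
    have e : ∀ ω, ENNReal.ofReal (1 / √((1 - ρ ^ 2) * a₀ ^ 2 * integratedVar ν BH t ω)) =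
        ENNReal.ofReal (1 / √((1 - ρ ^ 2) * a₀ ^ 2)) *
          ENNReal.ofReal (1 / √(integratedVar ν BH t ω)) := by
      intro ω
      rw [← ENNReal.ofReal_mul (by positivity), Real.sqrt_mul (by positivity), one_div_mul_one_div]
    simp only [e]
    rw [lintegral_const_mul' _ _ ENNReal.ofReal_ne_top]
    exact ENNReal.mul_ne_top ENNReal.ofReal_ne_top hfin
  have hgood := ae_condDistrib_of_lintegral_ne_top (P := P) (hZm.prodMk hvm) (hBHm t).aemeasurable
    (NNReal.rpow_pos ht).ne' (hlaw t).map_eq (V := fun z => (1 - ρ ^ 2) * a₀ ^ 2 * z.2)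
    (by fun_prop) (ae_of_all _ fun ω => by
      have := integratedVar_pos (ν := ν) (hBHc ω) ht
      dsimp only
      positivity) hfin'
  -- The exceptional values of B^H_t form a null set, pulled back through the logarithm and then to
  -- the plane by the second projection.
  have hgood' : ∀ᵐ p : ℝ × ℝ, 0 < p.2 → _ :=
    Measure.quasiMeasurePreserving_snd.ae (ae_pos_imp_log ha₀ hν hgood)
  filter_upwards [hae, hgood'] with p hp hg
  rw [hp]
  refine ⟨fun h => ?_, fun h => ?_⟩
  · exact Set.indicator_of_notMem (fun hmem => h ⟨hmem.1, hmem.2⟩) _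
  · exact fsabrDensity_eq hs₀ hν Z h.1 h.2 (hg h.2).1 (hg h.2).2

end Core

/-- A process with almost surely continuous adapted paths has an everywhere continuous adapted
modification. -/
theorem UsualConditions.exists_continuous_adapted (hF : UsualConditions F P) {X : ℝ≥0 → Ω → ℝ}
    (hX : Adapted F X) (hc : ∀ᵐ ω ∂P, Continuous fun s => X s ω) :
    ∃ X' : ℝ≥0 → Ω → ℝ, Adapted F X' ∧ (∀ ω, Continuous fun s => X' s ω) ∧
      ∀ᵐ ω ∂P, ∀ s, X s ω = X' s ω := by
  classical
  refine ⟨fun s ω => if Continuous (fun s => X s ω) then X s ω else 0, fun s => ?_, fun ω => ?_, ?_⟩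
  · refine hF.measurable_congr (hX s) ?_
    filter_upwards [hc] with ω hω
    exact if_pos hω
  · by_cases h : Continuous (fun s => X s ω)
    · simpa only [if_pos h] using h
    · simpa only [if_neg h] using continuous_const
  · filter_upwards [hc] with ω hω s
    exact (if_pos hω).symm

end FSABR

/-! ### Reduction to everywhere continuous paths. -/

theorem mainTheorem2 {Ω : Type*} {mΩ : MeasurableSpace Ω} (P : Measure Ω) [IsProbabilityMeasure P]
    (F : Filtration ℝ≥0 mΩ) (hF : UsualConditions F P)
    (B W : ℝ≥0 → Ω → ℝ) (hB : IsFilteredBrownian F P B) (hW : IsFilteredBrownian F P W)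
    (hBW : IndepFun (fun ω t => B t ω) (fun ω t => W t ω) P)
    (H : ℝ) (hH : H ∈ Set.Ioo (0 : ℝ) 1)
    (BH : ℝ≥0 → Ω → ℝ) (hBH : IsFractionalBrownian F P B H BH)
    (s₀ a₀ ν ρ : ℝ) (hs₀ : 0 < s₀) (ha₀ : 0 < a₀) (hν : ν ≠ 0) (hρ : ρ ∈ Set.Ioo (-1 : ℝ) 1)
    (S : ℝ≥0 → Ω → ℝ) (hS : IsFSABRSpot F P B W s₀ ρ (fsabrVol a₀ ν BH) S)
    (t : ℝ≥0) (ht : 0 < t) :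
    HasPDF (fun ω => (S t ω, fsabrVol a₀ ν BH t ω)) P volume ∧
    (∃ Z : Ω → ℝ, IsItoIntegral F P B (fsabrVol a₀ ν BH) t Z) ∧
    ∀ Z : Ω → ℝ, IsItoIntegral F P B (fsabrVol a₀ ν BH) t Z →
      ∀ᵐ p : ℝ × ℝ,
        (¬ (0 < p.1 ∧ 0 < p.2) →
          pdf (fun ω => (S t ω, fsabrVol a₀ ν BH t ω)) P volume p = 0) ∧
        (0 < p.1 ∧ 0 < p.2 →
          Integrable (fun ξ : ℝ => ((p.1 / s₀ : ℝ) : ℂ) ^ (Complex.I * (ξ : ℂ)) *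
            bridgeCondExp P BH ν ρ a₀ t Z (Real.log (p.2 / a₀) / ν) ξ) ∧
          ((pdf (fun ω => (S t ω, fsabrVol a₀ ν BH t ω)) P volume p).toReal : ℂ) =
            ((Real.exp (-(Real.log (p.2 / a₀) ^ 2 / (2 * ν ^ 2 * (t : ℝ) ^ (2 * H)))) /
              (p.2 * √(2 * Real.pi * ν ^ 2 * (t : ℝ) ^ (2 * H))) : ℝ) : ℂ) *
            ((1 / (2 * Real.pi * p.1) : ℝ) : ℂ) *
            ∫ ξ : ℝ, ((p.1 / s₀ : ℝ) : ℂ) ^ (Complex.I * (ξ : ℂ)) *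
              bridgeCondExp P BH ν ρ a₀ t Z (Real.log (p.2 / a₀) / ν) ξ) := by
  have hBHa : Adapted F BH := fun s => (hBH.integral s).measurable hF hB
  -- B^H and S are replaced by indistinguishable, everywhere continuous adapted versions. Itô
  -- integrals, the density and the conditional distributions see processes only up to such changes,
  -- so the conclusion transfers back.
  obtain ⟨BH', hBHa', hBHc', hBH'⟩ := hF.exists_continuous_adapted hBHa hBH.continuous
  obtain ⟨S', hSa', hSc', hS'⟩ := hF.exists_continuous_adapted hS.adapted hS.continuous
  have hBHi' : ∀ t : ℝ≥0, IsItoIntegral F P B (fun s _ => molchanGolosov H t s) t (BH' t) :=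
    fun t => ⟨(hBH.integral t).1, by
      obtain ⟨V, h1, h2⟩ := (hBH.integral t).2
      exact ⟨V, h1, h2.congr_right (hBH'.mono fun ω hω => hω t)⟩⟩
  have hα' : ∀ᵐ ω ∂P, ∀ s, fsabrVol a₀ ν BH s ω = fsabrVol a₀ ν BH' s ω := by
    filter_upwards [hBH'] with ω hω s
    simp only [fsabrVol, hω s]
  have hprod : ∀ᵐ ω ∂P, ∀ s, fsabrVol a₀ ν BH s ω * S s ω = fsabrVol a₀ ν BH' s ω * S' s ω := by
    filter_upwards [hα', hS'] with ω h1 h2 s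
    rw [h1, h2]
  have hsde' : ∀ t : ℝ≥0, ∃ I J : Ω → ℝ,
      IsItoIntegral F P B (fun r ω => fsabrVol a₀ ν BH' r ω * S' r ω) t I ∧
      IsItoIntegral F P W (fun r ω => fsabrVol a₀ ν BH' r ω * S' r ω) t J ∧
      ∀ᵐ ω ∂P, S' t ω = s₀ + (ρ * I ω + √(1 - ρ ^ 2) * J ω) := by
    intro t
    obtain ⟨I, J, hI, hJ, h⟩ := hS.sde t
    refine ⟨I, J, hI.congr hprod, hJ.congr hprod, ?_⟩
    filter_upwards [h, hS'] with ω h1 h2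
    rw [← h2, h1]
  obtain ⟨h1, ⟨Z, hZ⟩, h3⟩ := fsabr_density_of_continuous hF hB hW hBW hH hBHa' hBHc' hBHi' hs₀
    ha₀ hν hρ hSa' hSc' hsde' ht
  have hpair : (fun ω => (S t ω, fsabrVol a₀ ν BH t ω)) =ᵐ[P]
      fun ω => (S' t ω, fsabrVol a₀ ν BH' t ω) := by
    filter_upwards [hα', hS'] with ω h1 h2
    rw [h1, h2]
  have hpdf : pdf (fun ω => (S t ω, fsabrVol a₀ ν BH t ω)) P volume =
      pdf (fun ω => (S' t ω, fsabrVol a₀ ν BH' t ω)) P volume := by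
    rw [pdf_def, pdf_def, Measure.map_congr hpair]
  have hbridge : ∀ Z : Ω → ℝ, bridgeCondExp P BH ν ρ a₀ t Z = bridgeCondExp P BH' ν ρ a₀ t Z := by
    intro Z
    have hv : (fun ω => (Z ω, integratedVar ν BH t ω)) =ᵐ[P]
        fun ω => (Z ω, integratedVar ν BH' t ω) := by
      filter_upwards [hBH'] with ω hω
      simp only [integratedVar, hω]
    funext η ξ
    rw [bridgeCondExp, bridgeCondExp, condDistrib_congr hv (hBH'.mono fun ω hω => hω t)]
  refine ⟨(HasPDF.congr_iff hpair).2 h1, ⟨Z, hZ.congr (hα'.mono fun ω hω s => (hω s).symm)⟩,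
    fun Z hZ => ?_⟩
  rw [hpdf, hbridge]
  exact h3 Z (hZ.congr hα')
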